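/- For $z=(x,y)\in[-\frac12,\frac12)^2$ with $z\notin(\frac12\mathbb Z)^2$, let $M(z)$ be the translation surface obtained from two copies of the square torus $\mathbb R^2/\mathbb Z^2$, each slit along the projection of the straight segment of $[-\frac12,\frac12]^2$ from $-z$ to $z$, by gluing the two copies crosswise along the slit; the 1-form $\omega$ is induced by $dz$, and the two singularities are $\bullet$ (at $z$) and $\circ$ (at $-z$). Let $H_1^{(0)}(M(z);\mathbb Z)\subset H_1(M(z);\mathbb Z)$ be the group of the classes $\gamma$ with zero holonomy $\int_\gamma\omega=0$. For $g\in\mathrm{SL}(2,\mathbb Z)$, we write $g\cdot M(z)=M(z)$ if $gz\equiv z\pmod{\mathbb Z^2}$ and there is an affine homeomorphism $M(z)\to M(z)$ with derivative $g$ that fixes each of the two singularities. In this case we write $g_*(z)=\mathrm{id}$ if every affine homeomorphism $M(z)\to M(z)$ with derivative $g$ (mapping singularities to singularities) acts on $H_1^{(0)}(M(z);\mathbb Z)$ as $+\mathrm{id}$ or as $-\mathrm{id}$; the sign cannot be fixed, because the involution of $M(z)$ that exchanges the two tori has derivative $\mathrm{id}$ and acts as $-\mathrm{id}$. Let $h_+=\begin{pmatrix}1&1\\0&1\end{pmatrix}$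 and $h_-=\begin{pmatrix}1&0\\1&1\end{pmatrix}$. Let $r,s,q$ be integers with $|r|,|s|<q$, with $s\neq0$ coprime with $q$, and with at least one of $r,s$ odd, and let $z=\left(\frac r{2q},\frac s{2q}\right)$. Let $a,d$ be natural numbers such that $$4q<a,d\le 6q,\qquad r+as\equiv-q\pmod{2q},\qquad ds-r\equiv-q\pmod{2q},$$ and let $n=8qm$ for some $m\in\mathbb N$ (with $m=0$ allowed). Then the matrix $$g_z(n)=h_+^{d-1}\,h_-\,h_+\,h_-^{d}\,h_+^{n}\,h_-^{a-1}\,h_+\,h_-\,h_+^{a}\,h_-^{n}\in\mathrm{SL}(2,\mathbb Z)$$ satisfies $$g_z(n)\cdot M(z)=M(z)\qquad\text{and}\qquad (g_z(n))_*(z)=\mathrm{id}.$$ -/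

import Mathlib

open CategoryTheory Topology

noncomputable section

namespace SlitTori

/-! ### The torus and the matrices -/

/-- The Euclidean plane, in coordinates `(x, y)`. -/
abbrev Plane : Type := Fin 2 → ℝ

/-- The square torus `ℝ² / ℤ²`. -/
abbrev Torus : Type := UnitAddTorus (Fin 2)

/-- The projection `ℝ² → ℝ² / ℤ²`. -/
def toTorus (p : Plane) : Torus := fun k => (p k : UnitAddCircle)

/-- The linear action of an integer matrix on the plane. -/
def act (g : Matrix.SpecialLinearGroup (Fin 2) ℤ) (p : Plane) : Plane :=
  ((g : Matrix (Fin 2) (Fin 2) ℤ).map (Int.cast : ℤ → ℝ)).mulVec p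

/-- The matrix `(1 1; 0 1)`. -/
def hPlus : Matrix.SpecialLinearGroup (Fin 2) ℤ :=
  ⟨!![1, 1; 0, 1], by simp [Matrix.det_fin_two]⟩

/-- The matrix `(1 0; 1 1)`. -/
def hMinus : Matrix.SpecialLinearGroup (Fin 2) ℤ :=
  ⟨!![1, 0; 1, 1], by simp [Matrix.det_fin_two]⟩

/-- The word `h₊^(d-1) h₋ h₊ h₋^d h₊^n h₋^(a-1) h₊ h₋ h₊^a h₋^n`. -/
def gWord (a d n : ℕ) : Matrix.SpecialLinearGroup (Fin 2) ℤ :=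
  hPlus ^ (d - 1) * hMinus * hPlus * hMinus ^ d * hPlus ^ n *
    hMinus ^ (a - 1) * hPlus * hMinus * hPlus ^ a * hMinus ^ n

/-! ### The surface `M(z)`

The point `z` is always taken in `[-1/2, 1/2)²`, away from the four points with coordinates in
`{-1/2, 0}`. The square `[-1/2, 1/2]²` is cut along the line `ℝ z` through its centre into two
closed halves, and two copies (sheets) of each half are taken. Opposite sides of the square are
glued by translation within each sheet, and the two halves are glued along the cutting line:
within the same sheet off the slit, and crosswise along the slit, which is the segment from
`-z` to `z`. So `M(z)` is two square tori glued along the slit from `-z` to `z`. -/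

/-- The determinant of the pair `(z, p)`: its sign says on which side of `ℝ z` the point `p`
lies, and it vanishes on the line `ℝ z`. -/
def side (z p : Plane) : ℝ := z 0 * p 1 - z 1 * p 0

/-- The two closed halves of the square `[-1/2, 1/2]²` cut along the line `ℝ z`. -/
def halfSquare (z : Plane) (σ : Bool) : Set Plane :=
  {p | (∀ k, |p k| ≤ 1 / 2) ∧ if σ then 0 ≤ side z p else side z p ≤ 0}

/-- The disjoint union of the four polygons: a point is `(p, σ, i)`, where `p` is a point of the
half-square `σ` and `i` is the sheet. -/
abbrev Pieces (z : Plane) : Type :=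
  {x : Plane × Bool × Bool // x.1 ∈ halfSquare z x.2.1}

/-- The gluings of the four polygons. -/
inductive Glue (z : Plane) : Pieces z → Pieces z → Prop
  /-- Off the (open) slit the two halves are glued along the line `ℝ z` within one sheet. -/
  | line (p : Plane) (σ i : Bool) (h : p ∈ halfSquare z σ) (h' : p ∈ halfSquare z (!σ))
      (hp : p ∉ openSegment ℝ (-z) z) : Glue z ⟨(p, σ, i), h⟩ ⟨(p, !σ, i), h'⟩
  /-- Along the slit the two halves are glued crosswise. -/
  | slit (p : Plane) (σ i : Bool) (h : p ∈ halfSquare z σ) (h' : p ∈ halfSquare z (!σ))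
      (hp : p ∈ segment ℝ (-z) z) : Glue z ⟨(p, σ, i), h⟩ ⟨(p, !σ, !i), h'⟩
  /-- Opposite sides of the square are glued by the unit translation within one sheet. -/
  | edge (p : Plane) (k : Fin 2) (σ σ' i : Bool) (h : p ∈ halfSquare z σ)
      (h' : p + Pi.single k 1 ∈ halfSquare z σ') :
      Glue z ⟨(p, σ, i), h⟩ ⟨(p + Pi.single k 1, σ', i), h'⟩

/-- The surface `M(z)`, with the quotient topology. -/
def M (z : Plane) : Type := Quot (Glue z)

instance (z : Plane) : TopologicalSpace (M z) :=
  inferInstanceAs (TopologicalSpace (Quot (Glue z)))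

theorem toTorus_eq_of_glue {z : Plane} {x y : Pieces z} (h : Glue z x y) :
    toTorus x.1.1 = toTorus y.1.1 := by
  cases h with
  | line => rfl
  | slit => rfl
  | edge p k =>
    funext j
    simp only [toTorus, Pi.add_apply, AddCircle.coe_add]
    by_cases hj : j = k
    · subst hj
      simp
    · simp [Pi.single_eq_of_ne hj]

/-- The projection `M(z) → ℝ² / ℤ²` that forgets the sheet. Away from the singularities it is a
local homeomorphism, and the translation structure (the form `ω = dz`) of `M(z)` is the pull-back
of the one of the torus: the local coordinates of `M(z)` are those of this projection. -/
def proj (z : Plane) : C(M z, Torus) where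
  toFun := Quot.lift (fun x => toTorus x.1.1) fun _ _ h => toTorus_eq_of_glue h
  continuous_toFun := by
    refine continuous_quot_lift _ (continuous_pi fun k => ?_)
    exact (AddCircle.continuous_mk' 1).comp
      ((continuous_apply k).comp (continuous_fst.comp continuous_subtype_val))

/-- The singularity `•` at the endpoint `z` of the slit (a set with one element). -/
def bullet (z : Plane) : Set (M z) := {m | proj z m = toTorus z}

/-- The singularity `∘` at the endpoint `-z` of the slit (a set with one element). -/
def circ (z : Plane) : Set (M z) := {m | proj z m = toTorus (-z)}

/-- The set of singularities of `M(z)`. -/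
def sing (z : Plane) : Set (M z) := bullet z ∪ circ z

/-- A homeomorphism `M(z) → M(z')` is affine with derivative `g` if it maps singularities to
singularities and, in the translation coordinates near every nonsingular point, it is affine with
linear part `g`. Equivalently, it is a translation equivalence `g · M(z) → M(z')`. -/
structure IsAffineWithDerivative (g : Matrix.SpecialLinearGroup (Fin 2) ℤ) {z z' : Plane}
    (f : M z ≃ₜ M z') : Prop where
  map_sing : ∀ m ∈ sing z, f m ∈ sing z'
  affine : ∀ m ∉ sing z, ∀ᶠ m' in 𝓝 m, ∃ v : Plane, (∀ k, |v k| < 1 / 2) ∧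
    proj z m' = proj z m + toTorus v ∧ proj z' (f m') = proj z' (f m) + toTorus (act g v)

/-! ### Homology and holonomy -/

/-- The singular chain complex of `M(z)` with integer coefficients. -/
abbrev chains (z : Plane) : ChainComplex (ModuleCat.{0} ℤ) ℕ :=
  ((AlgebraicTopology.singularChainComplexFunctor (ModuleCat.{0} ℤ)).obj (ModuleCat.of ℤ ℤ)).obj
    (TopCat.of (M z))

/-- The first singular homology group `H₁(M(z); ℤ)`. -/
abbrev H1 (z : Plane) : ModuleCat.{0} ℤ :=
  ((AlgebraicTopology.singularHomologyFunctor (ModuleCat.{0} ℤ) 1).obj (ModuleCat.of ℤ ℤ)).obj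
    (TopCat.of (M z))

/-- The map induced on `H₁` by a homeomorphism `M(z) → M(z')`. -/
def H1map {z z' : Plane} (f : M z ≃ₜ M z') : H1 z →ₗ[ℤ] H1 z' :=
  (((AlgebraicTopology.singularHomologyFunctor (ModuleCat.{0} ℤ) 1).obj (ModuleCat.of ℤ ℤ)).map
    (TopCat.ofHom (f : C(M z, M z')))).hom

/-- The displacement of a path in the circle `ℝ / ℤ`: the difference between the end point and
the initial point of a lift to `ℝ`. -/
def circleDisplacement (γ : C(unitInterval, UnitAddCircle)) : ℝ :=
  (AddCircle.isCoveringMap_coe (1 : ℝ)).liftPath γ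
      (QuotientAddGroup.mk_surjective (γ 0)).choose
      (QuotientAddGroup.mk_surjective (γ 0)).choose_spec.symm 1 -
    (QuotientAddGroup.mk_surjective (γ 0)).choose

/-- The displacement (holonomy) vector of a path in `M(z)`: develop the path to `ℝ²` and take the
difference between the end point and the initial point. This is the integral of `ω`. -/
def displacement {z : Plane} (γ : C(unitInterval, M z)) : Plane := fun k =>
  circleDisplacement ⟨fun t => proj z (γ t) k,
    (continuous_apply k).comp ((proj z).continuous.comp γ.continuous)⟩

/-- A singular `1`-simplex of `M(z)`, as a path. -/
def simplexPath {z : Plane}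
    (s : (TopCat.toSSet.obj (TopCat.of (M z))).obj (.op (SimplexCategory.mk 1))) :
    C(unitInterval, M z) :=
  ⟨fun t => TopCat.toSSetObj₁Equiv s (TopCat.I.homeomorph.symm t),
    (TopCat.toSSetObj₁Equiv s).hom.continuous.comp TopCat.I.homeomorph.symm.continuous⟩

/-- The holonomy of singular `1`-chains: the additive extension of the displacement vector. -/
def hol (z : Plane) : (chains z).X 1 ⟶ ModuleCat.of ℤ Plane :=
  Limits.Cofan.IsColimit.desc
    ((TopCat.toSSet.obj (TopCat.of (M z))).isColimitChainComplexXCofan (ModuleCat.of ℤ ℤ) 1)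
    fun s => ModuleCat.ofHom (LinearMap.toSpanSingleton ℤ Plane (displacement (simplexPath s)))

/-- The group `H₁⁽⁰⁾(M(z); ℤ)` of the homology classes with zero holonomy, that is the classes of
the cycles with zero holonomy. -/
def H1zero (z : Plane) : Submodule ℤ (H1 z) :=
  (LinearMap.ker ((chains z).iCycles 1 ≫ hol z).hom).map ((chains z).homologyπ 1).hom

end SlitTori

end

/-!
The word `g = gWord a d n` is a product of two parabolic matrices (`act_gWord`): with
`T v = (p ↦ p + 2 det(v, p) v)` it is `T (d, 1) * (T (a, -1 - n a))⁻¹`. The congruences on `a` and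
`d`, together with `8 q ∣ n`, say exactly that `det(v, z)` is a half-integer for both directions
`v`. Such a direction (`Direction`) is one in which `M(z)` is a single cylinder: the closed geodesic
of the torus in direction `v` through `z` passes through `-z` as well, and its complement, an
annulus around the geodesic through the origin, has a connected preimage in `M(z)`, because the
slit crosses this core an odd number of times (`Direction.exists_chart` has an argument by the
symmetry `ι` below instead of the count). The derivative of the Dehn twist of this cylinder is `T v`
(`Direction.twist`), so the product `f₀` of a twist and of an inverse twist is affine with
derivative `g`, and it fixes both singularities.

*Homology.* Let `D` be a homomorphism on `1`-chains modulo boundaries. If `D` has a primitive in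
the coordinates of the cylinder, single-valued up to one period along and one period across the
cylinder, then the value of `D` on a cycle is a linear function of the holonomy of the cycle, so `D`
kills the classes with zero holonomy (`IsPrimitive.eq_zero`). This applies to `D = τ_* + 1`, where
`τ` exchanges the two tori, since `D` does not distinguish the two lifts of a segment of the torus;
hence `τ` acts as `-id` (`Direction.H1map_tau`). It also applies to `D = φ_* - 1`, where `φ` is a
power of the twist: a path across the cylinder is changed by a multiple of the core, and all lifts
of the core have the same class; hence `φ` acts as `id` (`Direction.H1map_twist`).

*Uniqueness.* An affine `f` with derivative `g` differs from `f₀` by a translation of the torus that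
permutes `±z`. If the translation is trivial, then `f` is `f₀` or `τ f₀`
(`eq_or_eq_tau_comp`), which gives the two signs. A nontrivial one would be by a vector of order two
(`not_translation`); its lift to `M(z)` would commute with the lift `ι` of `x ↦ -x` up to a constant
power of `τ`, but comparing the two compositions over the origin, where `ι` is `τ`, and over
`(1/2, 0)`, where `ι` is the identity, gives different powers.

*The model of the surface.* The double cover `M(z)` of the torus is described as the Riemann surface
of the square root of a function: `branch z` is a continuous function on the torus with simple zeros
at `±z` that takes negative real values exactly on the slit, and `root` is a continuous square root
of it on `M(z)`. A point of `M(z)` is determined by its projection and its root, any compatible pair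
occurs, and the topology is induced by this pair (`point_ext`, `exists_point`, `continuous_iff`).
This replaces all work with the four glued polygons.
-/

noncomputable section

namespace SlitTori

/-! ### Singular chains modulo boundaries -/

section Homology
open scoped Simplicial unitInterval
open HomologicalComplex
variable {X Y : Type} [TopologicalSpace X] [TopologicalSpace Y]

/-- The singular chain complex of a space with integer coefficients. -/
abbrev Chains (X : Type) [TopologicalSpace X] : ChainComplex (ModuleCat.{0} ℤ) ℕ :=
  ((AlgebraicTopology.singularChainComplexFunctor (ModuleCat.{0} ℤ)).obj (ModuleCat.of ℤ ℤ)).obj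
    (TopCat.of X)

/-- The singular `1`-chains modulo boundaries. The group `H₁` is a subgroup. -/
abbrev ChainClass (X : Type) [TopologicalSpace X] : ModuleCat.{0} ℤ := (Chains X).opcycles 1

/-- The class of a singular `1`-simplex modulo boundaries. -/
def simplexClass (s : (TopCat.toSSet.obj (TopCat.of X)) _⦋1⦌) : ChainClass X :=
  ((TopCat.toSSet.obj (TopCat.of X)).ιChainComplex (R := ModuleCat.of ℤ ℤ) s ≫
    (Chains X).pOpcycles 1).hom (1 : ℤ)

/-- A path, as a singular `1`-simplex. -/
def pathSimplex (γ : C(I, X)) : (TopCat.toSSet.obj (TopCat.of X)) _⦋1⦌ :=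
  (TopCat.toSSetObjEquiv (TopCat.of X) (.op ⦋1⦌)).symm
    (γ.comp ⟨stdSimplexHomeomorphUnitInterval, stdSimplexHomeomorphUnitInterval.continuous⟩)

/-- The class of a path, as a `1`-chain modulo boundaries. -/
def pathClass (γ : C(I, X)) : ChainClass X := simplexClass (pathSimplex γ)

lemma toSSetObj₁Equiv_pathSimplex (γ : C(I, X)) (t : I) :
    TopCat.toSSetObj₁Equiv (pathSimplex γ) (TopCat.I.homeomorph.symm t) = γ t := by
  change γ (stdSimplexHomeomorphUnitInterval (stdSimplexHomeomorphUnitInterval.symm t)) = γ t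
  simp

lemma simplexPath_pathSimplex {z : Plane} (γ : C(I, M z)) : simplexPath (pathSimplex γ) = γ := by
  ext t
  exact toSSetObj₁Equiv_pathSimplex γ t

lemma pathSimplex_surjective : Function.Surjective (pathSimplex (X := X)) := by
  intro s
  refine ⟨(TopCat.toSSetObjEquiv (TopCat.of X) (.op ⦋1⦌) s).comp
    ⟨stdSimplexHomeomorphUnitInterval.symm, stdSimplexHomeomorphUnitInterval.symm.continuous⟩, ?_⟩
  rw [pathSimplex, Equiv.symm_apply_eq]
  ext t
  simp

/-- The path on the edge of the standard triangle between two vertices. -/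
def edgePath (i j : Fin 3) : C(I, stdSimplex ℝ (Fin 3)) where
  toFun t := stdSimplex.map ![i, j] (stdSimplexHomeomorphUnitInterval.symm t)
  continuous_toFun := (stdSimplex.continuous_map _).comp
    stdSimplexHomeomorphUnitInterval.symm.continuous

lemma face_eq_pathSimplex (F : C(stdSimplex ℝ (Fin 3), X)) (k : Fin 3) (i j : Fin 3)
    (h : ![i, j] = k.succAbove) :
    (TopCat.toSSet.obj (TopCat.of X)).δ k ((TopCat.toSSetObjEquiv (TopCat.of X) (.op ⦋2⦌)).symm F)
      = pathSimplex (F.comp (edgePath i j)) := by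
  rw [pathSimplex, Equiv.eq_symm_apply]
  ext t
  have : F (stdSimplex.map (k.succAbove) t) = F.comp (edgePath i j)
      (stdSimplexHomeomorphUnitInterval t) := by
    simp [edgePath, h]
  exact this

/-- The sides of a singular triangle add up to zero modulo boundaries. -/
lemma pathClass_triangle (F : C(stdSimplex ℝ (Fin 3), X)) :
    pathClass (F.comp (edgePath 0 1)) + pathClass (F.comp (edgePath 1 2)) =
      pathClass (F.comp (edgePath 0 2)) := by
  have h := (Chains X).d_pOpcycles 2 1
  have h2 := congrArg (fun g => (((TopCat.toSSet.obj (TopCat.of X)).ιChainComplex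
    (R := ModuleCat.of ℤ ℤ) ((TopCat.toSSetObjEquiv (TopCat.of X) (.op ⦋2⦌)).symm F)) ≫ g).hom
      (1 : ℤ)) h
  have h3 := SSet.ιChainComplex_d_assoc (TopCat.toSSet.obj (TopCat.of X)) (ModuleCat.of ℤ ℤ)
    ((TopCat.toSSetObjEquiv (TopCat.of X) (.op ⦋2⦌)).symm F) ((Chains X).pOpcycles 1)
  have h4 := congrArg (fun g => g.hom (1 : ℤ)) h3
  have h5 := h4.symm.trans h2
  rw [Fin.sum_univ_three, face_eq_pathSimplex F 0 1 2 (by decide),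
    face_eq_pathSimplex F 1 0 2 (by decide), face_eq_pathSimplex F 2 0 1 (by decide)] at h5
  simp only [Fin.val_zero, Fin.val_one, Fin.val_two, pow_zero, one_smul, pow_one, neg_smul,
    even_two, Even.neg_pow, one_pow] at h5
  erw [Preadditive.add_comp, Preadditive.add_comp, Preadditive.neg_comp] at h5
  have h6 : pathClass (F.comp (edgePath 1 2)) - pathClass (F.comp (edgePath 0 2))
    + pathClass (F.comp (edgePath 0 1)) = 0 := by
    rw [sub_eq_add_neg]; exact h5
  rw [← sub_eq_zero, ← h6]; abel

/-- The map induced by a continuous map on chains modulo boundaries. -/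
def chainClassMap (f : C(X, Y)) : ChainClass X →ₗ[ℤ] ChainClass Y :=
  (opcyclesMap (((AlgebraicTopology.singularChainComplexFunctor (ModuleCat.{0} ℤ)).obj
    (ModuleCat.of ℤ ℤ)).map (TopCat.ofHom f)) 1).hom

lemma chainClassMap_pathClass (f : C(X, Y)) (γ : C(I, X)) :
    chainClassMap f (pathClass γ) = pathClass (f.comp γ) := by
  have h := HomologicalComplex.p_opcyclesMap (((AlgebraicTopology.singularChainComplexFunctor
    (ModuleCat.{0} ℤ)).obj (ModuleCat.of ℤ ℤ)).map (TopCat.ofHom f)) 1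
  have h1 := SSet.ι_chainComplexMap_f_assoc (TopCat.toSSet.obj (TopCat.of X))
    (TopCat.toSSet.obj (TopCat.of Y)) (TopCat.toSSet.map (TopCat.ofHom f)) (ModuleCat.of ℤ ℤ)
      (pathSimplex γ) ((Chains Y).pOpcycles 1)
  have h2 := congrArg (fun g => (((TopCat.toSSet.obj (TopCat.of X)).ιChainComplex
    (R := ModuleCat.of ℤ ℤ) (pathSimplex γ)) ≫ g).hom (1 : ℤ)) h
  have h3 := congrArg (fun g => g.hom (1 : ℤ)) h1
  exact h2.trans h3

lemma homologyι_H1map {z z' : Plane} (f : M z ≃ₜ M z') (c : H1 z) :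
    ((chains z').homologyι 1).hom (H1map f c) =
      chainClassMap (f : C(M z, M z')) (((chains z).homologyι 1).hom c) := by
  have h := HomologicalComplex.homologyι_naturality
    (((AlgebraicTopology.singularChainComplexFunctor
    (ModuleCat.{0} ℤ)).obj (ModuleCat.of ℤ ℤ)).map (TopCat.ofHom (f : C(M z, M z')))) 1
  exact congrArg (fun g => g.hom c) h

lemma homologyι_injective (z : Plane) :
    Function.Injective ((chains z).homologyι 1).hom :=
  (ModuleCat.mono_iff_injective _).1 inferInstance

end Homology

/-! ### Homomorphisms on chains and the holonomy -/

section Chains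
open scoped Simplicial unitInterval
open HomologicalComplex
variable {X : Type} [TopologicalSpace X] {A : Type} [AddCommGroup A]

/-- The generator of the singular chains given by a singular simplex. -/
def simplexChain {n : ℕ} (s : (TopCat.toSSet.obj (TopCat.of X)) _⦋n⦌) : (Chains X).X n :=
  ((TopCat.toSSet.obj (TopCat.of X)).ιChainComplex (R := ModuleCat.of ℤ ℤ) s).hom (1 : ℤ)

/-- The additive extension to singular chains of a function of simplices. -/
def chainExtension {n : ℕ} (φ : (TopCat.toSSet.obj (TopCat.of X)) _⦋n⦌ → A) :
    (Chains X).X n ⟶ ModuleCat.of ℤ A :=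
  Limits.Cofan.IsColimit.desc
    ((TopCat.toSSet.obj (TopCat.of X)).isColimitChainComplexXCofan (ModuleCat.of ℤ ℤ) n)
    fun s => ModuleCat.ofHom (LinearMap.toSpanSingleton ℤ A (φ s))

lemma chainExtension_simplexChain {n : ℕ} (φ : (TopCat.toSSet.obj (TopCat.of X)) _⦋n⦌ → A)
    (s : (TopCat.toSSet.obj (TopCat.of X)) _⦋n⦌) :
    (chainExtension φ).hom (simplexChain s) = φ s := by
  have h := Limits.Cofan.IsColimit.fac
    ((TopCat.toSSet.obj (TopCat.of X)).isColimitChainComplexXCofan (ModuleCat.of ℤ ℤ) n)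
    (fun s => ModuleCat.ofHom (LinearMap.toSpanSingleton ℤ A (φ s))) s
  have h2 := congrArg (fun g => g.hom (1 : ℤ)) h
  refine Eq.trans h2 ?_
  simp

lemma chain_hom_ext {n : ℕ} {f g : (Chains X).X n →ₗ[ℤ] A}
    (h : ∀ s, f (simplexChain s) = g (simplexChain s)) : f = g := by
  have : ModuleCat.ofHom f = ModuleCat.ofHom g := by
    refine SSet.chainComplex_hom_ext fun s => ?_
    refine ModuleCat.hom_ext (LinearMap.ext_ring ?_)
    exact h s
  exact congrArg ModuleCat.Hom.hom this

lemma d_simplexChain_pathSimplex (γ : C(I, X)) :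
    ((Chains X).d 1 0).hom (simplexChain (pathSimplex γ)) =
      simplexChain (TopCat.toSSetObj₀Equiv.symm (γ 1)) -
      simplexChain (TopCat.toSSetObj₀Equiv.symm (γ 0)) := by
  have h := SSet.ιChainComplex_d (TopCat.toSSet.obj (TopCat.of X)) (ModuleCat.of ℤ ℤ)
    (pathSimplex γ)
  have h1 := congrArg (fun g => g.hom (1 : ℤ)) h
  refine Eq.trans h1 ?_
  have e0 : (TopCat.toSSet.obj (TopCat.of X)).δ 0 (pathSimplex γ) =
      TopCat.toSSetObj₀Equiv.symm (γ 1) := by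
    rw [Equiv.eq_symm_apply, ← TopCat.toSSetObj₁Equiv_apply_one]
    exact toSSetObj₁Equiv_pathSimplex γ 1
  have e1 : (TopCat.toSSet.obj (TopCat.of X)).δ 1 (pathSimplex γ) =
      TopCat.toSSetObj₀Equiv.symm (γ 0) := by
    rw [Equiv.eq_symm_apply, ← TopCat.toSSetObj₁Equiv_apply_zero]
    exact toSSetObj₁Equiv_pathSimplex γ 0
  rw [Fin.sum_univ_two, e0, e1]
  simp only [Fin.val_zero, Fin.val_one, pow_zero, one_smul, pow_one, neg_smul]
  rw [sub_eq_add_neg]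
  rfl

lemma hol_simplexChain {z : Plane} (γ : C(I, M z)) :
    (hol z).hom (simplexChain (pathSimplex γ)) = displacement γ := by
  conv_rhs => rw [← simplexPath_pathSimplex γ]
  exact chainExtension_simplexChain (fun s => displacement (simplexPath s)) _

/-- Suppose that the holonomy of every path is, up to a function of the end points, an injective
linear function `B` of an integer vector, and that the value of a homomorphism `D` on the path is,
up to a function of the end points, a linear function `κ` of the same integer vector. Then `D`
vanishes on the homology classes with zero holonomy. -/
theorem eq_zero_of_mem_H1zero {z : Plane} (D : ChainClass (M z) →ₗ[ℤ] A) (s : M z → Plane)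
    (k : M z → A) (κ : ℤ × ℤ →+ A) (B : ℤ × ℤ →+ Plane) (hB : Function.Injective B)
    (h : ∀ γ : C(I, M z), ∃ n, displacement γ = s (γ 1) - s (γ 0) + B n ∧
      D (pathClass γ) = k (γ 1) - k (γ 0) + κ n) {c : H1 z} (hc : c ∈ H1zero z) :
    D (((chains z).homologyι 1).hom c) = 0 := by
  obtain ⟨y, hy, rfl⟩ := hc
  choose n hn1 hn2 using h
  let N : (Chains (M z)).X 1 ⟶ ModuleCat.of ℤ (ℤ × ℤ) :=
    chainExtension fun s => n (simplexPath s)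
  let S : (Chains (M z)).X 0 ⟶ ModuleCat.of ℤ Plane :=
    chainExtension fun p => s (TopCat.toSSetObj₀Equiv p)
  let K : (Chains (M z)).X 0 ⟶ ModuleCat.of ℤ A :=
    chainExtension fun p => k (TopCat.toSSetObj₀Equiv p)
  have hN (γ) : N.hom (simplexChain (pathSimplex γ)) = n γ := by
    refine (chainExtension_simplexChain _ _).trans ?_
    rw [simplexPath_pathSimplex]
  have hS (m : M z) : S.hom (simplexChain (TopCat.toSSetObj₀Equiv.symm m)) = s m := by
    refine (chainExtension_simplexChain _ _).trans ?_
    rw [Equiv.apply_symm_apply]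
  have hK (m : M z) : K.hom (simplexChain (TopCat.toSSetObj₀Equiv.symm m)) = k m := by
    refine (chainExtension_simplexChain _ _).trans ?_
    rw [Equiv.apply_symm_apply]
  -- Up to coboundaries, both the holonomy and `D` factor through `N`.
  have e1 : (hol z).hom = S.hom ∘ₗ ((Chains (M z)).d 1 0).hom + B.toIntLinearMap ∘ₗ N.hom := by
    refine chain_hom_ext fun σ' => ?_
    obtain ⟨γ, rfl⟩ := pathSimplex_surjective σ'
    simp only [LinearMap.add_apply, LinearMap.comp_apply]
    rw [d_simplexChain_pathSimplex, map_sub, hS, hS, hN]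
    exact (hol_simplexChain γ).trans (hn1 γ)
  have e2 : D ∘ₗ ((Chains (M z)).pOpcycles 1).hom =
      K.hom ∘ₗ ((Chains (M z)).d 1 0).hom + κ.toIntLinearMap ∘ₗ N.hom := by
    refine chain_hom_ext fun σ' => ?_
    obtain ⟨γ, rfl⟩ := pathSimplex_surjective σ'
    simp only [LinearMap.add_apply, LinearMap.comp_apply]
    rw [d_simplexChain_pathSimplex, map_sub, hK, hK, hN]
    exact hn2 γ
  set x := ((chains z).iCycles 1).hom y with hx
  have hd : ((Chains (M z)).d 1 0).hom x = 0 :=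
    congrArg (fun g => g.hom y) ((chains z).iCycles_d 1 0)
  have hx0 : (hol z).hom x = 0 := hy
  rw [e1] at hx0
  simp only [LinearMap.add_apply, LinearMap.comp_apply] at hx0
  rw [hd, map_zero, zero_add] at hx0
  have hNx : N.hom x = 0 := hB (hx0.trans (map_zero B).symm)
  have e3 : ((chains z).homologyι 1).hom (((chains z).homologyπ 1).hom y) =
      ((chains z).pOpcycles 1).hom x :=
    congrArg (fun g => g.hom y) ((chains z).homology_π_ι 1)
  refine (congrArg D e3).trans ?_
  have e4 := LinearMap.congr_fun e2 x
  simp only [LinearMap.add_apply, LinearMap.comp_apply] at e4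
  rw [hd, map_zero, hNx, map_zero, add_zero] at e4
  exact e4

end Chains

/-! ### Classes of segments and paths -/

section Segments
open scoped unitInterval
variable {X : Type} [TopologicalSpace X] {E : Type*} [AddCommGroup E] [Module ℝ E]
  [TopologicalSpace E] [IsTopologicalAddGroup E] [ContinuousSMul ℝ E]

open Classical in
/-- The class of a path given as a function, with value `0` if the function is not continuous. -/
def curveClass (γ : I → X) : ChainClass X := if h : Continuous γ then pathClass ⟨γ, h⟩ else 0

lemma curveClass_of_continuous {γ : I → X} (h : Continuous γ) :
    curveClass γ = pathClass ⟨γ, h⟩ := dif_pos h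

lemma chainClassMap_curveClass {Y : Type} [TopologicalSpace Y] (f : C(X, Y)) {γ : I → X}
    (h : Continuous γ) : chainClassMap f (curveClass γ) = curveClass (f ∘ γ) := by
  rw [curveClass_of_continuous h, curveClass_of_continuous (f.continuous.comp h),
    chainClassMap_pathClass]
  rfl

/-- The class of the image of a straight segment under a map. -/
def segClass (f : E → X) (p q : E) : ChainClass X :=
  curveClass fun t : I => f (AffineMap.lineMap p q (t : ℝ))

lemma continuous_seg {f : E → X} {S : Set E} (hS : Convex ℝ S) (hf : ContinuousOn f S) {p q : E}
    (hp : p ∈ S) (hq : q ∈ S) : Continuous fun t : I => f (AffineMap.lineMap p q (t : ℝ)) := by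
  refine hf.comp_continuous ?_ fun t => ?_
  · simp only [AffineMap.lineMap_apply_module]
    fun_prop
  · exact hS.lineMap_mem hp hq t.2

/-- The images of the three sides of a triangle bound its image. -/
lemma segClass_add {f : E → X} {S : Set E} (hS : Convex ℝ S) (hf : ContinuousOn f S) {p q r : E}
    (hp : p ∈ S) (hq : q ∈ S) (hr : r ∈ S) :
    segClass f p q + segClass f q r = segClass f p r := by
  have hc : Continuous fun x : stdSimplex ℝ (Fin 3) => f (x 0 • p + x 1 • q + x 2 • r) := by
    refine hf.comp_continuous ?_ fun x => ?_
    · have (i : Fin 3) : Continuous fun x : stdSimplex ℝ (Fin 3) => x i :=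
        (continuous_apply i).comp continuous_subtype_val
      exact (((this 0).smul continuous_const).add ((this 1).smul continuous_const)).add
        ((this 2).smul continuous_const)
    · have h3 := x.2.2
      rw [Fin.sum_univ_three] at h3
      have := hS.sum_mem (t := Finset.univ) (w := fun i => x i) (z := ![p, q, r])
        (fun i _ => x.2.1 i) x.2.2 (by intro i _; fin_cases i <;> assumption)
      simpa [Fin.sum_univ_three] using this
  have key (i j : Fin 3) (t : I) (k : Fin 3) : (edgePath i j t) k =
      (if i = k then 1 - (t : ℝ) else 0) + (if j = k then (t : ℝ) else 0) := by
    simp [edgePath, stdSimplexHomeomorphUnitInterval, stdSimplexEquivIcc, stdSimplex.map_coe,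
      FunOnFinite.linearMap_apply_apply, Finset.sum_filter, Fin.sum_univ_two]
    rfl
  have h := pathClass_triangle ⟨_, hc⟩
  rw [segClass, segClass, segClass, curveClass_of_continuous (continuous_seg hS hf hp hq),
    curveClass_of_continuous (continuous_seg hS hf hq hr),
    curveClass_of_continuous (continuous_seg hS hf hp hr)]
  convert h using 2
  · congr 1
    ext t
    simp [key, AffineMap.lineMap_apply_module]
  · congr 1
    ext t
    simp [key, AffineMap.lineMap_apply_module]
  · congr 1
    ext t
    simp [key, AffineMap.lineMap_apply_module]

lemma segClass_self {f : E → X} (p : E) : segClass f p p = 0 := by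
  have h := segClass_add (f := f) (convex_singleton p) (continuousOn_singleton f p)
    rfl rfl (rfl : p = p)
  simpa using h

lemma chainClassMap_segClass {Y : Type} [TopologicalSpace Y] (g : C(X, Y)) {f : E → X} {S : Set E}
    (hS : Convex ℝ S) (hf : ContinuousOn f S) {p q : E} (hp : p ∈ S) (hq : q ∈ S) :
    chainClassMap g (segClass f p q) = segClass (g ∘ f) p q :=
  chainClassMap_curveClass g (continuous_seg hS hf hp hq)

/-- If a homomorphism on path classes is locally along a path the difference of a function of the
parameter, then it is so globally. -/
lemma map_pathClass_of_local {A : Type*} [AddCommGroup A] [Module ℤ A] (D : ChainClass X →ₗ[ℤ] A)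
    (γ : C(I, X))
    (K : I → A) (h : ∀ t₀ : I, ∀ᶠ t : I in 𝓝 t₀,
      D (segClass (Set.IccExtend zero_le_one γ) (t₀ : ℝ) t) = K t - K t₀) :
    D (pathClass γ) = K 1 - K 0 := by
  set f : ℝ → X := Set.IccExtend zero_le_one γ with hf
  have hfc : ContinuousOn f Set.univ := γ.continuous.Icc_extend'.continuousOn
  have hadd (a b c : ℝ) : segClass f a b + segClass f b c = segClass f a c :=
    segClass_add convex_univ hfc trivial trivial trivial
  have hloc : IsLocallyConstant fun t : I => D (segClass f (0 : ℝ) t) - K t := by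
    rw [IsLocallyConstant.iff_eventually_eq]
    intro t₀
    filter_upwards [h t₀] with t ht
    rw [← hadd 0 t₀ t, map_add, ht]
    abel
  have h01 := hloc.apply_eq_of_isPreconnected isPreconnected_univ (Set.mem_univ (1 : I))
    (Set.mem_univ (0 : I))
  have e : segClass f (0 : ℝ) ((1 : I) : ℝ) = pathClass γ := by
    rw [segClass, curveClass_of_continuous (continuous_seg convex_univ hfc trivial trivial)]
    congr 1
    ext t
    simp [hf, AffineMap.lineMap_apply_module]
  simp only [e, Set.Icc.coe_zero, segClass_self, map_zero, zero_sub] at h01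
  rw [sub_eq_iff_eq_add] at h01
  rw [h01]
  abel

end Segments

/-! ### Holonomy of paths and the torus -/

section Displacement
open scoped unitInterval

lemma circleDisplacement_eq (γ : C(I, UnitAddCircle)) (p : C(I, ℝ))
    (h : ∀ t, ((p t : ℝ) : UnitAddCircle) = γ t) : circleDisplacement γ = p 1 - p 0 := by
  set x := (QuotientAddGroup.mk_surjective (γ 0)).choose with hx
  have hx0 : ((x : ℝ) : UnitAddCircle) = γ 0 := (QuotientAddGroup.mk_surjective (γ 0)).choose_spec
  -- The chosen lift is the given one, up to the constant integer `x - p 0`.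
  have hlift : (⟨fun t => p t + (x - p 0), by fun_prop⟩ : C(I, ℝ)) =
      (AddCircle.isCoveringMap_coe (1 : ℝ)).liftPath γ x hx0.symm := by
    rw [IsCoveringMap.eq_liftPath_iff']
    refine ⟨?_, by simp⟩
    ext t
    have : ((x : ℝ) : UnitAddCircle) - ((p 0 : ℝ) : UnitAddCircle) = 0 := by rw [hx0, h, sub_self]
    simp only [ContinuousMap.coe_mk, Function.comp_apply, AddCircle.coe_add, AddCircle.coe_sub, h t]
    rw [this, add_zero]
  have e : circleDisplacement γ =
      (AddCircle.isCoveringMap_coe (1 : ℝ)).liftPath γ x hx0.symm 1 - x := rfl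
  rw [e, ← hlift, ContinuousMap.coe_mk]
  ring

lemma displacement_eq {z : Plane} (γ : C(I, M z)) (p : C(I, Plane))
    (h : ∀ t, toTorus (p t) = proj z (γ t)) : displacement γ = p 1 - p 0 := by
  funext k
  exact circleDisplacement_eq _ ⟨fun t => p t k, by fun_prop⟩ fun t => congrFun (h t) k

lemma exists_planeLift {z : Plane} (γ : C(I, M z)) :
    ∃ p : C(I, Plane), ∀ t, toTorus (p t) = proj z (γ t) := by
  have h (k : Fin 2) : ∃ p : C(I, ℝ), ∀ t, ((p t : ℝ) : UnitAddCircle) = proj z (γ t) k := by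
    obtain ⟨x, hx⟩ := QuotientAddGroup.mk_surjective (proj z (γ 0) k)
    obtain ⟨p, hp, -⟩ := (AddCircle.isCoveringMap_coe (1 : ℝ)).exists_path_lifts
      ⟨fun t => proj z (γ t) k,
        (continuous_apply k).comp ((proj z).continuous.comp γ.continuous)⟩ x hx.symm
    exact ⟨p, fun t => congrFun hp t⟩
  choose p hp using h
  exact ⟨⟨fun t k => p k t, by fun_prop⟩, fun t => funext fun k => hp k t⟩

end Displacement

section Torus

lemma toTorus_add (p q : Plane) : toTorus (p + q) = toTorus p + toTorus q := rfl

lemma toTorus_neg (p : Plane) : toTorus (-p) = -toTorus p := rfl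

lemma toTorus_sub (p q : Plane) : toTorus (p - q) = toTorus p - toTorus q := rfl

lemma toTorus_zero : toTorus 0 = 0 := rfl

lemma continuous_toTorus : Continuous toTorus :=
  continuous_pi fun k => (AddCircle.continuous_mk' 1).comp (continuous_apply k)

lemma toTorus_eq_zero_iff (p : Plane) : toTorus p = 0 ↔ ∀ k, ∃ n : ℤ, p k = n := by
  simp only [toTorus, funext_iff, Pi.zero_apply, AddCircle.coe_eq_zero_iff]
  simp [eq_comm]

/-- Every point of the torus has a representative in the fundamental square. -/
lemma exists_toTorus_eq (x : Torus) : ∃ p : Plane, (∀ k, -(1 / 2) ≤ p k ∧ p k < 1 / 2) ∧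
    toTorus p = x := by
  have h (k : Fin 2) : ∃ t : ℝ, (-(1 / 2) ≤ t ∧ t < 1 / 2) ∧ (t : UnitAddCircle) = x k := by
    have := AddCircle.coe_image_Ico_eq (1 : ℝ) (-(1 / 2))
    have hx : x k ∈ ((↑) '' Set.Ico (-(1 / 2) : ℝ) (-(1 / 2) + 1) : Set UnitAddCircle) := by
      rw [this]; trivial
    obtain ⟨t, ht, hx⟩ := hx
    exact ⟨t, ⟨ht.1, by linarith [ht.2]⟩, hx⟩
  choose p hp hx using h
  exact ⟨p, hp, funext hx⟩

end Torus

/-! ### The branching function -/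

section Branching

/-- The function `t ↦ min c (1/2 - |t|)` on the circle, where `-1/2 ≤ t ≤ 1/2`. -/
def hat (c : ℝ) (x : UnitAddCircle) : ℝ := min c (1 / 2 - ‖x‖)

/-- The function `t ↦ t * min c (1/2 - |t|)` on the circle, where `-1/2 ≤ t ≤ 1/2`. -/
def oddHat (c : ℝ) : UnitAddCircle → ℝ :=
  AddCircle.liftIco 1 (-(1 / 2)) fun t => t * min c (1 / 2 - |t|)

lemma norm_coe_of_abs_le {t : ℝ} (ht : |t| ≤ 1 / 2) : ‖(t : UnitAddCircle)‖ = |t| := by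
  rw [AddCircle.norm_coe_eq_abs_iff _ one_ne_zero]
  simpa using ht

lemma hat_coe (c : ℝ) {t : ℝ} (ht : |t| ≤ 1 / 2) : hat c t = min c (1 / 2 - |t|) := by
  rw [hat, norm_coe_of_abs_le ht]

lemma oddHat_coe {c : ℝ} (hc : 0 ≤ c) {t : ℝ} (ht : |t| ≤ 1 / 2) :
    oddHat c t = t * min c (1 / 2 - |t|) := by
  rw [abs_le] at ht
  rcases eq_or_lt_of_le ht.2 with h | h
  · have : (t : UnitAddCircle) = ((-(1 / 2) : ℝ) : UnitAddCircle) := by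
      rw [h, ← sub_eq_zero, ← AddCircle.coe_sub, AddCircle.coe_eq_zero_iff]
      exact ⟨1, by norm_num⟩
    rw [this, oddHat, AddCircle.liftIco_coe_apply (by norm_num), h]
    have e : (0 : ℝ) ≤ 1 / 2 := by norm_num
    simp [abs_of_nonneg, hc]
  · rw [oddHat, AddCircle.liftIco_coe_apply ⟨ht.1, by linarith⟩]

lemma continuous_hat (c : ℝ) : Continuous (hat c) := by
  unfold hat; fun_prop

lemma continuous_oddHat {c : ℝ} (hc : 0 ≤ c) : Continuous (oddHat c) := by
  refine AddCircle.liftIco_continuous ?_ (by fun_prop)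
  have : |(-(1 / 2) + 1 : ℝ)| = 1 / 2 := by norm_num [abs_of_pos]
  rw [this]
  simp [hc]

lemma hat_neg (c : ℝ) (x : UnitAddCircle) : hat c (-x) = hat c x := by simp [hat]

lemma exists_coe_eq (x : UnitAddCircle) : ∃ t : ℝ, |t| ≤ 1 / 2 ∧ (t : UnitAddCircle) = x := by
  obtain ⟨p, hp, h⟩ := exists_toTorus_eq fun _ => x
  exact ⟨p 0, abs_le.2 ⟨(hp 0).1, (hp 0).2.le⟩, congrFun h 0⟩

lemma oddHat_neg {c : ℝ} (hc : 0 ≤ c) (x : UnitAddCircle) : oddHat c (-x) = -oddHat c x := by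
  obtain ⟨t, ht, rfl⟩ := exists_coe_eq x
  rw [← AddCircle.coe_neg, oddHat_coe hc ht, oddHat_coe hc (by rwa [abs_neg]), abs_neg]
  ring

/-- The standing assumptions on the end point `z` of the slit: it lies in the interior of the
fundamental square, off the horizontal axis. -/
structure Admissible (z : Plane) : Prop where
  abs_lt : ∀ k, |z k| < 1 / 2
  ne_zero : z 1 ≠ 0

/-- The height at which the functions `hat` are truncated, so that they are constant near the
coordinates of `±z`. -/
def cutoff (z : Plane) : ℝ := min (1 / 2 - |z 0|) (1 / 2 - |z 1|) / 2

/-- A continuous function on the torus, with simple zeros at `±z`, which is a negative real on the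
slit and takes no other negative real values. The surface `M(z)` is the Riemann surface of its
square root. -/
def branch (z : Plane) (x : Torus) : ℂ :=
  ⟨max (‖x 1‖ - |z 1|) (‖x 0‖ - (|z 0| + 1 / 2) / 2),
    z 0 * (oddHat (cutoff z) (x 1) * hat (cutoff z) (x 0)) -
      z 1 * (oddHat (cutoff z) (x 0) * hat (cutoff z) (x 1))⟩

variable {z : Plane} (hz : Admissible z)
include hz

lemma cutoff_pos : 0 < cutoff z := by
  have h0 := hz.abs_lt 0
  have h1 := hz.abs_lt 1
  have : 0 < min (1 / 2 - |z 0|) (1 / 2 - |z 1|) := lt_min (by linarith) (by linarith)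
  unfold cutoff
  linarith

lemma continuous_branch : Continuous (branch z) := by
  have h := continuous_oddHat (cutoff_pos hz).le
  have h' := continuous_hat (cutoff z)
  have e : branch z = fun x : Torus =>
      ((max (‖x 1‖ - |z 1|) (‖x 0‖ - (|z 0| + 1 / 2) / 2) : ℝ) : ℂ) +
      ((z 0 * (oddHat (cutoff z) (x 1) * hat (cutoff z) (x 0)) -
      z 1 * (oddHat (cutoff z) (x 0) * hat (cutoff z) (x 1)) : ℝ) : ℂ) * Complex.I := by
    funext x
    apply Complex.ext <;> simp [branch]
  rw [e]
  fun_prop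

lemma branch_neg (x : Torus) : branch z (-x) = (starRingEnd ℂ) (branch z x) := by
  have hc := (cutoff_pos hz).le
  apply Complex.ext
  · simp [branch]
  · simp [branch, oddHat_neg hc, hat_neg]
    ring

lemma branch_im {p : Plane} (hp : ∀ k, |p k| ≤ 1 / 2) : (branch z (toTorus p)).im =
    side z p * (min (cutoff z) (1 / 2 - |p 0|) * min (cutoff z) (1 / 2 - |p 1|)) := by
  have hc := (cutoff_pos hz).le
  simp only [branch, toTorus, oddHat_coe hc (hp _), hat_coe _ (hp _), side]
  ring

omit hz in
lemma branch_re {p : Plane} (hp : ∀ k, |p k| ≤ 1 / 2) : (branch z (toTorus p)).re =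
    max (|p 1| - |z 1|) (|p 0| - (|z 0| + 1 / 2) / 2) := by
  simp only [branch, toTorus, norm_coe_of_abs_le (hp _)]

/-- At a point with a coordinate `1/2` the branching function is a positive real. -/
lemma branch_pos_of_half {x : Torus} (k : Fin 2) (hk : x k = ((1 / 2 : ℝ) : UnitAddCircle)) :
    (branch z x).im = 0 ∧ 0 < (branch z x).re := by
  have hc := (cutoff_pos hz).le
  have h0 := hz.abs_lt 0
  have h1 := hz.abs_lt 1
  have e : |(1 / 2 : ℝ)| = 1 / 2 := abs_of_pos (by norm_num)
  have e1 : hat (cutoff z) ((1 / 2 : ℝ) : UnitAddCircle) = 0 := by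
    rw [hat_coe _ e.le, e, sub_self]; exact min_eq_right hc
  have e2 : oddHat (cutoff z) ((1 / 2 : ℝ) : UnitAddCircle) = 0 := by
    rw [oddHat_coe hc e.le, e, sub_self, min_eq_right hc, mul_zero]
  have e3 : ‖((1 / 2 : ℝ) : UnitAddCircle)‖ = 1 / 2 := by rw [norm_coe_of_abs_le e.le, e]
  fin_cases k
  · simp only [Fin.zero_eta, Fin.isValue] at hk
    refine ⟨by simp only [branch, hk, e1, e2]; ring, lt_max_of_lt_right ?_⟩
    rw [hk, e3]; linarith
  · simp only [Fin.mk_one, Fin.isValue] at hk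
    refine ⟨by simp only [branch, hk, e1, e2]; ring, lt_max_of_lt_left ?_⟩
    rw [hk, e3]; linarith

lemma branch_zero : (branch z 0).im = 0 ∧ (branch z 0).re < 0 := by
  have h0 := hz.abs_lt 0
  have h1 := abs_pos.2 hz.ne_zero
  have h2 := abs_nonneg (z 0)
  have hp : ∀ k : Fin 2, |(0 : Plane) k| ≤ 1 / 2 := by intro k; norm_num
  rw [← toTorus_zero, branch_im hz hp, branch_re hp]
  refine ⟨by simp [side], max_lt ?_ ?_⟩
  · simpa using hz.ne_zero
  · simp only [Pi.zero_apply, abs_zero]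
    linarith

omit hz in
lemma toTorus_half_of_abs_eq {p : Plane} {k : Fin 2} (h : |p k| = 1 / 2) :
    toTorus p k = ((1 / 2 : ℝ) : UnitAddCircle) := by
  rcases (abs_eq (by norm_num)).1 h with h | h
  · simp only [toTorus, h]
  · simp only [toTorus, h]
    rw [← sub_eq_zero, ← AddCircle.coe_sub, AddCircle.coe_eq_zero_iff]
    exact ⟨-1, by norm_num⟩

/-- In the square, the branching function is real exactly on the boundary, where it is positive,
and on the line `ℝ z`. -/
lemma pos_or_side_eq_zero {p : Plane} (hp : ∀ k, |p k| ≤ 1 / 2)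
    (h : (branch z (toTorus p)).im = 0) : 0 < (branch z (toTorus p)).re ∨ side z p = 0 := by
  by_cases hb : ∃ k, |p k| = 1 / 2
  · obtain ⟨k, hk⟩ := hb
    exact Or.inl (branch_pos_of_half hz k (toTorus_half_of_abs_eq hk)).2
  · push Not at hb
    right
    rw [branch_im hz hp] at h
    have hpos (k : Fin 2) : 0 < min (cutoff z) (1 / 2 - |p k|) :=
      lt_min (cutoff_pos hz) (by linarith [lt_of_le_of_ne (hp k) (hb k)])
    exact (mul_eq_zero.1 h).resolve_right (mul_pos (hpos 0) (hpos 1)).ne'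

lemma exists_smul_of_side_eq_zero {p : Plane} (h : side z p = 0) : ∃ t : ℝ, p = t • z := by
  refine ⟨p 1 / z 1, ?_⟩
  have h1 := hz.ne_zero
  have h' : z 0 * p 1 - z 1 * p 0 = 0 := h
  funext k
  fin_cases k
  · simp only [Fin.zero_eta, Fin.isValue, Pi.smul_apply, smul_eq_mul]
    field_simp
    linarith
  · simp [h1]

lemma branch_re_smul {t : ℝ} (hp : ∀ k, |(t • z) k| ≤ 1 / 2) :
    ((branch z (toTorus (t • z))).re < 0 ↔ |t| < 1) ∧
    ((branch z (toTorus (t • z))).re = 0 ↔ |t| = 1) := by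
  have h0 := hz.abs_lt 0
  have h1 := abs_pos.2 hz.ne_zero
  have h2 := abs_nonneg (z 0)
  rw [branch_re hp]
  simp only [Pi.smul_apply, smul_eq_mul, abs_mul]
  rcases lt_trichotomy |t| 1 with ht | ht | ht
  · have e1 : |t| * |z 1| - |z 1| < 0 := by nlinarith
    have e2 : |t| * |z 0| - (|z 0| + 1 / 2) / 2 < 0 := by nlinarith
    have := max_lt e1 e2
    exact ⟨iff_of_true this ht, iff_of_false this.ne ht.ne⟩
  · have e1 : |t| * |z 1| - |z 1| = 0 := by rw [ht]; ring
    have e2 : |t| * |z 0| - (|z 0| + 1 / 2) / 2 < 0 := by rw [ht]; linarith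
    rw [max_eq_left (by linarith), e1]
    simp [ht]
  · have e1 : 0 < |t| * |z 1| - |z 1| := by nlinarith
    have := lt_max_of_lt_left (c := |t| * |z 0| - (|z 0| + 1 / 2) / 2) e1
    exact ⟨iff_of_false this.not_gt ht.not_gt, iff_of_false this.ne' ht.ne'⟩

lemma branch_eq_zero_iff {p : Plane} (hp : ∀ k, |p k| ≤ 1 / 2) :
    branch z (toTorus p) = 0 ↔ p = z ∨ p = -z := by
  constructor
  · intro h
    have him : (branch z (toTorus p)).im = 0 := by rw [h]; rfl
    have hre : (branch z (toTorus p)).re = 0 := by rw [h]; rfl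
    obtain ⟨t, rfl⟩ := exists_smul_of_side_eq_zero hz
      ((pos_or_side_eq_zero hz hp him).resolve_left (by rw [hre]; exact lt_irrefl _))
    rcases (abs_eq zero_le_one).1 ((branch_re_smul hz hp).2.1 hre) with rfl | rfl
    · left; simp
    · right; simp
  · intro h
    have : ∃ t : ℝ, |t| = 1 ∧ p = t • z := by
      rcases h with h | h
      · exact ⟨1, by simp, by simpa using h⟩
      · exact ⟨-1, by simp, by simpa using h⟩
    obtain ⟨t, ht, rfl⟩ := this
    apply Complex.ext
    · exact (branch_re_smul hz hp).2.2 ht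
    · rw [branch_im hz hp, side]
      simp; left; ring

lemma branch_eq_zero_iff' (x : Torus) :
    branch z x = 0 ↔ x = toTorus z ∨ x = toTorus (-z) := by
  constructor
  · obtain ⟨p, hp, rfl⟩ := exists_toTorus_eq x
    intro h
    have hp' : ∀ k, |p k| ≤ 1 / 2 := fun k => abs_le.2 ⟨(hp k).1, (hp k).2.le⟩
    rcases (branch_eq_zero_iff hz hp').1 h with rfl | rfl <;> simp
  · have hz1 : ∀ k, |z k| ≤ 1 / 2 := fun k => (hz.abs_lt k).le
    have hz2 : ∀ k, |(-z) k| ≤ 1 / 2 := fun k => by simpa using hz1 k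
    rintro (rfl | rfl)
    · exact (branch_eq_zero_iff hz hz1).2 (Or.inl rfl)
    · exact (branch_eq_zero_iff hz hz2).2 (Or.inr rfl)

/-- Near `z` the branching function is real linear in the difference to `z`. -/
lemma branch_add_smul : ∃ δ > 0, ∀ ζ : Plane, (∀ k, |ζ k| < δ) → ∀ s ∈ Set.Icc (0 : ℝ) 1,
    branch z (toTorus (z + s • ζ)) = s * branch z (toTorus (z + ζ)) := by
  have hc := cutoff_pos hz
  have h1 := abs_pos.2 hz.ne_zero
  have hc0 : 2 * cutoff z ≤ 1 / 2 - |z 0| := by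
    unfold cutoff; linarith [min_le_left (1 / 2 - |z 0|) (1 / 2 - |z 1|)]
  have hc1 : 2 * cutoff z ≤ 1 / 2 - |z 1| := by
    unfold cutoff; linarith [min_le_right (1 / 2 - |z 0|) (1 / 2 - |z 1|)]
  have hck (k : Fin 2) : 2 * cutoff z ≤ 1 / 2 - |z k| := by fin_cases k <;> assumption
  refine ⟨min (cutoff z / 2) |z 1|, lt_min (by linarith) h1, fun ζ hζ => ?_⟩
  have key (s : ℝ) (hs : s ∈ Set.Icc (0 : ℝ) 1) :
      branch z (toTorus (z + s • ζ)) =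
        ⟨s * (SignType.sign (z 1) * ζ 1), s * (side z ζ * (cutoff z * cutoff z))⟩ := by
    have hsζ (k : Fin 2) : |s * ζ k| < min (cutoff z / 2) |z 1| := by
      rw [abs_mul, abs_of_nonneg hs.1]
      exact lt_of_le_of_lt (mul_le_of_le_one_left (abs_nonneg _) hs.2) (hζ k)
    have ha (k : Fin 2) : |(z + s • ζ) k| ≤ 1 / 2 - cutoff z := by
      have e1 := abs_add_le (z k) (s * ζ k)
      have e2 := (hsζ k).le.trans (min_le_left _ _)
      have e3 := hck k
      simp only [Pi.add_apply, Pi.smul_apply, smul_eq_mul]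
      linarith
    have hb (k : Fin 2) : |(z + s • ζ) k| ≤ 1 / 2 := (ha k).trans (by linarith)
    have hm (k : Fin 2) : min (cutoff z) (1 / 2 - |(z + s • ζ) k|) = cutoff z :=
      min_eq_left (by linarith [ha k])
    have hsgn : |(z + s • ζ) 1| = |z 1| + SignType.sign (z 1) * (s * ζ 1) := by
      have e := (abs_lt.1 ((hsζ 1).trans_le (min_le_right _ _)))
      simp only [Pi.add_apply, Pi.smul_apply, smul_eq_mul]
      rcases lt_or_gt_of_ne hz.ne_zero with h | h
      · rw [abs_of_neg h] at e ⊢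
        rw [abs_of_neg (by linarith), sign_neg h]
        simp; ring
      · rw [abs_of_pos h] at e ⊢
        rw [abs_of_pos (by linarith), sign_pos h]
        simp
    have hmax : |(z + s • ζ) 0| - (|z 0| + 1 / 2) / 2 ≤ |(z + s • ζ) 1| - |z 1| := by
      have e1 := abs_add_le (z 0) (s * ζ 0)
      have e2 := (hsζ 0).le.trans (min_le_left _ _)
      have e3 := (hsζ 1).le.trans (min_le_left _ _)
      have e4 := abs_sub_abs_le_abs_sub (z 1) ((z + s • ζ) 1)
      have e5 : |z 1 - (z + s • ζ) 1| = |s * ζ 1| := by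
        rw [abs_sub_comm]; simp
      have e6 : |(z + s • ζ) 0| = |z 0 + s * ζ 0| := by simp
      rw [e5] at e4
      rw [e6]
      linarith
    apply Complex.ext
    · rw [branch_re hb, max_eq_left hmax, hsgn]
      ring
    · rw [branch_im hz hb, hm, hm]
      simp [side]
      ring
  intro s hs
  have k1 := key 1 ⟨zero_le_one, le_rfl⟩
  rw [one_smul] at k1
  rw [key s hs, k1]
  apply Complex.ext <;> simp

/-- Near each zero the branching function is real linear in the difference to this zero. -/
lemma branch_add_smul_of_eq_zero {q : Plane} (hq : branch z (toTorus q) = 0) :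
    ∃ δ > 0, ∀ ζ : Plane, (∀ k, |ζ k| < δ) → ∀ s ∈ Set.Icc (0 : ℝ) 1,
    branch z (toTorus (q + s • ζ)) = s * branch z (toTorus (q + ζ)) := by
  obtain ⟨δ, hδ, h⟩ := branch_add_smul hz
  refine ⟨δ, hδ, fun ζ hζ s hs => ?_⟩
  rcases (branch_eq_zero_iff' hz _).1 hq with hq | hq
  · rw [toTorus_add, hq, ← toTorus_add, h ζ hζ s hs, toTorus_add, toTorus_add, hq]
  · have e (ξ : Plane) : branch z (toTorus (q + ξ)) =
        (starRingEnd ℂ) (branch z (toTorus (z + -ξ))) := by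
      rw [← branch_neg hz, ← toTorus_neg, neg_add, neg_neg, toTorus_add, toTorus_add, hq]
    rw [e, e, ← smul_neg, h (-ζ) (by simpa using hζ) s hs]
    simp

end Branching

/-! ### The surface as the Riemann surface of a square root -/

section Root

/-- For `σ = true` (`false`) the continuous branch of the square root on the closed upper (lower)
half-plane with nonnegative real part. -/
def halfRoot (σ : Bool) (w : ℂ) : ℂ :=
  ⟨√((‖w‖ + w.re) / 2), (if σ then 1 else -1) * √((‖w‖ - w.re) / 2)⟩

lemma continuous_halfRoot (σ : Bool) : Continuous (halfRoot σ) := by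
  have e : halfRoot σ = fun w => ((√((‖w‖ + w.re) / 2) : ℝ) : ℂ) +
      (((if σ then 1 else -1) * √((‖w‖ - w.re) / 2) : ℝ) : ℂ) * Complex.I := by
    funext w
    apply Complex.ext <;> simp [halfRoot]
  rw [e]
  fun_prop

lemma halfRoot_sq {σ : Bool} {w : ℂ} (h : if σ then 0 ≤ w.im else w.im ≤ 0) :
    halfRoot σ w ^ 2 = w := by
  have hre := abs_le.1 (Complex.abs_re_le_norm w)
  have h1 : 0 ≤ (‖w‖ + w.re) / 2 := by linarith [hre.1]
  have h2 : 0 ≤ (‖w‖ - w.re) / 2 := by linarith [hre.2]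
  have h3 : √((‖w‖ + w.re) / 2) * √((‖w‖ - w.re) / 2) = |w.im| / 2 := by
    rw [← Real.sqrt_mul h1, ← Real.sqrt_sq (by positivity : 0 ≤ |w.im| / 2)]
    congr 1
    have := Complex.sq_norm w
    rw [Complex.normSq_apply] at this
    rw [div_pow, sq_abs]
    nlinarith
  have h4 := Real.mul_self_sqrt h1
  have h5 := Real.mul_self_sqrt h2
  apply Complex.ext
  · rw [sq, Complex.mul_re]
    simp only [halfRoot]
    cases σ <;> simp only [Bool.false_eq_true, if_false, if_true] <;> linarith
  · rw [sq, Complex.mul_im]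
    simp only [halfRoot]
    cases σ
    · simp only [Bool.false_eq_true, if_false] at h ⊢
      rw [abs_of_nonpos h] at h3
      linarith
    · simp only [if_true] at h ⊢
      rw [abs_of_nonneg h] at h3
      linarith

lemma halfRoot_of_nonneg {w : ℂ} (him : w.im = 0) (hre : 0 ≤ w.re) (σ σ' : Bool) :
    halfRoot σ w = halfRoot σ' w := by
  have : ‖w‖ = w.re := by
    have : w = (w.re : ℂ) := Complex.ext (by simp) (by simpa using him)
    rw [this, Complex.norm_real, Real.norm_eq_abs, abs_of_nonneg hre, Complex.ofReal_re]
  simp [halfRoot, this]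

lemma halfRoot_not_of_nonpos {w : ℂ} (him : w.im = 0) (hre : w.re ≤ 0) (σ : Bool) :
    halfRoot (!σ) w = -halfRoot σ w := by
  have : ‖w‖ = -w.re := by
    have : w = (w.re : ℂ) := Complex.ext (by simp) (by simpa using him)
    rw [this, Complex.norm_real, Real.norm_eq_abs, abs_of_nonpos hre, Complex.ofReal_re]
  apply Complex.ext
  · simp [halfRoot, this]
  · cases σ <;> simp [halfRoot]

/-- The sign attached to a sheet. -/
def sheetSign (i : Bool) : ℂ := if i then -1 else 1

lemma sheetSign_not (i : Bool) : sheetSign (!i) = -sheetSign i := by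
  cases i <;> simp [sheetSign]

lemma sheetSign_sq (i : Bool) : sheetSign i ^ 2 = 1 := by
  cases i <;> simp [sheetSign]

variable {z : Plane} (hz : Admissible z)

include hz in
lemma branch_im_of_mem {p : Plane} {σ : Bool} (h : p ∈ halfSquare z σ) :
    if σ then 0 ≤ (branch z (toTorus p)).im else (branch z (toTorus p)).im ≤ 0 := by
  have hc := cutoff_pos hz
  have hp (k : Fin 2) : 0 ≤ min (cutoff z) (1 / 2 - |p k|) :=
    le_min hc.le (by linarith [h.1 k])
  rw [branch_im hz h.1]
  have h2 := h.2
  cases σ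
  · simp only [Bool.false_eq_true, if_false] at h2 ⊢
    exact mul_nonpos_of_nonpos_of_nonneg h2 (mul_nonneg (hp 0) (hp 1))
  · simp only [if_true] at h2 ⊢
    exact mul_nonneg h2 (mul_nonneg (hp 0) (hp 1))

lemma side_eq_zero_of_mem {p : Plane} {σ : Bool} (h : p ∈ halfSquare z σ)
    (h' : p ∈ halfSquare z (!σ)) : side z p = 0 := by
  have h1 := h.2
  have h2 := h'.2
  cases σ <;> simp at h1 h2 <;> linarith

lemma mem_segment_smul {t : ℝ} (h : |t| ≤ 1) : t • z ∈ segment ℝ (-z) z := by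
  rw [abs_le] at h
  exact ⟨(1 - t) / 2, (1 + t) / 2, by linarith [h.2], by linarith [h.1], by ring, by module⟩

lemma abs_le_of_mem_segment {p : Plane} (h : p ∈ segment ℝ (-z) z) :
    ∃ t : ℝ, |t| ≤ 1 ∧ p = t • z := by
  obtain ⟨a, b, ha, hb, hab, rfl⟩ := h
  exact ⟨b - a, abs_le.2 ⟨by linarith, by linarith⟩, by module⟩

include hz in
lemma not_mem_openSegment_smul {t : ℝ} (h : 1 ≤ |t|) : t • z ∉ openSegment ℝ (-z) z := by
  rintro ⟨a, b, ha, hb, hab, h'⟩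
  have e := congrFun h' 1
  simp only [Pi.add_apply, Pi.smul_apply, Pi.neg_apply, smul_eq_mul] at e
  have : t = b - a := mul_right_cancel₀ hz.ne_zero (by linarith)
  rw [this] at h
  exact absurd h (not_le.2 (abs_lt.2 ⟨by linarith, by linarith⟩))

lemma mem_openSegment_smul {t : ℝ} (h : |t| < 1) : t • z ∈ openSegment ℝ (-z) z := by
  rw [abs_lt] at h
  exact ⟨(1 - t) / 2, (1 + t) / 2, by linarith [h.2], by linarith [h.1], by ring, by module⟩

include hz in
lemma branch_im_eq_zero_of_side {p : Plane} (hp : ∀ k, |p k| ≤ 1 / 2) (h : side z p = 0) :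
    (branch z (toTorus p)).im = 0 := by
  rw [branch_im hz hp, h, zero_mul]

/-- The square root of the branching function, as a function on the surface. -/
def root : C(M z, ℂ) where
  toFun := Quot.lift
    (fun x => sheetSign x.1.2.2 * halfRoot x.1.2.1 (branch z (toTorus x.1.1))) fun x y h => by
      cases h with
      | line p σ i h h' hp =>
        have h0 := side_eq_zero_of_mem h h'
        have him := branch_im_eq_zero_of_side hz h.1 h0
        have hre : 0 ≤ (branch z (toTorus p)).re := by
          obtain ⟨t, rfl⟩ := exists_smul_of_side_eq_zero hz h0
          by_contra hlt
          exact hp (mem_openSegment_smul ((branch_re_smul hz h.1).1.1 (not_le.1 hlt)))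
        simp only
        rw [halfRoot_of_nonneg him hre]
      | slit p σ i h h' hp =>
        have h0 := side_eq_zero_of_mem h h'
        have him := branch_im_eq_zero_of_side hz h.1 h0
        have hre : (branch z (toTorus p)).re ≤ 0 := by
          obtain ⟨t, ht, rfl⟩ := abs_le_of_mem_segment hp
          rcases lt_or_eq_of_le ht with ht | ht
          · exact ((branch_re_smul hz h.1).1.2 ht).le
          · exact ((branch_re_smul hz h.1).2.2 ht).le
        simp only
        rw [halfRoot_not_of_nonpos him hre, sheetSign_not]
        ring
      | edge p k σ σ' i h h' =>
        have hk : p k = -(1 / 2) := by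
          have h1 := (abs_le.1 (h.1 k)).1
          have h2 := (abs_le.1 (h'.1 k)).2
          simp only [Pi.add_apply, Pi.single_eq_same] at h2
          linarith
        have hpos := branch_pos_of_half hz (x := toTorus p) k
          (toTorus_half_of_abs_eq (by rw [hk]; norm_num [abs_of_pos]))
        have e : toTorus (p + Pi.single k 1) = toTorus p :=
          (toTorus_eq_of_glue (Glue.edge p k σ σ' i h h')).symm
        simp only
        rw [e, halfRoot_of_nonneg hpos.1 hpos.2.le]
  continuous_toFun := by
    refine continuous_quot_lift _ ?_
    have h1 : Continuous fun x : Pieces z => toTorus x.1.1 :=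
      continuous_toTorus.comp (continuous_fst.comp continuous_subtype_val)
    have h2 : Continuous fun q : ℂ × Bool × Bool => sheetSign q.2.2 * halfRoot q.2.1 q.1 := by
      refine continuous_prod_of_discrete_right.2 fun b => ?_
      have : Continuous fun w : ℂ => sheetSign b.2 * halfRoot b.1 w :=
        continuous_const.mul (continuous_halfRoot b.1)
      exact this
    exact h2.comp (((continuous_branch hz).comp h1).prodMk
      (continuous_snd.comp continuous_subtype_val))

/-- The point of the surface with given position, half and sheet. -/
def mkPoint (p : Plane) (σ i : Bool) (h : p ∈ halfSquare z σ) : M z := Quot.mk _ ⟨(p, σ, i), h⟩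

lemma exists_mkPoint (m : M z) : ∃ p σ i h, m = mkPoint p σ i h := by
  obtain ⟨⟨⟨p, σ, i⟩, h⟩, rfl⟩ := Quot.exists_rep m
  exact ⟨p, σ, i, h, rfl⟩

lemma proj_mkPoint (p : Plane) (σ i : Bool) (h : p ∈ halfSquare z σ) :
    proj z (mkPoint p σ i h) = toTorus p := rfl

lemma root_mkPoint (p : Plane) (σ i : Bool) (h : p ∈ halfSquare z σ) :
    root hz (mkPoint p σ i h) = sheetSign i * halfRoot σ (branch z (toTorus p)) := rfl

lemma root_sq (m : M z) : root hz m ^ 2 = branch z (proj z m) := by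
  obtain ⟨p, σ, i, h, rfl⟩ := exists_mkPoint m
  rw [root_mkPoint, proj_mkPoint, mul_pow, sheetSign_sq, one_mul,
    halfRoot_sq (branch_im_of_mem hz h)]

omit hz in
lemma exists_mem_halfSquare {p : Plane} (hp : ∀ k, |p k| ≤ 1 / 2) : ∃ σ, p ∈ halfSquare z σ := by
  rcases le_total 0 (side z p) with h | h
  · exact ⟨true, hp, by simpa using h⟩
  · exact ⟨false, hp, by simpa using h⟩

omit hz in
lemma mkPoint_shift {p : Plane} {σ i : Bool} (h : p ∈ halfSquare z σ) {k : Fin 2}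
    (hk : p k = 1 / 2) : ∃ σ' h', mkPoint p σ i h = mkPoint (p - Pi.single k 1) σ' i h' := by
  obtain ⟨q, rfl⟩ : ∃ q : Plane, p = q + Pi.single k 1 := ⟨p - Pi.single k 1, by simp⟩
  have hq : ∀ j, |q j| ≤ 1 / 2 := by
    intro j
    by_cases hj : j = k
    · subst hj
      simp only [Pi.add_apply, Pi.single_eq_same] at hk
      rw [abs_le]
      constructor <;> linarith
    · have := h.1 j
      simpa [Pi.single_eq_of_ne hj] using this
  obtain ⟨σ', hσ'⟩ := exists_mem_halfSquare (z := z) hq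
  have hs : q + Pi.single k 1 - Pi.single k 1 = q := by simp
  refine ⟨σ', by rw [hs]; exact hσ', ?_⟩
  simp only [hs]
  exact (Quot.sound (Glue.edge q k σ' σ i hσ' h)).symm

omit hz in
lemma exists_mkPoint_normalized (m : M z) : ∃ p σ i h, (∀ k, -(1 / 2) ≤ p k ∧ p k < 1 / 2) ∧
    m = mkPoint p σ i h := by
  have step (k : Fin 2) (p : Plane) (σ i : Bool) (h : p ∈ halfSquare z σ) :
      ∃ p' σ' h', (-(1 / 2) ≤ p' k ∧ p' k < 1 / 2) ∧ (∀ j, j ≠ k → p' j = p j) ∧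
        mkPoint p σ i h = mkPoint p' σ' i h' := by
    have hk := abs_le.1 (h.1 k)
    rcases lt_or_eq_of_le hk.2 with hlt | heq
    · exact ⟨p, σ, h, ⟨hk.1, hlt⟩, fun _ _ => rfl, rfl⟩
    · obtain ⟨σ', h', e⟩ := mkPoint_shift (i := i) h heq
      refine ⟨_, σ', h', ?_, fun j hj => by simp [Pi.single_eq_of_ne hj], e⟩
      simp only [Pi.sub_apply, Pi.single_eq_same, heq]
      norm_num
  obtain ⟨p, σ, i, h, rfl⟩ := exists_mkPoint m
  obtain ⟨p1, σ1, h1, hp1, -, e1⟩ := step 0 p σ i h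
  obtain ⟨p2, σ2, h2, hp2, hj, e2⟩ := step 1 p1 σ1 i h1
  refine ⟨p2, σ2, i, h2, ?_, e1.trans e2⟩
  intro k
  fin_cases k
  · have := hj 0 (by decide)
    simp only [Fin.zero_eta, Fin.isValue, this]
    exact hp1
  · exact hp2

omit hz in
lemma eq_of_toTorus_eq {p q : Plane} (hp : ∀ k, -(1 / 2) ≤ p k ∧ p k < 1 / 2)
    (hq : ∀ k, -(1 / 2) ≤ q k ∧ q k < 1 / 2) (h : toTorus p = toTorus q) : p = q := by
  have h0 : toTorus (p - q) = 0 := by rw [toTorus_sub, h, sub_self]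
  rw [toTorus_eq_zero_iff] at h0
  funext k
  obtain ⟨n, hn⟩ := h0 k
  simp only [Pi.sub_apply] at hn
  have h1 : (n : ℝ) < 1 := by rw [← hn]; linarith [(hp k).2, (hq k).1]
  have h2 : (-1 : ℝ) < n := by rw [← hn]; linarith [(hp k).1, (hq k).2]
  have : n = 0 := by
    have h1' : n < 1 := by exact_mod_cast h1
    have h2' : -1 < n := by exact_mod_cast h2
    omega
  rw [this] at hn
  push_cast at hn
  linarith

include hz in
lemma mkPoint_eq_of_root_eq {p : Plane} {σ σ' i i' : Bool} (h : p ∈ halfSquare z σ)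
    (h' : p ∈ halfSquare z σ')
    (e : root hz (mkPoint p σ i h) = root hz (mkPoint p σ' i' h')) :
    mkPoint p σ i h = mkPoint p σ' i' h' := by
  rw [root_mkPoint, root_mkPoint] at e
  have hsq := halfRoot_sq (branch_im_of_mem hz h)
  have hsq' := halfRoot_sq (branch_im_of_mem hz h')
  have hroot0 {τ : Bool} (hτ : halfRoot τ (branch z (toTorus p)) ^ 2 = branch z (toTorus p))
      (hne : branch z (toTorus p) ≠ 0) : halfRoot τ (branch z (toTorus p)) ≠ 0 := by
    intro h0
    rw [h0] at hτ
    exact hne (by rw [← hτ]; ring)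
  by_cases hb : branch z (toTorus p) = 0
  · -- At a singularity all halves and sheets are glued.
    obtain ⟨t, ht, hpt⟩ : ∃ t : ℝ, |t| = 1 ∧ p = t • z := by
      rcases (branch_eq_zero_iff hz h.1).1 hb with h | h
      · exact ⟨1, by simp, by simpa using h⟩
      · exact ⟨-1, by simp, by simpa using h⟩
    have hside : side z p = 0 := by rw [hpt]; simp [side]; ring
    have hall (τ : Bool) : p ∈ halfSquare z τ := ⟨h.1, by cases τ <;> simp [hside]⟩
    have hline (τ j : Bool) : mkPoint p τ j (hall τ) = mkPoint p (!τ) j (hall (!τ)) :=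
      Quot.sound (Glue.line p τ j _ _ (by rw [hpt]; exact not_mem_openSegment_smul hz ht.ge))
    have hslit (τ j : Bool) : mkPoint p τ j (hall τ) = mkPoint p (!τ) (!j) (hall (!τ)) :=
      Quot.sound (Glue.slit p τ j _ _ (by rw [hpt]; exact mem_segment_smul ht.le))
    have hto (τ j : Bool) : mkPoint p τ j (hall τ) = mkPoint p true true (hall true) := by
      cases τ <;> cases j
      · exact hslit false false
      · exact hline false true
      · exact (hline true false).trans (hslit false false)
      · rfl
    rw [hto σ i, hto σ' i']
  · by_cases hσ : σ = σ'
    · subst hσ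
      have := mul_right_cancel₀ (hroot0 hsq hb) e
      have hi : i = i' := by
        cases i <;> cases i' <;> simp [sheetSign] at this ⊢
        · exact absurd this (by norm_num [Complex.ext_iff])
        · exact absurd this (by norm_num [Complex.ext_iff])
      rw [hi]
    · obtain rfl : σ' = !σ := by cases σ <;> cases σ' <;> simp_all
      have hside := side_eq_zero_of_mem h h'
      have him := branch_im_eq_zero_of_side hz h.1 hside
      obtain ⟨t, rfl⟩ := exists_smul_of_side_eq_zero hz hside
      have hne : (branch z (toTorus (t • z))).re ≠ 0 := fun h0 => hb (Complex.ext h0 him)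
      rcases lt_or_gt_of_ne hne with hlt | hgt
      · rw [halfRoot_not_of_nonpos him hlt.le, mul_neg, ← neg_mul] at e
        have := mul_right_cancel₀ (hroot0 hsq hb) e
        have hi : i' = !i := by
          cases i <;> cases i' <;> simp [sheetSign] at this ⊢
          · exact absurd this (by norm_num [Complex.ext_iff])
          · exact absurd this (by norm_num [Complex.ext_iff])
        subst hi
        exact Quot.sound (Glue.slit _ σ i h h'
          (mem_segment_smul ((branch_re_smul hz h.1).1.1 hlt).le))
      · rw [halfRoot_of_nonneg him hgt.le (!σ) σ] at e
        have := mul_right_cancel₀ (hroot0 hsq hb) e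
        have hi : i' = i := by
          cases i <;> cases i' <;> simp [sheetSign] at this ⊢
          · exact absurd this (by norm_num [Complex.ext_iff])
          · exact absurd this (by norm_num [Complex.ext_iff])
        subst hi
        refine Quot.sound (Glue.line _ σ _ h h' (not_mem_openSegment_smul hz ?_))
        by_contra hlt
        exact absurd ((branch_re_smul hz h.1).1.2 (not_le.1 hlt)) hgt.not_gt

/-- A point of the surface is determined by its projection and the value of the root. -/
lemma point_ext {m m' : M z} (h1 : proj z m = proj z m') (h2 : root hz m = root hz m') :
    m = m' := by
  obtain ⟨p, σ, i, h, hp, rfl⟩ := exists_mkPoint_normalized m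
  obtain ⟨p', σ', i', h', hp', rfl⟩ := exists_mkPoint_normalized m'
  obtain rfl := eq_of_toTorus_eq hp hp' h1
  exact mkPoint_eq_of_root_eq hz h h' h2

lemma exists_point {x : Torus} {w : ℂ} (h : w ^ 2 = branch z x) :
    ∃ m : M z, proj z m = x ∧ root hz m = w := by
  obtain ⟨p, hp, rfl⟩ := exists_toTorus_eq x
  obtain ⟨σ, hσ⟩ := exists_mem_halfSquare (z := z) fun k => abs_le.2 ⟨(hp k).1, (hp k).2.le⟩
  have hsq := halfRoot_sq (branch_im_of_mem hz hσ)
  rw [← hsq, sq_eq_sq_iff_eq_or_eq_neg] at h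
  rcases h with h | h
  · exact ⟨mkPoint p σ false hσ, rfl, by rw [root_mkPoint, h]; simp [sheetSign]⟩
  · exact ⟨mkPoint p σ true hσ, rfl, by rw [root_mkPoint, h]; simp [sheetSign]⟩

instance : CompactSpace (M z) := by
  have : CompactSpace (Pieces z) := by
    have hK : IsCompact {x : Plane × Bool × Bool | x.1 ∈ halfSquare z x.2.1} := by
      have h1 : IsCompact ((Set.univ.pi fun _ : Fin 2 => Set.Icc (-(1 / 2) : ℝ) (1 / 2)) ×ˢ
          (Set.univ : Set (Bool × Bool))) :=
        (isCompact_univ_pi fun _ => isCompact_Icc).prod isCompact_univ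
      refine h1.of_isClosed_subset ?_ ?_
      · have hs : Continuous fun p : Plane => side z p := by unfold side; fun_prop
        have hcl (σ : Bool) : IsClosed (halfSquare z σ) := by
          have hb : IsClosed {p : Plane | ∀ k, |p k| ≤ 1 / 2} := by
            simp only [Set.ofPred_forall]
            exact isClosed_iInter fun k =>
              isClosed_le (continuous_abs.comp (continuous_apply k)) continuous_const
          cases σ
          · simpa [halfSquare, Set.ofPred_and] using hb.inter (isClosed_le hs continuous_const)
          · simpa [halfSquare, Set.ofPred_and] using hb.inter (isClosed_le continuous_const hs)
        have e : {x : Plane × Bool × Bool | x.1 ∈ halfSquare z x.2.1} =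
            ⋃ σ : Bool, (halfSquare z σ) ×ˢ ({σ} ×ˢ Set.univ) := by
          ext ⟨p, σ, i⟩
          simp
        rw [e]
        exact isClosed_iUnion_of_finite fun σ =>
          (hcl σ).prod ((isClosed_discrete _).prod isClosed_univ)
      · rintro ⟨p, σ, i⟩ h
        exact ⟨fun k _ => abs_le.1 (h.1 k), trivial⟩
    exact isCompact_iff_compactSpace.1 hK
  exact Quot.compactSpace

include hz in
lemma t2Space : T2Space (M z) :=
  T2Space.of_injective_continuous (f := fun m => (proj z m, root hz m))
    (fun _ _ h => point_ext hz (congrArg Prod.fst h) (congrArg Prod.snd h))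
    ((proj z).continuous.prodMk (root hz).continuous)

lemma isClosedEmbedding_proj_root : IsClosedEmbedding fun m : M z => (proj z m, root hz m) :=
  ((proj z).continuous.prodMk (root hz).continuous).isClosedEmbedding
    fun _ _ h => point_ext hz (congrArg Prod.fst h) (congrArg Prod.snd h)

/-- Continuity of a map into the surface can be checked on the projection and the root. -/
lemma continuousOn_iff {Y : Type*} [TopologicalSpace Y] {f : Y → M z} {S : Set Y} :
    ContinuousOn f S ↔ ContinuousOn (fun y => proj z (f y)) S ∧
      ContinuousOn (fun y => root hz (f y)) S := by
  rw [(isClosedEmbedding_proj_root hz).isInducing.continuousOn_iff]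
  exact ⟨fun h => ⟨continuous_fst.comp_continuousOn h, continuous_snd.comp_continuousOn h⟩,
    fun h => h.1.prodMk h.2⟩

lemma continuous_iff {Y : Type*} [TopologicalSpace Y] {f : Y → M z} :
    Continuous f ↔ Continuous (fun y => proj z (f y)) ∧ Continuous (fun y => root hz (f y)) := by
  simp only [← continuousOn_univ, continuousOn_iff hz]

lemma root_eq_zero_iff (m : M z) : root hz m = 0 ↔ m ∈ sing z := by
  rw [← pow_eq_zero_iff two_ne_zero, root_sq, branch_eq_zero_iff' hz]
  rfl

/-- The point of the surface with a given projection and value of the root. -/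
def ofRoot (x : Torus) (w : ℂ) (h : w ^ 2 = branch z x) : M z := (exists_point hz h).choose

lemma proj_ofRoot (x : Torus) (w : ℂ) (h : w ^ 2 = branch z x) : proj z (ofRoot hz x w h) = x :=
  (exists_point hz h).choose_spec.1

lemma root_ofRoot (x : Torus) (w : ℂ) (h : w ^ 2 = branch z x) : root hz (ofRoot hz x w h) = w :=
  (exists_point hz h).choose_spec.2

end Root

/-! ### Deck transformation, hyperelliptic involution and unique lifting -/

section Symmetries
variable {z : Plane} (hz : Admissible z)

/-- A continuous map into the surface from its projection and its root. -/
lemma continuous_ofRoot {Y : Type*} [TopologicalSpace Y] {x : Y → Torus} {w : Y → ℂ}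
    (hx : Continuous x) (hw : Continuous w) (h : ∀ y, w y ^ 2 = branch z (x y)) :
    Continuous fun y => ofRoot hz (x y) (w y) (h y) := by
  rw [continuous_iff hz]
  simp only [proj_ofRoot, root_ofRoot]
  exact ⟨hx, hw⟩

lemma neg_root_sq (m : M z) : (-root hz m) ^ 2 = branch z (proj z m) := by rw [neg_sq, root_sq]

lemma conj_root_sq (m : M z) : starRingEnd ℂ (root hz m) ^ 2 = branch z (-proj z m) := by
  rw [← map_pow, root_sq, branch_neg hz]

/-- The map underlying the deck transformation. -/
def tauFun (m : M z) : M z := ofRoot hz (proj z m) (-root hz m) (neg_root_sq hz m)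

lemma continuous_tauFun : Continuous (tauFun hz) :=
  continuous_ofRoot hz (proj z).continuous (root hz).continuous.neg (neg_root_sq hz)

/-- The deck transformation of `M(z)` over the torus: it exchanges the two sheets. -/
def tau : M z ≃ₜ M z where
  toFun := tauFun hz
  invFun := tauFun hz
  left_inv m := point_ext hz (by simp [tauFun, proj_ofRoot]) (by simp [tauFun, root_ofRoot])
  right_inv m := point_ext hz (by simp [tauFun, proj_ofRoot]) (by simp [tauFun, root_ofRoot])
  continuous_toFun := continuous_tauFun hz
  continuous_invFun := continuous_tauFun hz

lemma proj_tau (m : M z) : proj z (tau hz m) = proj z m :=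
  proj_ofRoot hz _ _ (neg_root_sq hz m)

lemma root_tau (m : M z) : root hz (tau hz m) = -root hz m :=
  root_ofRoot hz _ _ (neg_root_sq hz m)

lemma tau_tau (m : M z) : tau hz (tau hz m) = m := (tau hz).left_inv m

lemma tau_eq_self_iff (m : M z) : tau hz m = m ↔ m ∈ sing z := by
  rw [← root_eq_zero_iff hz]
  constructor
  · intro h
    have := congrArg (root hz) h
    rw [root_tau] at this
    exact self_eq_neg.1 this.symm
  · intro h
    exact point_ext hz (proj_tau hz m) (by rw [root_tau, h, neg_zero])

/-- A lift of the rotation `x ↦ -x` of the torus. -/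
def iota : C(M z, M z) where
  toFun m := ofRoot hz (-proj z m) (starRingEnd ℂ (root hz m)) (conj_root_sq hz m)
  continuous_toFun := continuous_ofRoot hz (proj z).continuous.neg
    (Complex.continuous_conj.comp (root hz).continuous) (conj_root_sq hz)

lemma proj_iota (m : M z) : proj z (iota hz m) = -proj z m :=
  proj_ofRoot hz _ _ (conj_root_sq hz m)

lemma root_iota (m : M z) : root hz (iota hz m) = starRingEnd ℂ (root hz m) :=
  root_ofRoot hz _ _ (conj_root_sq hz m)

lemma eq_or_eq_tau {m m' : M z} (h : proj z m = proj z m') : m' = m ∨ m' = tau hz m := by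
  have : root hz m' ^ 2 = root hz m ^ 2 := by rw [root_sq, root_sq, h]
  rcases sq_eq_sq_iff_eq_or_eq_neg.1 this with h1 | h1
  · exact Or.inl (point_ext hz h.symm h1)
  · exact Or.inr (point_ext hz (by rw [proj_tau, h]) (by rw [root_tau, h1]))

/-- Two lifts of the same map from a connected set agree up to the deck transformation, if they
avoid the singularities. -/
lemma eqOn_or_eqOn_tau {Y : Type*} [TopologicalSpace Y] {S : Set Y} (hS : _root_.IsPreconnected S)
    {a b : Y → M z} (ha : ContinuousOn a S) (hb : ContinuousOn b S)
    (h : ∀ y ∈ S, proj z (a y) = proj z (b y)) (hsing : ∀ y ∈ S, a y ∉ sing z) :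
    Set.EqOn b a S ∨ Set.EqOn b (fun y => tau hz (a y)) S := by
  have ha' := ((continuousOn_iff hz).1 ha).2
  have hb' := ((continuousOn_iff hz).1 hb).2
  have := hS.eq_or_eq_neg_of_sq_eq (f := fun y => root hz (b y)) (g := fun y => root hz (a y))
    hb' ha' (fun y hy => by simp only [Pi.pow_apply, root_sq, h y hy])
    (fun {y} hy => (root_eq_zero_iff hz _).not.2 (hsing y hy))
  rcases this with h1 | h1
  · exact Or.inl fun y hy => point_ext hz (h y hy).symm (h1 hy)
  · exact Or.inr fun y hy => point_ext hz (by rw [proj_tau, h y hy]) (by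
      rw [root_tau]; exact h1 hy)

include hz in
lemma isPreconnected_half (σ : Bool) :
    _root_.IsPreconnected {p | p ∈ halfSquare z σ ∧ p ≠ z ∧ p ≠ -z} := by
  -- The set lies between its convex interior and the closure of the latter.
  let s : ℝ := if σ then 1 else -1
  let C : Set Plane := {p | (∀ k, |p k| ≤ 1 / 2) ∧ 0 < s * side z p}
  have hmem (p : Plane) : p ∈ halfSquare z σ ↔ (∀ k, |p k| ≤ 1 / 2) ∧ 0 ≤ s * side z p := by
    cases σ <;> simp [halfSquare, s]
  have hlin (a b : ℝ) (p q : Plane) : side z (a • p + b • q) = a * side z p + b * side z q := by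
    simp [side]; ring
  have hsq {a b : ℝ} (ha : 0 ≤ a) (hb : 0 ≤ b) (hab : a + b = 1) {p q : Plane}
      (hp : ∀ k, |p k| ≤ 1 / 2) (hq : ∀ k, |q k| ≤ 1 / 2) (k : Fin 2) :
      |(a • p + b • q) k| ≤ 1 / 2 := by
    have e1 := abs_le.1 (hp k)
    have e2 := abs_le.1 (hq k)
    simp only [Pi.add_apply, Pi.smul_apply, smul_eq_mul]
    have hb' : b = 1 - a := by linarith
    rw [abs_le]
    constructor <;> nlinarith
  have hC : Convex ℝ C := by
    intro p hp q hq a b ha hb hab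
    refine ⟨hsq ha hb hab hp.1 hq.1, ?_⟩
    rw [hlin]
    rcases eq_or_lt_of_le ha with ha' | ha'
    · have : b = 1 := by linarith
      rw [← ha', this]
      have := hq.2
      linarith
    · have h1 := mul_pos ha' hp.2
      have h2 := mul_nonneg hb hq.2.le
      nlinarith
  let c : Plane := ![-(s * z 1), s * z 0]
  have hs : s = 1 ∨ s = -1 := by cases σ <;> simp [s]
  have hss : s * s = 1 := by rcases hs with h | h <;> rw [h] <;> norm_num
  have hsabs : |s| = 1 := by rcases hs with h | h <;> rw [h] <;> simp
  have hc : c ∈ C := by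
    constructor
    · intro k
      fin_cases k
      · simp only [c, Fin.zero_eta, Matrix.cons_val_zero, abs_neg, abs_mul, hsabs, one_mul]
        exact (hz.abs_lt 1).le
      · simp only [c, Fin.mk_one, Matrix.cons_val_one, Matrix.cons_val_zero, abs_mul, hsabs,
          one_mul]
        exact (hz.abs_lt 0).le
    · have h1 := sq_nonneg (z 0)
      have h2 : 0 < z 1 ^ 2 := by have := hz.ne_zero; positivity
      have : s * side z c = s * s * (z 0 ^ 2 + z 1 ^ 2) := by simp [side, c]; ring
      rw [this, hss]
      linarith
  refine hC.isPreconnected.subset_closure ?_ ?_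
  · intro p hp
    have hne : side z p ≠ 0 := fun h => by have := hp.2; rw [h] at this; simp at this
    refine ⟨(hmem p).2 ⟨hp.1, hp.2.le⟩, ?_, ?_⟩
    · rintro rfl; exact hne (by simp [side]; ring)
    · rintro rfl; exact hne (by simp [side]; ring)
  · rintro p ⟨hp, -⟩
    rw [hmem] at hp
    have hcont : Filter.Tendsto (fun t : ℝ => (1 - t) • p + t • c) (𝓝[>] 0) (𝓝 p) := by
      have : Continuous fun t : ℝ => (1 - t) • p + t • c := by fun_prop
      have h := (this.tendsto 0).mono_left (nhdsWithin_le_nhds (s := Set.Ioi 0))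
      simpa using h
    refine mem_closure_of_tendsto hcont ?_
    filter_upwards [Ioo_mem_nhdsGT zero_lt_one] with t ht
    refine ⟨hsq (by linarith [ht.2]) ht.1.le (by ring) hp.1 hc.1, ?_⟩
    rw [hlin]
    have h1 := mul_pos ht.1 hc.2
    have h2 := mul_nonneg (sub_pos.2 ht.2).le hp.2
    nlinarith

include hz in
lemma mkPoint_mem_sing_iff {p : Plane} {σ i : Bool} (h : p ∈ halfSquare z σ) :
    mkPoint p σ i h ∈ sing z ↔ p = z ∨ p = -z := by
  rw [← branch_eq_zero_iff hz h.1, branch_eq_zero_iff' hz]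
  rfl

include hz in
/-- The complement of the singularities is connected. -/
lemma isPreconnected_compl_sing : _root_.IsPreconnected (sing z)ᶜ := by
  let H (σ : Bool) : Set Plane := {p | p ∈ halfSquare z σ ∧ p ≠ z ∧ p ≠ -z}
  let R (σ i : Bool) : Set (M z) := Set.range fun p : H σ => mkPoint p.1 σ i p.2.1
  have hR (σ i : Bool) : _root_.IsPreconnected (R σ i) := by
    have := isPreconnected_iff_preconnectedSpace.1 (isPreconnected_half hz σ)
    refine isPreconnected_range ?_
    exact continuous_quot_mk.comp (by fun_prop)
  have hmem {p : Plane} {σ : Bool} (i : Bool) (h : p ∈ halfSquare z σ) (h1 : p ≠ z) (h2 : p ≠ -z) :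
      mkPoint p σ i h ∈ R σ i := ⟨⟨p, h, h1, h2⟩, rfl⟩
  have hside (t : ℝ) : side z (t • z) = 0 := by simp [side]; ring
  have hslit (i : Bool) : (R true i ∩ R false (!i)).Nonempty := by
    have h0 (σ : Bool) : (0 : Plane) ∈ halfSquare z σ := by
      refine ⟨by intro k; norm_num, ?_⟩
      cases σ <;> simp [side]
    have hne : (0 : Plane) ≠ z := fun h => hz.ne_zero (by rw [← h]; rfl)
    have hne' : (0 : Plane) ≠ -z := fun h => hne (by rw [← neg_eq_zero.1 h.symm])
    have hseg : (0 : Plane) ∈ segment ℝ (-z) z := by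
      have := mem_segment_smul (z := z) (t := 0) (by norm_num)
      rwa [zero_smul] at this
    refine ⟨mkPoint 0 true i (h0 true), hmem i _ hne hne', ?_⟩
    have : mkPoint 0 true i (h0 true) = mkPoint 0 (!true) (!i) (h0 _) :=
      Quot.sound (Glue.slit 0 true i _ _ hseg)
    rw [this]
    exact hmem (!i) _ hne hne'
  have hline (i : Bool) : (R true i ∩ R false i).Nonempty := by
    have hz0 : 0 < ‖z‖ := norm_pos_iff.2 fun h => hz.ne_zero (by rw [h]; rfl)
    have hz1 : ‖z‖ < 1 / 2 := (pi_norm_lt_iff (by norm_num)).2 fun k => by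
      simpa using hz.abs_lt k
    obtain ⟨t, ht1, ht2⟩ : ∃ t : ℝ, 1 < t ∧ t * ‖z‖ ≤ 1 / 2 :=
      ⟨1 / 2 / ‖z‖, (one_lt_div hz0).2 hz1, by rw [div_mul_cancel₀ _ hz0.ne']⟩
    have h0 (σ : Bool) : t • z ∈ halfSquare z σ := by
      refine ⟨fun k => ?_, by cases σ <;> simp [hside]⟩
      have := norm_le_pi_norm z k
      rw [Real.norm_eq_abs] at this
      simp only [Pi.smul_apply, smul_eq_mul, abs_mul, abs_of_pos (zero_lt_one.trans ht1)]
      nlinarith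
    have hne : t • z ≠ z := fun h => by
      have e := congrFun h 1
      simp only [Pi.smul_apply, smul_eq_mul] at e
      have := mul_right_cancel₀ hz.ne_zero (e.trans (one_mul _).symm)
      linarith
    have hne' : t • z ≠ -z := fun h => by
      have e := congrFun h 1
      simp only [Pi.smul_apply, smul_eq_mul, Pi.neg_apply] at e
      have := mul_right_cancel₀ hz.ne_zero (e.trans (neg_one_mul _).symm)
      linarith
    refine ⟨mkPoint (t • z) true i (h0 true), hmem i _ hne hne', ?_⟩
    have : mkPoint (t • z) true i (h0 true) = mkPoint (t • z) (!true) i (h0 _) :=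
      Quot.sound (Glue.line _ true i _ _ (not_mem_openSegment_smul hz (by
        rw [abs_of_pos (by linarith)]; exact ht1.le)))
    rw [this]
    exact hmem i _ hne hne'
  have hcompl : (sing z)ᶜ = (R true false ∪ R false false) ∪ (R true true ∪ R false true) := by
    ext m
    obtain ⟨p, σ, i, h, rfl⟩ := exists_mkPoint m
    rw [Set.mem_compl_iff, mkPoint_mem_sing_iff hz h]
    constructor
    · intro hne
      push Not at hne
      have := hmem i h hne.1 hne.2
      cases σ <;> cases i <;> simp [this]
    · have hR' (σ' i' : Bool) (hm : mkPoint p σ i h ∈ R σ' i') : ¬ (p = z ∨ p = -z) := by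
        obtain ⟨q, hq⟩ := hm
        rw [← mkPoint_mem_sing_iff hz h, ← hq, mkPoint_mem_sing_iff hz q.2.1]
        simpa using q.2.2
      rintro ((hm | hm) | (hm | hm))
      · exact hR' _ _ hm
      · exact hR' _ _ hm
      · exact hR' _ _ hm
      · exact hR' _ _ hm
  rw [hcompl]
  have h0 := (hR true false).union' (hline false) (hR false false)
  have h1 := (hR true true).union' (hline true) (hR false true)
  refine _root_.IsPreconnected.union' ?_ h0 h1
  obtain ⟨m, hm1, hm2⟩ := hslit false
  exact ⟨m, Or.inl hm1, Or.inr hm2⟩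

end Symmetries

/-! ### Charts of the surface by a strip -/

section Strip

/-- A primitive integer direction `v`, completed to a positive basis `v, n` of `ℤ²`, such that
both singularities of `M(z)` lie on the closed geodesic of the torus that is parallel to `v` and
halfway between two consecutive passages of the one through the origin. -/
structure Direction (z : Plane) where
  /-- the direction -/
  v : Fin 2 → ℤ
  /-- the complementary basis vector -/
  n : Fin 2 → ℤ
  det : v 0 * n 1 - v 1 * n 0 = 1
  half : ∃ j : ℤ, side (fun k => (v k : ℝ)) z = j + 1 / 2

/-- The closed strip of height `1` around the horizontal axis. -/
def strip : Set (ℝ × ℝ) := {p | |p.2| ≤ 1 / 2}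

lemma convex_strip : Convex ℝ strip := by
  have : strip = (LinearMap.snd ℝ ℝ ℝ) ⁻¹' Set.Icc (-(1 / 2)) (1 / 2) := by
    ext p; simp [strip, abs_le]
  rw [this]
  exact (convex_Icc _ _).linear_preimage _

lemma convex_openStrip : Convex ℝ {p : ℝ × ℝ | |p.2| < 1 / 2} := by
  have : {p : ℝ × ℝ | |p.2| < 1 / 2} =
      (LinearMap.snd ℝ ℝ ℝ) ⁻¹' Set.Ioo (-(1 / 2)) (1 / 2) := by
    ext p; simp [abs_lt]
  rw [this]
  exact (convex_Ioo _ _).linear_preimage _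

lemma strip_subset_closure : strip ⊆ closure {p : ℝ × ℝ | |p.2| < 1 / 2} := by
  have h := isOpenMap_snd.preimage_closure_eq_closure_preimage (continuous_snd (X := ℝ) (Y := ℝ))
    (Set.Ioo (-(1 / 2)) (1 / 2))
  rw [closure_Ioo (by norm_num)] at h
  have e : {p : ℝ × ℝ | |p.2| < 1 / 2} = Prod.snd ⁻¹' Set.Ioo (-(1 / 2)) (1 / 2) := by
    ext p; simp [abs_lt]
  rw [e, ← h]
  intro p hp
  exact abs_le.1 hp

variable {z : Plane} (hz : Admissible z) (e : Direction z)

namespace Direction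

/-- The point of the plane with coordinates `p` in the basis `v, n`. -/
def pt : ℝ × ℝ →ₗ[ℝ] Plane where
  toFun p := fun k => p.1 * e.v k + p.2 * e.n k
  map_add' p q := by funext k; simp; ring
  map_smul' c p := by funext k; simp; ring

lemma pt_apply (p : ℝ × ℝ) (k : Fin 2) : e.pt p k = p.1 * e.v k + p.2 * e.n k := rfl

lemma continuous_pt : Continuous e.pt := e.pt.continuous_of_finiteDimensional

lemma toTorus_pt_int (a b : ℤ) : toTorus (e.pt (a, b)) = 0 := by
  rw [toTorus_eq_zero_iff]
  intro k
  exact ⟨a * e.v k + b * e.n k, by simp [pt_apply]⟩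

lemma toTorus_pt_add_int (p : ℝ × ℝ) (a b : ℤ) :
    toTorus (e.pt (p + ((a : ℝ), (b : ℝ)))) = toTorus (e.pt p) := by
  rw [map_add, toTorus_add, toTorus_pt_int, add_zero]

/-- The coordinates of a point of the plane in the basis `v, n`. -/
def coord (p : Plane) : ℝ × ℝ :=
  (p 0 * e.n 1 - p 1 * e.n 0, e.v 0 * p 1 - e.v 1 * p 0)

lemma pt_coord (p : Plane) : e.pt (e.coord p) = p := by
  have h : (e.v 0 : ℝ) * e.n 1 - e.v 1 * e.n 0 = 1 := by exact_mod_cast e.det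
  funext k
  fin_cases k
  · simp only [coord, pt_apply, Fin.zero_eta, Fin.isValue]
    linear_combination p 0 * h
  · simp only [coord, pt_apply, Fin.mk_one, Fin.isValue]
    linear_combination p 1 * h

lemma coord_pt (p : ℝ × ℝ) : e.coord (e.pt p) = p := by
  have h : (e.v 0 : ℝ) * e.n 1 - e.v 1 * e.n 0 = 1 := by exact_mod_cast e.det
  ext
  · simp only [coord, pt_apply]
    linear_combination p.1 * h
  · simp only [coord, pt_apply]
    linear_combination p.2 * h

lemma continuous_coord : Continuous e.coord := by
  unfold coord
  fun_prop

/-- Points with the same projection to the torus differ by integer coordinates. -/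
lemma exists_int_of_toTorus_eq {p q : ℝ × ℝ} (h : toTorus (e.pt p) = toTorus (e.pt q)) :
    ∃ a b : ℤ, p = q + ((a : ℝ), (b : ℝ)) := by
  have h0 : toTorus (e.pt (p - q)) = 0 := by rw [map_sub, toTorus_sub, h, sub_self]
  rw [toTorus_eq_zero_iff] at h0
  choose m hm using h0
  refine ⟨m 0 * e.n 1 - m 1 * e.n 0, e.v 0 * m 1 - e.v 1 * m 0, ?_⟩
  have h1 := e.coord_pt (p - q)
  rw [← sub_eq_iff_eq_add', ← h1]
  ext <;> simp [coord, hm]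

include hz in
/-- The singularities lie on the boundary lines of the translates of the strip. -/
lemma snd_eq_of_branch_eq_zero {p : ℝ × ℝ} (h : branch z (toTorus (e.pt p)) = 0) :
    ∃ j : ℤ, p.2 = j + 1 / 2 := by
  obtain ⟨j, hj⟩ := e.half
  have hc : (e.coord z).2 = j + 1 / 2 := hj
  rcases (branch_eq_zero_iff' hz _).1 h with h | h
  · replace h : toTorus (e.pt p) = toTorus (e.pt (e.coord z)) := by rw [h, pt_coord]
    obtain ⟨a, b, rfl⟩ := e.exists_int_of_toTorus_eq h
    exact ⟨j + b, by simp [hc]; ring⟩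
  · have : -z = e.pt (-e.coord z) := by rw [map_neg, pt_coord]
    rw [this] at h
    obtain ⟨a, b, rfl⟩ := e.exists_int_of_toTorus_eq h
    exact ⟨-j - 1 + b, by simp [hc]; ring⟩

include hz in
lemma branch_ne_zero {p : ℝ × ℝ} (h : |p.2| < 1 / 2) : branch z (toTorus (e.pt p)) ≠ 0 := by
  intro h0
  obtain ⟨j, hj⟩ := e.snd_eq_of_branch_eq_zero hz h0
  rw [hj, abs_lt] at h
  have h1 : (-1 : ℝ) < j := by linarith [h.1]
  have h2 : (j : ℝ) < 0 := by linarith [h.2]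
  have h1' : -1 < j := by exact_mod_cast h1
  have h2' : j < 0 := by exact_mod_cast h2
  omega

open unitInterval in
include hz in
/-- The branching function has a continuous square root on the strip, since its zeros lie on the
boundary. -/
lemma exists_sqrt : ∃ w : ℝ × ℝ → ℂ, ContinuousOn w strip ∧
    ∀ p ∈ strip, w p ^ 2 = branch z (toTorus (e.pt p)) := by
  classical
  -- Off the zeros of the branching function, the square root is lifted along rays from the origin.
  let A := {p : ℝ × ℝ // p ∈ strip ∧ branch z (toTorus (e.pt p)) ≠ 0}
  have hb : Continuous fun p : ℝ × ℝ => branch z (toTorus (e.pt p)) :=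
    (continuous_branch hz).comp (continuous_toTorus.comp e.continuous_pt)
  have hne (t : I) (p : A) : branch z (toTorus (e.pt ((t : ℝ) • p.1))) ≠ 0 := by
    rcases lt_or_eq_of_le t.2.2 with ht | ht
    · refine e.branch_ne_zero hz ?_
      have hp : |p.1.2| ≤ 1 / 2 := p.2.1
      simp only [Prod.smul_snd, smul_eq_mul, abs_mul, abs_of_nonneg t.2.1]
      have := abs_nonneg p.1.2
      have := t.2.1
      rcases eq_or_lt_of_le (abs_nonneg p.1.2) with h0 | h0
      · rw [← h0]; norm_num
      · nlinarith
    · rw [ht, one_smul]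
      exact p.2.2
  let H : C(I × A, {w : ℂ // w ≠ 0}) :=
    ⟨fun x => ⟨_, hne x.1 x.2⟩, Continuous.subtype_mk
      (hb.comp ((continuous_subtype_val.comp continuous_fst).smul
        (continuous_subtype_val.comp continuous_snd))) _⟩
  have h0 : branch z (toTorus (e.pt 0)) ≠ 0 := e.branch_ne_zero hz (by norm_num)
  obtain ⟨w₀, hw₀⟩ := IsAlgClosed.exists_pow_nat_eq (branch z (toTorus (e.pt 0))) zero_lt_two
  have hw₀' : w₀ ≠ 0 := by
    rintro rfl
    exact h0 (by rw [← hw₀]; ring)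
  have cov := isCoveringMap_npow (𝕜 := ℂ) 2 (by norm_num)
  have hH0 (a : A) : H (0, a) = ⟨w₀ ^ 2, pow_ne_zero 2 hw₀'⟩ := by
    apply Subtype.ext
    simp [H, hw₀]
  let W := cov.liftHomotopy H (ContinuousMap.const A ⟨w₀, hw₀'⟩) hH0
  have hW (a : A) : (W (1, a)).1 ^ 2 = branch z (toTorus (e.pt a.1)) := by
    have := congrFun (cov.liftHomotopy_lifts H (ContinuousMap.const A ⟨w₀, hw₀'⟩) hH0) (1, a)
    refine (congrArg Subtype.val this).trans ?_
    simp [H]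
  let w : ℝ × ℝ → ℂ := fun p =>
    if h : p ∈ strip ∧ branch z (toTorus (e.pt p)) ≠ 0 then (W (1, ⟨p, h⟩)).1 else 0
  have hw (p : ℝ × ℝ) (hp : p ∈ strip) : w p ^ 2 = branch z (toTorus (e.pt p)) := by
    by_cases h : branch z (toTorus (e.pt p)) = 0
    · simp [w, h]
    · have : w p = (W (1, ⟨p, hp, h⟩)).1 := dif_pos ⟨hp, h⟩
      rw [this]
      exact hW ⟨p, hp, h⟩
  refine ⟨w, fun p hp => ?_, hw⟩
  by_cases h : branch z (toTorus (e.pt p)) = 0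
  · have hw0 : w p = 0 := by simpa [h] using hw p hp
    rw [ContinuousWithinAt, hw0, tendsto_zero_iff_norm_tendsto_zero]
    have h1 : Filter.Tendsto (fun p => √‖branch z (toTorus (e.pt p))‖) (𝓝[strip] p) (𝓝 0) := by
      have := (Real.continuous_sqrt.comp hb.norm).tendsto p
      simp only [Function.comp_apply, h, norm_zero, Real.sqrt_zero] at this
      exact this.mono_left nhdsWithin_le_nhds
    refine h1.congr' ?_
    filter_upwards [self_mem_nhdsWithin] with q hq
    rw [← hw q hq, norm_pow, Real.sqrt_sq (norm_nonneg _)]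
  · have hA : ContinuousOn w {p | p ∈ strip ∧ branch z (toTorus (e.pt p)) ≠ 0} := by
      rw [continuousOn_iff_continuous_domRestrict]
      have : Set.domRestrict {p | p ∈ strip ∧ branch z (toTorus (e.pt p)) ≠ 0} w =
          fun a : A => (W (1, a)).1 := by
        funext a
        exact dif_pos a.2
      rw [this]
      exact continuous_subtype_val.comp (W.continuous.comp (by fun_prop))
    refine (hA p ⟨hp, h⟩).mono_of_mem_nhdsWithin ?_
    filter_upwards [self_mem_nhdsWithin, mem_nhdsWithin_of_mem_nhds
      ((isOpen_ne.preimage hb).mem_nhds h)] with q h1 h2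
    exact ⟨h1, h2⟩

/-- A primitive vector has an odd coordinate. -/
lemma exists_odd : ∃ k, Odd (e.v k) := by
  by_contra hcon
  push Not at hcon
  have h0 := Int.not_odd_iff_even.1 (hcon 0)
  have h1 := Int.not_odd_iff_even.1 (hcon 1)
  have := e.det
  obtain ⟨a, ha⟩ := h0
  obtain ⟨b, hb⟩ := h1
  rw [ha, hb] at this
  have : 2 * (a * e.n 1 - b * e.n 0) = 1 := by linarith
  omega

end Direction

lemma conj_eq_of_sq_pos {r w : ℂ} (h : r ^ 2 = w) (him : w.im = 0) (hre : 0 < w.re) :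
    starRingEnd ℂ r = r := by
  rw [sq] at h
  have h1 := congrArg Complex.im h
  have h2 := congrArg Complex.re h
  rw [Complex.mul_im, him] at h1
  rw [Complex.mul_re] at h2
  rw [Complex.conj_eq_iff_im]
  by_contra hne
  have : r.re = 0 := by
    have : r.re * r.im = 0 := by linarith
    exact (mul_eq_zero.1 this).resolve_right hne
  rw [this] at h2
  nlinarith [sq_nonneg r.im]

lemma conj_eq_neg_of_sq_neg {r w : ℂ} (h : r ^ 2 = w) (him : w.im = 0) (hre : w.re < 0) :
    starRingEnd ℂ r = -r := by
  have hI : (Complex.I * r) ^ 2 = -w := by rw [mul_pow, Complex.I_sq, h]; ring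
  have := conj_eq_of_sq_pos hI (by simp [him]) (by simpa using hre)
  rw [map_mul, Complex.conj_I] at this
  have h2 : Complex.I * (starRingEnd ℂ r + r) = 0 := by linear_combination -this
  rw [mul_eq_zero] at h2
  exact eq_neg_of_add_eq_zero_left (h2.resolve_left Complex.I_ne_zero)

/-- Over a point of the torus with a coordinate `1/2`, the lift of the rotation `x ↦ -x` does not
change the root. -/
lemma root_iota_of_half {m : M z} (k : Fin 2)
    (hk : proj z m k = ((1 / 2 : ℝ) : UnitAddCircle)) : root hz (iota hz m) = root hz m := by
  have h := branch_pos_of_half hz k hk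
  rw [root_iota, conj_eq_of_sq_pos (root_sq hz m) h.1 h.2]

/-- Over the centre of the slit, the lift of the rotation `x ↦ -x` changes the sign of the root. -/
lemma iota_eq_tau_of_zero {m : M z} (h : proj z m = 0) : iota hz m = tau hz m := by
  have h' := branch_zero hz
  rw [← h] at h'
  refine point_ext hz (by rw [proj_iota, proj_tau, h, neg_zero]) ?_
  rw [root_iota, root_tau, conj_eq_neg_of_sq_neg (root_sq hz m) h'.1 h'.2]

lemma iota_eq_self_of_half {m : M z} (k : Fin 2)
    (hk : proj z m k = ((1 / 2 : ℝ) : UnitAddCircle)) (h2 : -proj z m = proj z m) :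
    iota hz m = m :=
  point_ext hz (by rw [proj_iota, h2]) (root_iota_of_half hz k hk)

namespace Direction

lemma half_add_int (j : ℤ) :
    (((j : ℝ) + 1 / 2 : ℝ) : UnitAddCircle) = ((1 / 2 : ℝ) : UnitAddCircle) := by
  rw [← sub_eq_zero, ← AddCircle.coe_sub, AddCircle.coe_eq_zero_iff]
  exact ⟨j, by simp⟩

include hz in
/-- The strip develops into the surface, and the translation by `v` exchanges the sheets. The
latter comes from the rotation by a half-turn, whose lift `iota` moves the points over the origin
but fixes those over `v / 2`. -/
theorem exists_chart : ∃ Φ : ℝ × ℝ → M z, ContinuousOn Φ strip ∧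
    (∀ p ∈ strip, proj z (Φ p) = toTorus (e.pt p)) ∧
    ∀ p ∈ strip, Φ (p + (1, 0)) = tau hz (Φ p) := by
  obtain ⟨w, hwc, hw⟩ := e.exists_sqrt hz
  have hmem0 : (0 : ℝ × ℝ) ∈ strip := by simp [strip]
  let Φ : ℝ × ℝ → M z := fun p =>
    if h : w p ^ 2 = branch z (toTorus (e.pt p)) then ofRoot hz _ _ h else
      ofRoot hz _ _ (hw 0 hmem0)
  have hΦ (p) (hp : p ∈ strip) : Φ p = ofRoot hz _ _ (hw p hp) := dif_pos (hw p hp)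
  have hproj (p) (hp : p ∈ strip) : proj z (Φ p) = toTorus (e.pt p) := by
    rw [hΦ p hp, proj_ofRoot]
  have hΦc : ContinuousOn Φ strip := by
    rw [continuousOn_iff hz]
    constructor
    · exact (continuous_toTorus.comp e.continuous_pt).continuousOn.congr hproj
    · refine hwc.congr fun p hp => ?_
      rw [hΦ p hp, root_ofRoot]
  refine ⟨Φ, hΦc, hproj, ?_⟩
  let S : Set (ℝ × ℝ) := {p | |p.2| < 1 / 2}
  have hS : _root_.IsPreconnected S := convex_openStrip.isPreconnected
  have hSs : S ⊆ strip := fun p (hp : |p.2| < 1 / 2) => hp.le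
  have hsing (p) (hp : p ∈ S) : Φ p ∉ sing z := by
    rw [← root_eq_zero_iff hz, ← pow_eq_zero_iff two_ne_zero, root_sq, hproj p (hSs hp)]
    exact e.branch_ne_zero hz hp
  have hneg : Set.MapsTo (fun p : ℝ × ℝ => -p) S S := fun p hp => by simpa [S] using hp
  have hadd : Set.MapsTo (fun p : ℝ × ℝ => p + (1, 0)) strip strip := fun p hp => by
    simpa [strip] using hp
  have haddS : Set.MapsTo (fun p : ℝ × ℝ => p + (1, 0)) S S := fun p hp => by simpa [S] using hp
  have hadd' (p : ℝ × ℝ) : toTorus (e.pt (p + (1, 0))) = toTorus (e.pt p) := by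
    have := e.toTorus_pt_add_int p 1 0
    simpa using this
  -- Over the origin the two lifts `iota ∘ Φ ∘ (- ·)` and `Φ` of the chart differ by `tau`, hence
  -- they do so everywhere.
  have h1 : Set.EqOn (fun p => iota hz (Φ (-p))) (fun p => tau hz (Φ p)) S := by
    have hc : ContinuousOn (fun p => iota hz (Φ (-p))) S :=
      (iota hz).continuous.comp_continuousOn ((hΦc.mono hSs).comp continuous_neg.continuousOn hneg)
    rcases eqOn_or_eqOn_tau hz hS (hΦc.mono hSs) hc (fun p hp => by
      rw [proj_iota, hproj p (hSs hp), hproj _ (hSs (hneg hp)), map_neg, toTorus_neg, neg_neg])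
      hsing with h | h
    · exfalso
      have h0 : (0 : ℝ × ℝ) ∈ S := by simp [S]
      have h' := h h0
      simp only [neg_zero] at h'
      rw [iota_eq_tau_of_zero hz (by rw [hproj 0 hmem0, map_zero, toTorus_zero]),
        tau_eq_self_iff] at h'
      exact hsing 0 h0 h'
    · exact h
  -- If the translation by `v` did not exchange the sheets, then the point over `v / 2` would be
  -- moved by `iota`, by `h1`, but `v / 2` has a coordinate `1/2` modulo `1`.
  have h2 : Set.EqOn (fun p => Φ (p + (1, 0))) (fun p => tau hz (Φ p)) S := by
    have hc : ContinuousOn (fun p => Φ (p + (1, 0))) S :=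
      (hΦc.mono hSs).comp (by fun_prop) haddS
    rcases eqOn_or_eqOn_tau hz hS (hΦc.mono hSs) hc (fun p hp => by
      rw [hproj p (hSs hp), hproj _ (hSs (haddS hp)), hadd']) hsing with h | h
    · exfalso
      have hp : ((1 / 2, 0) : ℝ × ℝ) ∈ S := by simp [S]
      have hp' : ((-(1 / 2), 0) : ℝ × ℝ) ∈ S := by simp [S]
      have e1 := h hp'
      have e2 : ((-(1 / 2), 0) : ℝ × ℝ) + (1, 0) = (1 / 2, 0) := by ext <;> norm_num
      have e3 : -((1 / 2, 0) : ℝ × ℝ) = (-(1 / 2), 0) := by ext <;> norm_num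
      simp only [e2] at e1
      have e4 := h1 hp
      simp only [e3, ← e1] at e4
      have e5 := congrArg (root hz) e4
      obtain ⟨k, j, hj⟩ := e.exists_odd
      rw [root_iota_of_half hz k, root_tau, self_eq_neg, root_eq_zero_iff] at e5
      · exact hsing _ hp e5
      · rw [hproj _ (hSs hp)]
        simp only [toTorus, pt_apply, hj]
        rw [← half_add_int j]
        congr 1
        push_cast
        ring
    · exact h
  have := t2Space hz
  exact fun p hp => h2.of_subset_closure (hΦc.comp (by fun_prop) hadd)
    ((tau hz).continuous.comp_continuousOn hΦc) hSs strip_subset_closure hp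

/-- A chart of the surface by the strip, see `exists_chart`. -/
def chart : ℝ × ℝ → M z := (e.exists_chart hz).choose

lemma continuousOn_chart : ContinuousOn (e.chart hz) strip := (e.exists_chart hz).choose_spec.1

lemma proj_chart {p : ℝ × ℝ} (hp : p ∈ strip) : proj z (e.chart hz p) = toTorus (e.pt p) :=
  (e.exists_chart hz).choose_spec.2.1 p hp

lemma chart_add_one {p : ℝ × ℝ} (hp : p ∈ strip) :
    e.chart hz (p + (1, 0)) = tau hz (e.chart hz p) :=
  (e.exists_chart hz).choose_spec.2.2 p hp

end Direction
end Strip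

/-! ### The twist along the cylinder -/

section Twist
variable {z : Plane} (hz : Admissible z) (e : Direction z)

lemma mem_strip_add {p : ℝ × ℝ} (a : ℝ) : p + (a, 0) ∈ strip ↔ p ∈ strip := by simp [strip]

/-- The shear of the strip that fixes the lower boundary and moves the upper one by `2k`. -/
def stripShear (k : ℤ) (p : ℝ × ℝ) : ℝ × ℝ := p + (k * (2 * p.2 + 1), 0)

lemma stripShear_mem {k : ℤ} {p : ℝ × ℝ} : stripShear k p ∈ strip ↔ p ∈ strip := mem_strip_add _

lemma continuous_stripShear (k : ℤ) : Continuous (stripShear k) := by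
  unfold stripShear; fun_prop

lemma stripShear_neg (k : ℤ) (p : ℝ × ℝ) : stripShear (-k) (stripShear k p) = p := by
  ext <;> simp [stripShear]

lemma stripShear_add (k : ℤ) (p : ℝ × ℝ) (a : ℝ) :
    stripShear k (p + (a, 0)) = stripShear k p + (a, 0) := by
  ext <;> simp [stripShear]; ring

/-- The deck transformation or the identity. -/
def tauPow (ε : Bool) : M z ≃ₜ M z := if ε then tau hz else Homeomorph.refl _

lemma tauPow_true (m : M z) : tauPow hz true m = tau hz m := rfl

lemma tauPow_false (m : M z) : tauPow hz false m = m := rfl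

lemma proj_tauPow (ε : Bool) (m : M z) : proj z (tauPow hz ε m) = proj z m := by
  cases ε
  · rfl
  · exact proj_tau hz m

lemma tau_tauPow (ε : Bool) (m : M z) : tau hz (tauPow hz ε m) = tauPow hz (!ε) m := by
  cases ε
  · rfl
  · exact tau_tau hz m

lemma tauPow_eq_iff {m : M z} (hm : m ∉ sing z) (ε ε' : Bool) :
    tauPow hz ε m = tauPow hz ε' m ↔ ε = ε' := by
  have h1 : tau hz m ≠ m := (tau_eq_self_iff hz m).not.2 hm
  cases ε <;> cases ε' <;> simp [tauPow_true, tauPow_false, h1, h1.symm]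

namespace Direction

lemma exists_chart_add_int (a : ℤ) : ∃ ε, ∀ p ∈ strip,
    e.chart hz (p + ((a : ℝ), 0)) = tauPow hz ε (e.chart hz p) := by
  induction a with
  | zero => exact ⟨false, fun p _ => by simp [tauPow_false, ← Prod.zero_eq_mk]⟩
  | succ a ih =>
    obtain ⟨ε, h⟩ := ih
    refine ⟨!ε, fun p hp => ?_⟩
    have : p + (((a + 1 : ℤ) : ℝ), 0) = p + (((a : ℤ) : ℝ), 0) + (1, 0) := by
      ext <;> simp; ring
    rw [this, chart_add_one hz e ((mem_strip_add _).2 hp), h p hp, tau_tauPow]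
  | pred a ih =>
    obtain ⟨ε, h⟩ := ih
    refine ⟨!ε, fun p hp => ?_⟩
    have : p + (((-a : ℤ) : ℝ), 0) = p + (((-a - 1 : ℤ) : ℝ), 0) + (1, 0) := by
      ext <;> simp; ring
    have h2 := h p hp
    rw [this, chart_add_one hz e ((mem_strip_add _).2 hp)] at h2
    rw [← tau_tauPow, ← h2, tau_tau]

lemma chart_add_even (a : ℤ) {p : ℝ × ℝ} (hp : p ∈ strip) :
    e.chart hz (p + (2 * (a : ℝ), 0)) = e.chart hz p := by
  obtain ⟨ε, h⟩ := e.exists_chart_add_int hz a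
  have : p + (2 * (a : ℝ), 0) = p + ((a : ℝ), 0) + ((a : ℝ), 0) := by
    ext <;> simp; ring
  rw [this, h _ ((mem_strip_add _).2 hp), h p hp]
  cases ε
  · rfl
  · exact tau_tau hz _

/-- The chart by the strip, followed by the deck transformation if `ε` is true. -/
def sheetChart (ε : Bool) (p : ℝ × ℝ) : M z := tauPow hz ε (e.chart hz p)

lemma continuousOn_sheetChart (ε : Bool) : ContinuousOn (e.sheetChart hz ε) strip :=
  (tauPow hz ε).continuous.comp_continuousOn (e.continuousOn_chart hz)

lemma proj_sheetChart (ε : Bool) {p : ℝ × ℝ} (hp : p ∈ strip) :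
    proj z (e.sheetChart hz ε p) = toTorus (e.pt p) := by
  rw [sheetChart, proj_tauPow, proj_chart hz e hp]

lemma tau_sheetChart (ε : Bool) (p : ℝ × ℝ) :
    tau hz (e.sheetChart hz ε p) = e.sheetChart hz (!ε) p := tau_tauPow hz _ _

lemma sheetChart_add_one (ε : Bool) {p : ℝ × ℝ} (hp : p ∈ strip) :
    e.sheetChart hz ε (p + (1, 0)) = e.sheetChart hz (!ε) p := by
  rw [sheetChart, chart_add_one hz e hp, ← tau_sheetChart]
  cases ε <;> rfl

lemma sheetChart_add_even (ε : Bool) (a : ℤ) {p : ℝ × ℝ} (hp : p ∈ strip) :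
    e.sheetChart hz ε (p + (2 * (a : ℝ), 0)) = e.sheetChart hz ε p := by
  rw [sheetChart, chart_add_even hz e a hp, sheetChart]

lemma exists_sheetChart_of_proj {m : M z} {p : ℝ × ℝ} (hp : p ∈ strip)
    (h : proj z m = toTorus (e.pt p)) : ∃ ε, m = e.sheetChart hz ε p := by
  rcases eq_or_eq_tau hz (m := e.chart hz p) (m' := m) (by rw [h, proj_chart hz e hp]) with h | h
  · exact ⟨false, h⟩
  · exact ⟨true, h⟩

lemma exists_coord (m : M z) : ∃ p : ℝ × ℝ, proj z m = toTorus (e.pt p) := by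
  obtain ⟨q, -, hq⟩ := exists_toTorus_eq (proj z m)
  exact ⟨e.coord q, by rw [pt_coord, hq]⟩

lemma sub_round_mem_strip (p : ℝ × ℝ) : p - (0, (round p.2 : ℝ)) ∈ strip := by
  simpa [strip] using abs_sub_round p.2

lemma exists_sheetChart (m : M z) : ∃ ε p, p ∈ strip ∧ p.1 ∈ Set.Icc (0 : ℝ) 1 ∧
    m = e.sheetChart hz ε p := by
  obtain ⟨p, hp⟩ := e.exists_coord m
  have hmem : p + (((-⌊p.1⌋ : ℤ) : ℝ), ((-round p.2 : ℤ) : ℝ)) ∈ strip := by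
    simpa [strip, ← sub_eq_add_neg] using abs_sub_round p.2
  rw [← e.toTorus_pt_add_int p (-⌊p.1⌋) (-round p.2)] at hp
  obtain ⟨ε, h⟩ := e.exists_sheetChart_of_proj hz hmem hp
  refine ⟨ε, _, hmem, ?_, h⟩
  have h1 := Int.floor_le p.1
  have h2 := Int.lt_floor_add_one p.1
  constructor <;> simp <;> linarith

include hz in
lemma sheetChart_notMem_sing (ε : Bool) {p : ℝ × ℝ} (hp : |p.2| < 1 / 2) :
    e.sheetChart hz ε p ∉ sing z := by
  rw [← root_eq_zero_iff hz, ← pow_eq_zero_iff two_ne_zero, root_sq,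
    proj_sheetChart hz e ε (p := p) hp.le]
  exact e.branch_ne_zero hz hp

lemma sheetChart_stripShear_of_boundary (k : ℤ) (ε : Bool) {p : ℝ × ℝ} (hp : |p.2| = 1 / 2) :
    e.sheetChart hz ε (stripShear k p) = e.sheetChart hz ε p := by
  rcases (abs_eq (by norm_num)).1 hp with h | h
  · have : stripShear k p = p + (2 * (k : ℝ), 0) := by
      ext <;> simp [stripShear, h]; ring
    rw [this, sheetChart_add_even hz e ε k (p := p) hp.le]
  · have : stripShear k p = p := by
      ext <;> simp [stripShear, h]
    rw [this]

/-- The shear of the two strips is compatible with their identifications on the surface: in the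
interior these are horizontal translations, and on the boundary the sheared strips are not moved on
the surface. -/
lemma sheetChart_stripShear_congr (k : ℤ) {ε ε' : Bool} {p p' : ℝ × ℝ} (hp : p ∈ strip)
    (hp' : p' ∈ strip) (h : e.sheetChart hz ε p = e.sheetChart hz ε' p') :
    e.sheetChart hz ε (stripShear k p) = e.sheetChart hz ε' (stripShear k p') := by
  have hproj := congrArg (proj z) h
  rw [proj_sheetChart hz e ε hp, proj_sheetChart hz e ε' hp'] at hproj
  obtain ⟨a, b, hab⟩ := e.exists_int_of_toTorus_eq hproj
  have hb : p.2 = p'.2 + b := by rw [hab]; rfl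
  have hp1 := abs_le.1 (show |p.2| ≤ 1 / 2 from hp)
  have hp2 := abs_le.1 (show |p'.2| ≤ 1 / 2 from hp')
  by_cases hint : |p.2| = 1 / 2 ∧ |p'.2| = 1 / 2
  · rw [sheetChart_stripShear_of_boundary hz e k ε hint.1,
      sheetChart_stripShear_of_boundary hz e k ε' hint.2, h]
  · have hb0 : b = 0 := by
      by_contra hne
      rcases lt_or_gt_of_ne hne with hlt | hgt
      · have : (b : ℝ) ≤ -1 := by exact_mod_cast (by omega : b ≤ -1)
        refine hint ⟨?_, ?_⟩
        · rw [show p.2 = -(1 / 2) by linarith]; norm_num [abs_of_pos]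
        · rw [show p'.2 = 1 / 2 by linarith]; norm_num [abs_of_pos]
      · have : (1 : ℝ) ≤ b := by exact_mod_cast (by omega : 1 ≤ b)
        refine hint ⟨?_, ?_⟩
        · rw [show p.2 = 1 / 2 by linarith]; norm_num [abs_of_pos]
        · rw [show p'.2 = -(1 / 2) by linarith]; norm_num [abs_of_pos]
    subst hb0
    simp only [Int.cast_zero, add_zero] at hab hb
    have hlt : |p'.2| < 1 / 2 := by
      refine lt_of_le_of_ne hp' fun h' => hint ⟨by rw [hb, h'], h'⟩
    obtain ⟨ε₀, hε₀⟩ := e.exists_chart_add_int hz a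
    have key (q : ℝ × ℝ) (hq : q ∈ strip) : e.sheetChart hz ε (q + ((a : ℝ), 0)) =
        tauPow hz (xor ε ε₀) (e.chart hz q) := by
      rw [sheetChart, hε₀ q hq]
      cases ε <;> cases ε₀ <;> first | rfl | exact tau_tau hz _
    have hns : e.chart hz p' ∉ sing z := e.sheetChart_notMem_sing hz false hlt
    rw [hab, key p' hp', sheetChart, tauPow_eq_iff hz hns] at h
    rw [hab, stripShear_add, key _ (stripShear_mem.2 hp'), h]
    rfl

/-- The map underlying `twist`. -/
def twistFun (k : ℤ) (m : M z) : M z :=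
  e.sheetChart hz (e.exists_sheetChart hz m).choose
    (stripShear k (e.exists_sheetChart hz m).choose_spec.choose)

lemma twistFun_sheetChart (k : ℤ) (ε : Bool) {p : ℝ × ℝ} (hp : p ∈ strip) :
    e.twistFun hz k (e.sheetChart hz ε p) = e.sheetChart hz ε (stripShear k p) := by
  have h := (e.exists_sheetChart hz (e.sheetChart hz ε p)).choose_spec.choose_spec
  exact e.sheetChart_stripShear_congr hz k h.1 hp h.2.2.symm

lemma continuous_twistFun (k : ℤ) : Continuous (e.twistFun hz k) := by
  have := t2Space hz
  -- The surface is a quotient of two compact rectangles in the strips.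
  let Q : Set (ℝ × ℝ) := Set.Icc 0 1 ×ˢ Set.Icc (-(1 / 2)) (1 / 2)
  have hQ : Q ⊆ strip := fun p hp => abs_le.2 hp.2
  have : CompactSpace Q := isCompact_iff_compactSpace.1 (isCompact_Icc.prod isCompact_Icc)
  let g : Q × Bool → M z := fun x => e.sheetChart hz x.2 x.1.1
  have hg : Continuous g := continuous_prod_of_discrete_right.2 fun ε =>
    (e.continuousOn_sheetChart hz ε).comp_continuous continuous_subtype_val fun p => hQ p.2
  have hsurj : Function.Surjective g := by
    intro m
    obtain ⟨ε, p, hp, hp1, rfl⟩ := e.exists_sheetChart hz m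
    exact ⟨(⟨p, hp1, abs_le.1 hp⟩, ε), rfl⟩
  have hquot : IsQuotientMap g := hg.isClosedMap.isQuotientMap hg hsurj
  rw [hquot.continuous_iff]
  have hcomp : e.twistFun hz k ∘ g =
      fun x : Q × Bool => e.sheetChart hz x.2 (stripShear k x.1.1) := by
    funext x
    exact e.twistFun_sheetChart hz k x.2 (hQ x.1.2)
  rw [hcomp]
  exact continuous_prod_of_discrete_right.2 fun ε =>
    (e.continuousOn_sheetChart hz ε).comp_continuous
      ((continuous_stripShear k).comp continuous_subtype_val) fun p => stripShear_mem.2 (hQ p.2)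

lemma twistFun_neg (k : ℤ) (m : M z) : e.twistFun hz (-k) (e.twistFun hz k m) = m := by
  obtain ⟨ε, p, hp, -, rfl⟩ := e.exists_sheetChart hz m
  rw [twistFun_sheetChart hz e k ε hp, twistFun_sheetChart hz e (-k) ε (stripShear_mem.2 hp),
    stripShear_neg]

/-- The `k`-th power of the Dehn twist along the cylinder in direction `v`, which is the complement
of the closed geodesics through the singularities. It is an affine homeomorphism. -/
def twist (k : ℤ) : M z ≃ₜ M z where
  toFun := e.twistFun hz k
  invFun := e.twistFun hz (-k)
  left_inv := e.twistFun_neg hz k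
  right_inv m := by simpa using e.twistFun_neg hz (-k) m
  continuous_toFun := e.continuous_twistFun hz k
  continuous_invFun := e.continuous_twistFun hz (-k)

lemma twist_sheetChart (k : ℤ) (ε : Bool) {p : ℝ × ℝ} (hp : p ∈ strip) :
    e.twist hz k (e.sheetChart hz ε p) = e.sheetChart hz ε (stripShear k p) :=
  e.twistFun_sheetChart hz k ε hp

lemma twist_of_mem_sing (k : ℤ) {m : M z} (hm : m ∈ sing z) : e.twist hz k m = m := by
  obtain ⟨ε, p, hp, -, rfl⟩ := e.exists_sheetChart hz m
  have hb : |p.2| = 1 / 2 := by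
    by_contra hne
    exact e.sheetChart_notMem_sing hz ε (lt_of_le_of_ne hp hne) hm
  rw [twist_sheetChart hz e k ε hp, sheetChart_stripShear_of_boundary hz e k ε hb]

lemma proj_twist (k : ℤ) {m : M z} {p : ℝ × ℝ} (h : proj z m = toTorus (e.pt p)) :
    proj z (e.twist hz k m) = toTorus (e.pt (p.1 + 2 * k * p.2, p.2)) := by
  obtain ⟨ε, q, hq, -, rfl⟩ := e.exists_sheetChart hz m
  rw [proj_sheetChart hz e ε hq] at h
  obtain ⟨a, b, rfl⟩ := e.exists_int_of_toTorus_eq h.symm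
  rw [twist_sheetChart hz e k ε hq, proj_sheetChart hz e ε (stripShear_mem.2 hq),
    ← e.toTorus_pt_add_int (stripShear k q) (a + 2 * k * b - k) b]
  congr 2
  ext
  · simp [stripShear]; ring
  · simp [stripShear]

end Direction
end Twist

/-! ### Integration of homomorphisms on path classes -/

section Potential

lemma segClass_congr {X : Type} [TopologicalSpace X] {E E' : Type*} [AddCommGroup E] [Module ℝ E]
    [AddCommGroup E'] [Module ℝ E'] {f : E → X} {g : E' → X}
    {p q : E} {p' q' : E'}
    (h : ∀ s ∈ Set.Icc (0 : ℝ) 1, f (AffineMap.lineMap p q s) = g (AffineMap.lineMap p' q' s)) :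
    segClass f p q = segClass g p' q' := by
  unfold segClass
  congr 1
  funext t
  exact h t t.2

lemma segClass_const {X : Type} [TopologicalSpace X] {E : Type*} [AddCommGroup E] [Module ℝ E]
    [TopologicalSpace E] [IsTopologicalAddGroup E] [ContinuousSMul ℝ E] {f : E → X} {p q : E}
    {m : X}
    (h : ∀ s ∈ Set.Icc (0 : ℝ) 1, f (AffineMap.lineMap p q s) = m) : segClass f p q = 0 := by
  rw [segClass_congr (g := fun _ : E => m) (p' := p) (q' := p) h, segClass_self]

variable {z : Plane} (hz : Admissible z) (e : Direction z)

/-- Two lifts of a curve in the torus which either avoids the singularities before its end point or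
consists of singularities agree up to the deck transformation. -/
lemma eqOn_or_eqOn_tau_Icc {f g : ℝ → M z} (hf : ContinuousOn f (Set.Icc 0 1))
    (hg : ContinuousOn g (Set.Icc 0 1)) (h : ∀ s ∈ Set.Icc (0 : ℝ) 1, proj z (f s) = proj z (g s))
    (hs : (∀ s ∈ Set.Ico (0 : ℝ) 1, f s ∉ sing z) ∨ ∀ s ∈ Set.Icc (0 : ℝ) 1, f s ∈ sing z) :
    Set.EqOn g f (Set.Icc 0 1) ∨ Set.EqOn g (fun s => tau hz (f s)) (Set.Icc 0 1) := by
  have := t2Space hz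
  have hcl : Set.Icc (0 : ℝ) 1 ⊆ closure (Set.Ico 0 1) := by rw [closure_Ico zero_ne_one]
  rcases hs with hs | hs
  · rcases eqOn_or_eqOn_tau hz isPreconnected_Ico (hf.mono Set.Ico_subset_Icc_self)
      (hg.mono Set.Ico_subset_Icc_self) (fun s hs => h s ⟨hs.1, hs.2.le⟩) hs with h1 | h1
    · exact Or.inl (h1.of_subset_closure hg hf Set.Ico_subset_Icc_self hcl)
    · exact Or.inr (h1.of_subset_closure hg ((tau hz).continuous.comp_continuousOn hf)
        Set.Ico_subset_Icc_self hcl)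
  · refine Or.inl fun s hs' => point_ext hz (h s hs').symm ?_
    have h1 := (root_eq_zero_iff hz _).2 (hs s hs')
    have h2 : root hz (g s) ^ 2 = root hz (f s) ^ 2 := by rw [root_sq, root_sq, h s hs']
    rw [h1] at h2 ⊢
    exact pow_eq_zero_iff two_ne_zero |>.1 (by rw [h2]; ring)

namespace Direction

include hz in
/-- Near every point `q` the square root of the branching function can be continued along the
straight segments towards `q`. -/
lemma exists_scaling (q : ℝ × ℝ) : ∃ δ > 0, ∃ S : (ℝ × ℝ) × ℝ → ℂ,
    ContinuousOn S (Metric.ball q δ ×ˢ Set.Icc 0 1) ∧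
    (∀ p ∈ Metric.ball q δ, ∀ s ∈ Set.Icc (0 : ℝ) 1, S (p, s) ^ 2 * branch z (toTorus (e.pt p)) =
      branch z (toTorus (e.pt (AffineMap.lineMap p q s)))) ∧
    (∀ p ∈ Metric.ball q δ, S (p, 0) = 1) ∧
    (∀ p ∈ Metric.ball q δ, ∀ s ∈ Set.Ico (0 : ℝ) 1, S (p, s) ≠ 0) ∧
    (branch z (toTorus (e.pt q)) ≠ 0 → ∀ s, S (q, s) = 1) := by
  have hF : Continuous fun p => branch z (toTorus (e.pt p)) :=
    (continuous_branch hz).comp (continuous_toTorus.comp e.continuous_pt)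
  set F : ℝ × ℝ → ℂ := fun p => branch z (toTorus (e.pt p)) with hFdef
  have hline (p : ℝ × ℝ) (s : ℝ) : AffineMap.lineMap p q s = q + (1 - s) • (p - q) := by
    rw [AffineMap.lineMap_apply_module]; module
  -- At a zero `q` the function is linear, so it is multiplied by `1 - s` at the point `s` of the
  -- segment; otherwise it is almost constant near `q` and the principal square root can be used.
  by_cases hq : F q = 0
  · obtain ⟨δ, hδ, h⟩ := branch_add_smul_of_eq_zero hz hq
    obtain ⟨δ', hδ', h'⟩ := Metric.continuous_iff.1 e.continuous_pt q δ hδ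
    refine ⟨δ', hδ', fun x => (Real.sqrt (1 - x.2) : ℝ), by fun_prop, ?_, by simp, ?_,
      fun h => absurd hq h⟩
    · intro p hp s hs
      have h1 := h (e.pt (p - q)) (fun k => by
        have := h' p hp
        rw [dist_eq_norm, ← map_sub] at this
        exact (norm_le_pi_norm _ k).trans_lt this) (1 - s) ⟨by linarith [hs.2], by linarith [hs.1]⟩
      rw [← map_smul, ← map_add, ← hline, ← map_add, add_sub_cancel] at h1
      rw [h1, ← Complex.ofReal_pow, Real.sq_sqrt (by linarith [hs.2])]
    · intro p hp s hs
      have := Real.sqrt_pos.2 (sub_pos.2 hs.2)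
      exact Complex.ofReal_ne_zero.2 this.ne'
  · have hq0 : 0 < ‖F q‖ := norm_pos_iff.2 hq
    obtain ⟨δ, hδ, h⟩ := Metric.continuous_iff.1 hF q (‖F q‖ / 3) (by positivity)
    simp only [dist_eq_norm (F _)] at h
    have hmem {p : ℝ × ℝ} (hp : p ∈ Metric.ball q δ) {s : ℝ} (hs : s ∈ Set.Icc (0 : ℝ) 1) :
        AffineMap.lineMap p q s ∈ Metric.ball q δ :=
      (convex_ball q δ).lineMap_mem hp (Metric.mem_ball_self hδ) hs
    have hp0 {p : ℝ × ℝ} (hp : p ∈ Metric.ball q δ) : 2 / 3 * ‖F q‖ < ‖F p‖ := by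
      have h1 := h p hp
      have h2 := norm_sub_norm_le (F q) (F p)
      rw [norm_sub_rev] at h2
      linarith
    have hne {p : ℝ × ℝ} (hp : p ∈ Metric.ball q δ) : F p ≠ 0 := by
      have := hp0 hp
      exact norm_pos_iff.1 (by linarith)
    have hslit {p : ℝ × ℝ} (hp : p ∈ Metric.ball q δ) {s : ℝ} (hs : s ∈ Set.Icc (0 : ℝ) 1) :
        F (AffineMap.lineMap p q s) / F p ∈ Complex.slitPlane := by
      have e1 : F (AffineMap.lineMap p q s) / F p =
          1 + (F (AffineMap.lineMap p q s) - F p) / F p := by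
        field_simp [hne hp]
        ring
      rw [e1]
      refine Complex.mem_slitPlane_of_norm_lt_one ?_
      rw [norm_div, div_lt_one (norm_pos_iff.2 (hne hp))]
      have h1 := h _ (hmem hp hs)
      have h2 := h p hp
      have h3 := norm_sub_le_norm_sub_add_norm_sub (F (AffineMap.lineMap p q s)) (F q) (F p)
      rw [norm_sub_rev (F q)] at h3
      linarith [hp0 hp]
    refine ⟨δ, hδ, fun x => (F (AffineMap.lineMap x.1 q x.2) / F x.1) ^ ((2 : ℕ)⁻¹ : ℂ),
      ?_, ?_, ?_, ?_, ?_⟩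
    · refine ContinuousOn.cpow_const (ContinuousOn.div ?_ ?_ ?_) ?_
      · simp only [AffineMap.lineMap_apply_module]
        exact (hF.comp (by fun_prop)).continuousOn
      · exact (hF.comp continuous_fst).continuousOn
      · exact fun x hx => hne hx.1
      · exact fun x hx => hslit hx.1 hx.2
    · intro p hp s hs
      simp only
      rw [Complex.cpow_nat_inv_pow _ two_ne_zero]
      exact div_mul_cancel₀ _ (hne hp)
    · intro p hp
      simp [div_self (hne hp)]
    · intro p hp s hs
      have := Complex.slitPlane_ne_zero (hslit hp ⟨hs.1, hs.2.le⟩)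
      simp only [ne_eq, Complex.cpow_eq_zero_iff, this, false_and, not_false_eq_true]
    · intro _ s
      simp [div_self hq]

include hz in
/-- A curve over a short segment towards a fixed point avoids the singularities before its end
point or consists of singularities. -/
lemma eventually_segment_sing (q : ℝ × ℝ) : ∀ᶠ p in 𝓝 q, ∀ T : ℝ → M z,
    (∀ s ∈ Set.Icc (0 : ℝ) 1, proj z (T s) = toTorus (e.pt (AffineMap.lineMap p q s))) →
    (∀ s ∈ Set.Ico (0 : ℝ) 1, T s ∉ sing z) ∨ ∀ s ∈ Set.Icc (0 : ℝ) 1, T s ∈ sing z := by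
  obtain ⟨δ, hδ, S, -, hS, -, hS0, -⟩ := e.exists_scaling hz q
  filter_upwards [Metric.ball_mem_nhds q hδ] with p hp T hT
  have key (s) (hs : s ∈ Set.Icc (0 : ℝ) 1) : T s ∈ sing z ↔
      S (p, s) ^ 2 * branch z (toTorus (e.pt p)) = 0 := by
    rw [← root_eq_zero_iff hz, ← pow_eq_zero_iff two_ne_zero, root_sq, hT s hs, hS p hp s hs]
  by_cases h : branch z (toTorus (e.pt p)) = 0
  · exact Or.inr fun s hs => by simp [key s hs, h]
  · refine Or.inl fun s hs => ?_
    rw [key s ⟨hs.1, hs.2.le⟩]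
    exact mul_ne_zero (pow_ne_zero 2 (hS0 p hp s hs)) h

include hz in
/-- A short piece of a path is homologous, relative to its end points, to a lift of a straight
segment, even if the path meets a singularity in a complicated way. -/
lemma eventually_segClass_eq {γ : ℝ → M z} (hγ : Continuous γ) {p : ℝ → ℝ × ℝ} (hp : Continuous p)
    (h : ∀ t, proj z (γ t) = toTorus (e.pt (p t))) (t₀ : ℝ) : ∀ᶠ t in 𝓝 t₀, ∃ T : ℝ → M z,
    ContinuousOn T (Set.Icc 0 1) ∧ T 0 = γ t ∧ T 1 = γ t₀ ∧
    (∀ s ∈ Set.Icc (0 : ℝ) 1,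
      proj z (T s) = toTorus (e.pt (AffineMap.lineMap (p t) (p t₀) s))) ∧
    segClass γ t₀ t = -segClass T (0 : ℝ) 1 := by
  obtain ⟨δ, hδ, S, hSc, hS, hS1, -, hSq⟩ := e.exists_scaling hz (p t₀)
  obtain ⟨η, hη, hball⟩ := Metric.continuous_iff.1 hp t₀ δ hδ
  -- `H (t, s)` is the point `s` of a lift of the segment from `p t` to `p t₀` that starts at `γ t`.
  -- The sides `s = 1` and `t = t₀` of the rectangle are mapped to the point `γ t₀`.
  set W : Set (ℝ × ℝ) := Metric.ball t₀ η ×ˢ Set.Icc 0 1 with hW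
  have hWc : Convex ℝ W := (convex_ball _ _).prod (convex_Icc _ _)
  have hex (x : ℝ × ℝ) : ∃ m : M z, x ∈ W →
      proj z m = toTorus (e.pt (AffineMap.lineMap (p x.1) (p t₀) x.2)) ∧
      root hz m = S (p x.1, x.2) * root hz (γ x.1) := by
    by_cases hx : x ∈ W
    · obtain ⟨m, hm⟩ := exists_point hz (w := S (p x.1, x.2) * root hz (γ x.1))
        (x := toTorus (e.pt (AffineMap.lineMap (p x.1) (p t₀) x.2))) (by
          rw [mul_pow, root_sq, h, hS _ (hball _ hx.1) _ hx.2])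
      exact ⟨m, fun _ => hm⟩
    · exact ⟨γ 0, fun h => absurd h hx⟩
  choose H hH using hex
  have hHc : ContinuousOn H W := by
    rw [continuousOn_iff hz]
    constructor
    · have : Continuous fun x : ℝ × ℝ => toTorus (e.pt (AffineMap.lineMap (p x.1) (p t₀) x.2)) := by
        refine continuous_toTorus.comp (e.continuous_pt.comp ?_)
        simp only [AffineMap.lineMap_apply_module]
        fun_prop
      exact this.continuousOn.congr fun x hx => (hH x hx).1
    · have h1 : ContinuousOn (fun x : ℝ × ℝ => S (p x.1, x.2)) W :=
        hSc.comp (by fun_prop) fun x hx => ⟨hball _ hx.1, hx.2⟩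
      have h2 : Continuous fun x : ℝ × ℝ => root hz (γ x.1) := by fun_prop
      exact (h1.mul h2.continuousOn).congr fun x hx => (hH x hx).2
  have ht₀ : t₀ ∈ Metric.ball t₀ η := Metric.mem_ball_self hη
  have h00 : (0 : ℝ) ∈ Set.Icc (0 : ℝ) 1 := by simp
  have h01 : (1 : ℝ) ∈ Set.Icc (0 : ℝ) 1 := by simp
  have hbot {t : ℝ} (ht : t ∈ Metric.ball t₀ η) : H (t, 0) = γ t := by
    obtain ⟨e1, e2⟩ := hH (t, 0) ⟨ht, h00⟩
    refine point_ext hz ?_ ?_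
    · rw [e1, h]; simp
    · rw [e2, hS1 _ (hball _ ht), one_mul]
  have hside {s : ℝ} (hs : s ∈ Set.Icc (0 : ℝ) 1) : H (t₀, s) = γ t₀ := by
    obtain ⟨e1, e2⟩ := hH (t₀, s) ⟨ht₀, hs⟩
    refine point_ext hz ?_ ?_
    · rw [e1, h]; simp
    · rw [e2]
      by_cases hq : branch z (toTorus (e.pt (p t₀))) = 0
      · rw [← h, ← root_sq hz, pow_eq_zero_iff two_ne_zero] at hq
        simp only [hq, mul_zero]
      · simp only [hSq hq, one_mul]
  have hprojtop {t : ℝ} (ht : t ∈ Metric.ball t₀ η) : proj z (H (t, 1)) = proj z (γ t₀) := by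
    rw [(hH (t, 1) ⟨ht, h01⟩).1, h]; simp
  have htop {t : ℝ} (ht : t ∈ Metric.ball t₀ η) : H (t, 1) = γ t₀ := by
    by_cases hs : γ t₀ ∈ sing z
    · refine point_ext hz (hprojtop ht) ?_
      have h0 := (root_eq_zero_iff hz _).2 hs
      rw [h0, ← pow_eq_zero_iff two_ne_zero, root_sq, hprojtop ht, ← root_sq hz, h0]
      simp
    · have hc : ContinuousOn (fun t => H (t, 1)) (Metric.ball t₀ η) :=
        hHc.comp (by fun_prop) fun t ht => ⟨ht, h01⟩
      rcases eqOn_or_eqOn_tau hz (convex_ball t₀ η).isPreconnected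
        (continuousOn_const (c := γ t₀)) hc (fun y hy => (hprojtop hy).symm) (fun _ _ => hs)
        with h1 | h1
      · exact h1 ht
      · have h2 := h1 ht₀
        simp only [hside h01] at h2
        exact absurd ((tau_eq_self_iff hz _).1 h2.symm) hs
  filter_upwards [Metric.ball_mem_nhds t₀ hη] with t ht
  refine ⟨fun s => H (t, s), hHc.comp (by fun_prop) fun s hs => ⟨ht, hs⟩, hbot ht, htop ht,
    fun s hs => (hH (t, s) ⟨ht, hs⟩).1, ?_⟩
  have m1 : ((t₀, 0) : ℝ × ℝ) ∈ W := ⟨ht₀, h00⟩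
  have m2 : ((t, 0) : ℝ × ℝ) ∈ W := ⟨ht, h00⟩
  have m3 : ((t, 1) : ℝ × ℝ) ∈ W := ⟨ht, h01⟩
  have m4 : ((t₀, 1) : ℝ × ℝ) ∈ W := ⟨ht₀, h01⟩
  have hprod (a b c d s : ℝ) : (AffineMap.lineMap ((a, b) : ℝ × ℝ) (c, d) s : ℝ × ℝ) =
      (AffineMap.lineMap a c s, AffineMap.lineMap b d s) := by
    simp [AffineMap.lineMap_apply_module]
  have hin {t : ℝ} (ht : t ∈ Metric.ball t₀ η) {s : ℝ} (hs : s ∈ Set.Icc (0 : ℝ) 1) :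
      AffineMap.lineMap t₀ t s ∈ Metric.ball t₀ η := (convex_ball _ _).lineMap_mem ht₀ ht hs
  have c1 := segClass_add hWc hHc m1 m2 m3
  have c2 := segClass_add hWc hHc m1 m4 m3
  have d1 : segClass H (t₀, (0 : ℝ)) (t, 0) = segClass γ t₀ t := segClass_congr fun s hs => by
    rw [hprod, AffineMap.lineMap_same_apply]
    exact hbot (hin ht hs)
  have d2 : segClass H (t, (0 : ℝ)) (t, 1) = segClass (fun s => H (t, s)) (0 : ℝ) 1 :=
    segClass_congr fun s hs => by rw [hprod, AffineMap.lineMap_same_apply]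
  have d3 : segClass H (t₀, (0 : ℝ)) (t₀, 1) = 0 := segClass_const fun s hs => by
    rw [hprod, AffineMap.lineMap_same_apply]
    have e1 : AffineMap.lineMap (0 : ℝ) 1 s = s := by simp [AffineMap.lineMap_apply]
    rw [e1]
    exact hside hs
  have d4 : segClass H (t₀, (1 : ℝ)) (t, 1) = 0 := segClass_const fun s hs => by
    rw [hprod, AffineMap.lineMap_same_apply]
    exact htop (hin ht hs)
  rw [← c2, d1, d2, d3, d4, add_zero] at c1
  exact eq_neg_of_add_eq_zero_left c1

/-- Near a point, every point lies in a common translate of the strip with it. -/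
lemma eventually_exists_strip (q : ℝ × ℝ) : ∀ᶠ p in 𝓝 q, ∃ j : ℤ,
    p - (0, (j : ℝ)) ∈ strip ∧ q - (0, (j : ℝ)) ∈ strip := by
  have hup : ∀ᶠ p : ℝ × ℝ in 𝓝 q, p.2 < ⌊q.2 + 1 / 2⌋ + 1 / 2 := by
    refine continuous_snd.continuousAt.eventually_lt continuousAt_const ?_
    linarith [Int.lt_floor_add_one (q.2 + 1 / 2)]
  have hlo : ∀ᶠ p : ℝ × ℝ in 𝓝 q, (⌈q.2 - 1 / 2⌉ : ℝ) - 1 / 2 < p.2 := by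
    refine continuousAt_const.eventually_lt continuous_snd.continuousAt ?_
    linarith [Int.ceil_lt_add_one (q.2 - 1 / 2)]
  filter_upwards [hup, hlo] with p h1 h2
  have mk {x : ℝ × ℝ} {j : ℤ} (h1 : (j : ℝ) - 1 / 2 ≤ x.2) (h2 : x.2 ≤ j + 1 / 2) :
      x - (0, (j : ℝ)) ∈ strip :=
    abs_le.2 ⟨by change -(1 / 2) ≤ x.2 - (j : ℝ); linarith, by
      change x.2 - (j : ℝ) ≤ 1 / 2; linarith⟩
  have f1 := Int.floor_le (q.2 + 1 / 2)
  have f2 := Int.lt_floor_add_one (q.2 + 1 / 2)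
  have f3 := Int.le_ceil (q.2 - 1 / 2)
  have f4 := Int.ceil_lt_add_one (q.2 - 1 / 2)
  rcases le_total q.2 p.2 with hpq | hpq
  · exact ⟨⌊q.2 + 1 / 2⌋, mk (by linarith) (by linarith), mk (by linarith) (by linarith)⟩
  · exact ⟨⌈q.2 - 1 / 2⌉, mk (by linarith) (by linarith), mk (by linarith) (by linarith)⟩

end Direction
end Potential

/-! ### Homomorphisms that vanish on the classes with zero holonomy -/

section Primitive
variable {z : Plane} (hz : Admissible z) (e : Direction z) {A : Type} [AddCommGroup A] [Module ℤ A]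

/-- A primitive of a homomorphism `D` on path classes with respect to the charts `sheetChart` by
the strip: a function `K` on the two strips whose differences are the values of `D` on straight
segments, and which is a function on the surface up to the periods `c'` along the strip and `c`
across the strip. -/
structure IsPrimitive (D : ChainClass (M z) →ₗ[ℤ] A) (K : Bool → ℝ × ℝ → A) (c' c : A) : Prop where
  well_defined : ∀ ε ε' p, p ∈ strip → e.sheetChart hz ε p = e.sheetChart hz ε' p → K ε p = K ε' p
  map_seg : ∀ ε p q, p ∈ strip → q ∈ strip → D (segClass (e.sheetChart hz ε) p q) = K ε q - K ε p
  add_one : ∀ ε p, p ∈ strip → K (!ε) (p + (1, 0)) = K ε p + c'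
  top : ∀ ε ε' p, p.2 = 1 / 2 → e.sheetChart hz ε p = e.sheetChart hz ε' (p - (0, 1)) →
    K ε p = K ε' (p - (0, 1)) + c

namespace IsPrimitive
variable {hz e} {D : ChainClass (M z) →ₗ[ℤ] A} {K : Bool → ℝ × ℝ → A} {c' c : A}

open Classical in
/-- The value of the primitive `K` at a point `m` of the surface with coordinates `p` in the
strip. -/
def value (hz : Admissible z) (e : Direction z) (K : Bool → ℝ × ℝ → A) (m : M z) (p : ℝ × ℝ) : A :=
  if h : ∃ ε, m = e.sheetChart hz ε p then K h.choose p else 0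

/-- The extension of `value` to all coordinates `p` of a point `m` of the surface. -/
def extension (hz : Admissible z) (e : Direction z) (K : Bool → ℝ × ℝ → A) (c : A) (m : M z)
    (p : ℝ × ℝ) : A :=
  value hz e K m (p - (0, (round p.2 : ℝ))) + round p.2 • c

lemma value_eq (h : IsPrimitive hz e D K c' c) {m : M z} {p : ℝ × ℝ} (hp : p ∈ strip) {ε : Bool}
    (hm : m = e.sheetChart hz ε p) : value hz e K m p = K ε p := by
  have hex : ∃ ε, m = e.sheetChart hz ε p := ⟨ε, hm⟩
  rw [value, dif_pos hex]
  exact h.well_defined _ _ p hp (hex.choose_spec.symm.trans hm)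

lemma proj_sub_int {m : M z} {p : ℝ × ℝ} (hm : proj z m = toTorus (e.pt p)) (a b : ℤ) :
    proj z m = toTorus (e.pt (p - ((a : ℝ), (b : ℝ)))) := by
  rw [hm, ← e.toTorus_pt_add_int (p - ((a : ℝ), (b : ℝ))) a b, sub_add_cancel]

lemma value_top (h : IsPrimitive hz e D K c' c) {m : M z} {p : ℝ × ℝ}
    (hm : proj z m = toTorus (e.pt p)) (hp : p.2 = 1 / 2) :
    value hz e K m p = value hz e K m (p - (0, 1)) + c := by
  have h1 : p ∈ strip := by simp only [strip, Set.mem_ofPred_eq, hp]; norm_num [abs_of_pos]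
  have h2 : p - (0, 1) ∈ strip := by
    simp only [strip, Set.mem_ofPred_eq, Prod.snd_sub, hp]; norm_num [abs_of_pos]
  obtain ⟨ε, hε⟩ := e.exists_sheetChart_of_proj hz h1 hm
  obtain ⟨ε', hε'⟩ := e.exists_sheetChart_of_proj hz h2 (by simpa using proj_sub_int hm 0 1)
  rw [h.value_eq h1 hε, h.value_eq h2 hε']
  exact h.top _ _ p hp (hε.symm.trans hε')

/-- The extension can be computed in any translate of the strip. -/
lemma extension_eq (h : IsPrimitive hz e D K c' c) {m : M z} {p : ℝ × ℝ}
    (hm : proj z m = toTorus (e.pt p)) {j : ℤ} (hj : p - (0, (j : ℝ)) ∈ strip) :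
    extension hz e K c m p = value hz e K m (p - (0, (j : ℝ))) + j • c := by
  have h1 := abs_le.1 (show |p.2 - j| ≤ 1 / 2 from hj)
  have h2 := abs_le.1 (abs_sub_round p.2)
  have key (i : ℤ) (hi : p.2 = i + 1 / 2) : value hz e K m (p - (0, (i : ℝ))) + i • c =
      value hz e K m (p - (0, ((i + 1 : ℤ) : ℝ))) + (i + 1) • c := by
    rw [h.value_top (p := p - (0, (i : ℝ))) (by simpa using proj_sub_int hm 0 i) (by simp [hi]),
      sub_sub, add_zsmul, one_zsmul]
    simp only [Prod.mk_add_mk, add_zero, Int.cast_add, Int.cast_one]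
    abel
  rw [extension]
  obtain hlt | heq | hgt := lt_trichotomy (round p.2) j
  · have h3 : (round p.2 : ℝ) + 1 ≤ j := by exact_mod_cast hlt
    have h4 : j = round p.2 + 1 := by
      have : (j : ℝ) < round p.2 + 2 := by linarith
      have : j < round p.2 + 2 := by exact_mod_cast this
      omega
    rw [h4]
    exact key _ (by linarith)
  · rw [heq]
  · have h3 : (j : ℝ) + 1 ≤ round p.2 := by exact_mod_cast hgt
    have h4 : round p.2 = j + 1 := by
      have : (round p.2 : ℝ) < j + 2 := by linarith
      have : round p.2 < j + 2 := by exact_mod_cast this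
      omega
    rw [h4]
    exact (key _ (by linarith)).symm

/-- Translation by integers along the strip adds multiples of the period `c'`. -/
lemma value_add_int (h : IsPrimitive hz e D K c' c) {m : M z} {p : ℝ × ℝ} (hp : p ∈ strip)
    (hm : proj z m = toTorus (e.pt p)) (a : ℤ) :
    value hz e K m (p + ((a : ℝ), 0)) = value hz e K m p + a • c' := by
  have step {p : ℝ × ℝ} (hp : p ∈ strip) (hm : proj z m = toTorus (e.pt p)) :
      value hz e K m (p + (1, 0)) = value hz e K m p + c' := by
    obtain ⟨ε, hε⟩ := e.exists_sheetChart_of_proj hz hp hm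
    rw [h.value_eq hp hε, ← h.add_one ε p hp]
    exact h.value_eq ((mem_strip_add _).2 hp) (by rw [e.sheetChart_add_one hz _ hp]; simpa)
  have hs (a : ℤ) := step (p := p + ((a : ℝ), 0)) ((mem_strip_add _).2 hp) (by
    have := e.toTorus_pt_add_int p a 0
    rw [hm, ← this, Int.cast_zero])
  have hs' (a : ℤ) : value hz e K m (p + (((a + 1 : ℤ) : ℝ), 0)) =
      value hz e K m (p + ((a : ℝ), 0)) + c' := by
    rw [← hs a, add_assoc]
    simp
  induction a with
  | zero => simp [← Prod.zero_eq_mk]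
  | succ a ih => rw [hs', ih, add_zsmul, one_zsmul, add_assoc]
  | pred a ih =>
    have := hs' (-a - 1)
    rw [sub_add_cancel, ih] at this
    rw [sub_zsmul, one_zsmul, ← add_assoc, this, add_neg_cancel_right]

lemma extension_add_int (h : IsPrimitive hz e D K c' c) {m : M z} {p : ℝ × ℝ}
    (hm : proj z m = toTorus (e.pt p)) (a b : ℤ) :
    extension hz e K c m (p + ((a : ℝ), (b : ℝ))) = extension hz e K c m p + (a • c' + b • c) := by
  have h1 : (p + ((a : ℝ), (b : ℝ))) - (0, ((round p.2 + b : ℤ) : ℝ)) =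
      (p - (0, (round p.2 : ℝ))) + ((a : ℝ), 0) := by
    ext <;> simp
  have h2 := Direction.sub_round_mem_strip p
  rw [h.extension_eq (j := round p.2 + b) (by rw [hm, e.toTorus_pt_add_int])
    (by rw [h1]; exact (mem_strip_add _).2 h2), h1, h.value_add_int h2
    (by simpa using proj_sub_int hm 0 (round p.2)), extension, add_zsmul]
  abel

/-- A homomorphism with a primitive is determined on a path by the end points of a lift of the path
to the coordinates. -/
lemma map_pathClass (h : IsPrimitive hz e D K c' c) (γ : C(unitInterval, M z))
    (p : C(unitInterval, ℝ × ℝ)) (hp : ∀ t, proj z (γ t) = toTorus (e.pt (p t))) :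
    D (pathClass γ) = extension hz e K c (γ 1) (p 1) - extension hz e K c (γ 0) (p 0) := by
  refine map_pathClass_of_local D γ (fun t => extension hz e K c (γ t) (p t)) fun t₀ => ?_
  set γ' : ℝ → M z := Set.IccExtend zero_le_one γ with hγ'
  set p' : ℝ → ℝ × ℝ := Set.IccExtend zero_le_one p with hp'
  have hγc : Continuous γ' := γ.continuous.Icc_extend'
  have hpc : Continuous p' := p.continuous.Icc_extend'
  have hγp (t : ℝ) : proj z (γ' t) = toTorus (e.pt (p' t)) := hp _
  have ev1 := e.eventually_segClass_eq hz hγc hpc hγp t₀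
  have ev2 := hpc.continuousAt.eventually (e.eventually_segment_sing hz (p' t₀))
  have ev3 := hpc.continuousAt.eventually (Direction.eventually_exists_strip (p' t₀))
  have ev := continuous_subtype_val.continuousAt.eventually ((ev1.and ev2).and ev3)
  filter_upwards [ev] with t ht
  obtain ⟨⟨⟨T, hTc, hT0, hT1, hTp, hTs⟩, hdich⟩, j, hj, hj₀⟩ := ht
  have eγ (t : unitInterval) : γ' t = γ t := Set.IccExtend_val _ _ t
  have ep (t : unitInterval) : p' t = p t := Set.IccExtend_val _ _ t
  set P := p' t - (0, (j : ℝ)) with hP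
  set Q := p' t₀ - (0, (j : ℝ)) with hQ
  have hseg (s : ℝ) : (AffineMap.lineMap P Q s : ℝ × ℝ) =
      AffineMap.lineMap (p' t) (p' t₀) s - (((0 : ℤ) : ℝ), (j : ℝ)) := by
    rw [hP, hQ, AffineMap.lineMap_apply_module, AffineMap.lineMap_apply_module, Int.cast_zero]
    module
  have hline : Continuous fun s : ℝ => (AffineMap.lineMap P Q s : ℝ × ℝ) := by
    simp only [AffineMap.lineMap_apply_module]; fun_prop
  have hmem {s : ℝ} (hs : s ∈ Set.Icc (0 : ℝ) 1) : (AffineMap.lineMap P Q s : ℝ × ℝ) ∈ strip :=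
    convex_strip.lineMap_mem hj hj₀ hs
  have hcont : ContinuousOn (fun s : ℝ => e.sheetChart hz false (AffineMap.lineMap P Q s))
      (Set.Icc 0 1) :=
    (e.continuousOn_sheetChart hz false).comp hline.continuousOn fun s hs => hmem hs
  obtain ⟨ε, hε⟩ : ∃ ε, ∀ s ∈ Set.Icc (0 : ℝ) 1,
      T s = e.sheetChart hz ε (AffineMap.lineMap P Q s) := by
    rcases eqOn_or_eqOn_tau_Icc hz hTc hcont (fun s hs => by
      rw [e.proj_sheetChart hz false (hmem hs), hseg]
      exact proj_sub_int (hTp s hs) 0 j) (hdich T hTp) with h1 | h1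
    · exact ⟨false, fun s hs => (h1 hs).symm⟩
    · refine ⟨true, fun s hs => ?_⟩
      rw [← Bool.not_false, ← e.tau_sheetChart hz]
      have := h1 hs
      simp only at this
      rw [this, tau_tau]
  have hT : segClass T (0 : ℝ) 1 = segClass (e.sheetChart hz ε) P Q := segClass_congr fun s hs => by
    have e1 : AffineMap.lineMap (0 : ℝ) 1 s = s := by simp [AffineMap.lineMap_apply]
    rw [e1, hε s hs]
  have m0 : γ' t = e.sheetChart hz ε P := by
    rw [← hT0, hε 0 (by simp), AffineMap.lineMap_apply_zero]
  have m1 : γ' t₀ = e.sheetChart hz ε Q := by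
    rw [← hT1, hε 1 (by simp), AffineMap.lineMap_apply_one]
  rw [hTs, hT, map_neg, h.map_seg ε P Q hj hj₀, ← eγ, ← eγ, ← ep, ← ep,
    h.extension_eq (hγp _) hj, h.extension_eq (hγp _) hj₀, h.value_eq hj m0, h.value_eq hj₀ m1]
  abel

/-- A homomorphism with a primitive vanishes on the homology classes with zero holonomy: the value
on a path is, up to a function of its end points, a linear function of the holonomy. -/
theorem eq_zero (h : IsPrimitive hz e D K c' c) {x : H1 z} (hx : x ∈ H1zero z) :
    D (((chains z).homologyι 1).hom x) = 0 := by
  obtain rfl : ‹Module ℤ A› = AddCommGroup.toIntModule A := Subsingleton.elim _ _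
  choose s hs using e.exists_coord (z := z)
  let B : ℤ × ℤ →+ Plane := AddMonoidHom.mk' (fun n => e.pt ((n.1 : ℝ), (n.2 : ℝ))) (by
    intro n n'
    rw [← map_add]
    simp)
  let κ : ℤ × ℤ →+ A := AddMonoidHom.mk' (fun n => n.1 • c' + n.2 • c) (by
    intro n n'
    simp only [Prod.fst_add, Prod.snd_add, add_zsmul]
    abel)
  have hB : Function.Injective B := by
    intro n n' hn
    have := congrArg e.coord (show e.pt _ = e.pt _ from hn)
    rw [e.coord_pt, e.coord_pt, Prod.mk.injEq, Int.cast_inj, Int.cast_inj] at this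
    exact Prod.ext this.1 this.2
  refine eq_zero_of_mem_H1zero D (fun m => e.pt (s m))
    (fun m => extension hz e K c m (s m)) κ B hB (fun γ => ?_) hx
  obtain ⟨P, hP⟩ := exists_planeLift γ
  let p : C(unitInterval, ℝ × ℝ) := ⟨fun t => e.coord (P t), e.continuous_coord.comp P.continuous⟩
  have hp (t) : proj z (γ t) = toTorus (e.pt (p t)) := by
    rw [← hP t]; exact congrArg toTorus (e.pt_coord _).symm
  obtain ⟨a₁, b₁, h1⟩ := e.exists_int_of_toTorus_eq ((hp 1).symm.trans (hs (γ 1)))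
  obtain ⟨a₀, b₀, h0⟩ := e.exists_int_of_toTorus_eq ((hp 0).symm.trans (hs (γ 0)))
  refine ⟨(a₁ - a₀, b₁ - b₀), ?_, ?_⟩
  · rw [displacement_eq γ P hP, ← e.pt_coord (P 1), ← e.pt_coord (P 0)]
    change e.pt (p 1) - e.pt (p 0) = _ + e.pt _
    rw [h1, h0, ← map_sub, ← map_sub, ← map_add]
    congr 1
    ext <;> simp <;> ring
  · rw [h.map_pathClass γ p hp, h1, h0, h.extension_add_int (hs _), h.extension_add_int (hs _)]
    change _ = _ + ((a₁ - a₀) • c' + (b₁ - b₀) • c)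
    rw [sub_zsmul, sub_zsmul]
    abel

end IsPrimitive
end Primitive

/-! ### The action on the homology classes with zero holonomy -/

section Action
variable {z : Plane} (hz : Admissible z) (e : Direction z)

lemma lineMap_add_right {E : Type*} [AddCommGroup E] [Module ℝ E] (p q v : E) (s : ℝ) :
    AffineMap.lineMap (p + v) (q + v) s = AffineMap.lineMap p q s + v := by
  rw [AffineMap.lineMap_apply_module, AffineMap.lineMap_apply_module]; module

lemma H1map_trans {z z' z'' : Plane} (f : M z ≃ₜ M z') (g : M z' ≃ₜ M z'') (c : H1 z) :
    H1map (f.trans g) c = H1map g (H1map f c) := by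
  have h := ((AlgebraicTopology.singularHomologyFunctor (ModuleCat.{0} ℤ) 1).obj
    (ModuleCat.of ℤ ℤ)).map_comp (TopCat.ofHom (f : C(M z, M z')))
    (TopCat.ofHom (g : C(M z', M z'')))
  exact congrArg (fun φ => φ.hom c) h

namespace Direction

lemma lineMap_mem_strip {p q : ℝ × ℝ} (hp : p ∈ strip) (hq : q ∈ strip) {s : ℝ}
    (hs : s ∈ Set.Icc (0 : ℝ) 1) : AffineMap.lineMap p q s ∈ strip :=
  convex_strip.lineMap_mem hp hq hs

lemma segClass_add_strip (ε : Bool) {p q r : ℝ × ℝ} (hp : p ∈ strip) (hq : q ∈ strip)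
    (hr : r ∈ strip) : segClass (e.sheetChart hz ε) p q + segClass (e.sheetChart hz ε) q r =
      segClass (e.sheetChart hz ε) p r :=
  segClass_add convex_strip (e.continuousOn_sheetChart hz ε) hp hq hr

lemma segClass_add_one (ε : Bool) {p q : ℝ × ℝ} (hp : p ∈ strip) (hq : q ∈ strip) :
    segClass (e.sheetChart hz ε) (p + (1, 0)) (q + (1, 0)) =
      segClass (e.sheetChart hz (!ε)) p q := segClass_congr fun s hs => by
  rw [lineMap_add_right, e.sheetChart_add_one hz ε (lineMap_mem_strip hp hq hs)]

lemma segClass_add_even (ε : Bool) (a : ℤ) {p q : ℝ × ℝ} (hp : p ∈ strip) (hq : q ∈ strip) :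
    segClass (e.sheetChart hz ε) (p + (2 * (a : ℝ), 0)) (q + (2 * (a : ℝ), 0)) =
      segClass (e.sheetChart hz ε) p q := segClass_congr fun s hs => by
  rw [lineMap_add_right, e.sheetChart_add_even hz ε a (lineMap_mem_strip hp hq hs)]

lemma chainClassMap_tau_segClass (ε : Bool) {p q : ℝ × ℝ} (hp : p ∈ strip) (hq : q ∈ strip) :
    chainClassMap (tau hz : C(M z, M z)) (segClass (e.sheetChart hz ε) p q) =
      segClass (e.sheetChart hz (!ε)) p q := by
  rw [chainClassMap_segClass _ convex_strip (e.continuousOn_sheetChart hz ε) hp hq]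
  exact segClass_congr fun s _ => e.tau_sheetChart hz ε _

/-- A homomorphism that does not distinguish the two lifts of a segment takes the same values on
corresponding segments of the two boundary lines of the strip, since these have the same projection
to the torus. -/
lemma map_seg_bottom_eq_top {A : Type} [AddCommGroup A] [Module ℤ A]
    (D : ChainClass (M z) →ₗ[ℤ] A)
    (hD : ∀ ε p q, p ∈ strip → q ∈ strip →
      D (segClass (e.sheetChart hz (!ε)) p q) = D (segClass (e.sheetChart hz ε) p q)) (x y : ℝ) :
    D (segClass (e.sheetChart hz false) (x, 1 / 2) (y, 1 / 2)) =
      D (segClass (e.sheetChart hz false) (x, -(1 / 2)) (y, -(1 / 2))) := by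
  have hup (x : ℝ) : ((x, 1 / 2) : ℝ × ℝ) ∈ strip := by
    simp only [strip, Set.mem_ofPred_eq]; norm_num [abs_of_pos]
  have hlo (x : ℝ) : ((x, -(1 / 2)) : ℝ × ℝ) ∈ strip := by
    simp only [strip, Set.mem_ofPred_eq]; norm_num [abs_of_pos]
  set G : ℝ → A := fun y => D (segClass (e.sheetChart hz false) (x, 1 / 2) (y, 1 / 2)) -
    D (segClass (e.sheetChart hz false) (x, -(1 / 2)) (y, -(1 / 2))) with hG
  have hG0 : G x = 0 := by simp [hG, segClass_self]
  have hloc : IsLocallyConstant G := by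
    rw [IsLocallyConstant.iff_eventually_eq]
    intro t₀
    have hc : Continuous fun t : ℝ => ((t, 1 / 2) : ℝ × ℝ) := by fun_prop
    filter_upwards [hc.continuousAt.eventually (e.eventually_segment_sing hz (t₀, 1 / 2))] with t ht
    have hl (c s : ℝ) : (AffineMap.lineMap ((t, c) : ℝ × ℝ) (t₀, c) s : ℝ × ℝ) =
        (AffineMap.lineMap t t₀ s, c) := by
      simp [AffineMap.lineMap_apply_module, ← add_mul]
    have hcont (c : ℝ) (hc : ∀ x : ℝ, ((x, c) : ℝ × ℝ) ∈ strip) : ContinuousOn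
        (fun s : ℝ => e.sheetChart hz false (AffineMap.lineMap ((t, c) : ℝ × ℝ) (t₀, c) s))
        (Set.Icc 0 1) := by
      exact (e.continuousOn_sheetChart hz false).comp AffineMap.lineMap_continuous.continuousOn
        fun s _ => by rw [hl]; exact hc _
    have hseg : D (segClass (e.sheetChart hz false) (t, -(1 / 2)) (t₀, -(1 / 2))) =
        D (segClass (e.sheetChart hz false) (t, 1 / 2) (t₀, 1 / 2)) := by
      have hp (s : ℝ) : toTorus (e.pt ((AffineMap.lineMap t t₀ s, 1 / 2) : ℝ × ℝ)) =
          toTorus (e.pt ((AffineMap.lineMap t t₀ s, -(1 / 2)) : ℝ × ℝ)) := by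
        rw [← e.toTorus_pt_add_int (_, -(1 / 2)) 0 1]
        congr 2
        ext <;> simp; norm_num
      rcases eqOn_or_eqOn_tau_Icc hz (hcont _ hup) (hcont _ hlo) (fun s hs => by
          rw [hl, hl, e.proj_sheetChart hz false (hup _), e.proj_sheetChart hz false (hlo _), hp])
        (ht _ fun s hs => by rw [hl, e.proj_sheetChart hz false (hup _)]) with h | h
      · exact congrArg D (segClass_congr h)
      · rw [← hD false _ _ (hup _) (hup _)]
        refine congrArg D (segClass_congr fun s hs => ?_)
        rw [← e.tau_sheetChart hz]
        exact h hs
    have e1 := e.segClass_add_strip hz false (hup x) (hup t) (hup t₀)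
    have e2 := e.segClass_add_strip hz false (hlo x) (hlo t) (hlo t₀)
    simp only [hG]
    rw [← e1, ← e2, map_add, map_add, hseg]
    abel
  have h := hloc.apply_eq_of_isPreconnected isPreconnected_univ (Set.mem_univ y) (Set.mem_univ x)
  rw [hG0] at h
  exact sub_eq_zero.1 h

include e in
/-- The exchange of the two tori acts as `-id` on the classes with zero holonomy. -/
theorem H1map_tau {x : H1 z} (hx : x ∈ H1zero z) : H1map (tau hz) x = -x := by
  set D : ChainClass (M z) →ₗ[ℤ] ChainClass (M z) :=
    chainClassMap (tau hz : C(M z, M z)) + LinearMap.id with hDdef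
  have hD (ε : Bool) (p q : ℝ × ℝ) (hp : p ∈ strip) (hq : q ∈ strip) :
      D (segClass (e.sheetChart hz (!ε)) p q) = D (segClass (e.sheetChart hz ε) p q) := by
    simp only [hDdef, LinearMap.add_apply, LinearMap.id_apply]
    rw [e.chainClassMap_tau_segClass hz _ hp hq, e.chainClassMap_tau_segClass hz _ hp hq,
      Bool.not_not, add_comm]
  have hD' (ε : Bool) {p q : ℝ × ℝ} (hp : p ∈ strip) (hq : q ∈ strip) :
      D (segClass (e.sheetChart hz ε) p q) = D (segClass (e.sheetChart hz false) p q) := by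
    cases ε
    · rfl
    · exact hD false p q hp hq
  have h0 : (0 : ℝ × ℝ) ∈ strip := by simp [strip]
  have h1 : (1, 0) ∈ strip := by simp [strip]
  have hup (x : ℝ) : ((x, 1 / 2) : ℝ × ℝ) ∈ strip := by
    simp only [strip, Set.mem_ofPred_eq]; norm_num [abs_of_pos]
  have hlo (x : ℝ) : ((x, -(1 / 2)) : ℝ × ℝ) ∈ strip := by
    simp only [strip, Set.mem_ofPred_eq]; norm_num [abs_of_pos]
  -- The values of `D` on segments do not depend on the sheet, so they have a primitive on the
  -- strip.
  set K : ℝ × ℝ → ChainClass (M z) := fun p => D (segClass (e.sheetChart hz false) 0 p) with hK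
  have hKsub {p q : ℝ × ℝ} (hp : p ∈ strip) (hq : q ∈ strip) :
      D (segClass (e.sheetChart hz false) p q) = K q - K p := by
    simp only [hK]
    rw [← e.segClass_add_strip hz false h0 hp hq, map_add, add_sub_cancel_left]
  have hprim : IsPrimitive hz e D (fun _ => K) (K (1, 0)) (K (0, 1 / 2) - K (0, -(1 / 2))) := by
    refine ⟨fun _ _ _ _ _ => rfl, fun ε p q hp hq => by rw [hD' ε hp hq, hKsub hp hq], ?_, ?_⟩
    · intro _ p hp
      have e1 := e.segClass_add_one hz false h0 hp
      rw [zero_add] at e1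
      have e2 := hKsub h1 ((mem_strip_add (p := p) 1).2 hp)
      rw [add_comm p] at e1 e2
      rw [e1, hD false _ _ h0 hp] at e2
      rw [add_comm p]
      exact sub_eq_iff_eq_add.1 e2.symm
    · rintro _ _ ⟨x, y⟩ hy -
      simp only at hy
      subst hy
      have e1 := e.map_seg_bottom_eq_top hz D hD 0 x
      rw [hKsub (hup _) (hup _), hKsub (hlo _) (hlo _)] at e1
      have e2 : ((x, 1 / 2) : ℝ × ℝ) - (0, 1) = (x, -(1 / 2)) := by ext <;> simp; norm_num
      simp only [e2]
      rw [sub_eq_sub_iff_add_eq_add] at e1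
      rw [← add_sub_assoc, eq_sub_iff_add_eq, e1]
  have h := hprim.eq_zero hx
  refine homologyι_injective z ?_
  refine (homologyι_H1map _ _).trans (Eq.trans ?_ (map_neg _ x).symm)
  exact eq_neg_of_add_eq_zero_left h

/-- The twist acts trivially on the classes with zero holonomy. -/
theorem H1map_twist (k : ℤ) {x : H1 z} (hx : x ∈ H1zero z) : H1map (e.twist hz k) x = x := by
  set D : ChainClass (M z) →ₗ[ℤ] ChainClass (M z) :=
    chainClassMap (e.twist hz k : C(M z, M z)) - LinearMap.id with hDdef
  -- The twist changes a segment from `p` to `q` by the difference of the horizontal segments along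
  -- which it moves the end points.
  set K : Bool → ℝ × ℝ → ChainClass (M z) := fun ε p =>
    segClass (e.sheetChart hz ε) p (stripShear k p) with hK
  set v : ℝ × ℝ := (2 * (k : ℝ), 0) with hv
  have hmem {p : ℝ × ℝ} (hp : p ∈ strip) (a : ℝ) : p + (a, 0) ∈ strip := (mem_strip_add a).2 hp
  have h0 : (0 : ℝ × ℝ) ∈ strip := by simp [strip]
  -- The loop that runs `k` times around the cylinder has the same class everywhere, since the
  -- segments that connect two such loops are the same at both ends.
  have hloop (ε : Bool) {p q : ℝ × ℝ} (hp : p ∈ strip) (hq : q ∈ strip) :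
      segClass (e.sheetChart hz ε) p (p + v) = segClass (e.sheetChart hz ε) q (q + v) := by
    have e1 := e.segClass_add_strip hz ε hp (hmem hp (2 * (k : ℝ))) (hmem hq (2 * (k : ℝ)))
    have e2 := e.segClass_add_strip hz ε hp hq (hmem hq (2 * (k : ℝ)))
    rw [e.segClass_add_even hz ε k hp hq, ← e2, add_comm] at e1
    exact add_left_cancel e1
  set C := segClass (e.sheetChart hz false) 0 (0 + v) with hC
  have hloopC (ε : Bool) {p : ℝ × ℝ} (hp : p ∈ strip) :
      segClass (e.sheetChart hz ε) p (p + v) = C := by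
    cases ε
    · exact hloop false hp h0
    · have e1 := e.segClass_add_one hz false hp (hmem hp (2 * (k : ℝ)))
      rw [Bool.not_false, add_right_comm] at e1
      rw [← e1]
      exact hloop false (hmem hp 1) h0
  have hKtop (ε : Bool) {p : ℝ × ℝ} (h : p.2 = 1 / 2) (hp : p ∈ strip) : K ε p = C := by
    rw [← hloopC ε hp]
    simp only [hK, hv, stripShear, h]
    congr 3
    ring
  have hKbot (ε : Bool) {p : ℝ × ℝ} (h : p.2 = -(1 / 2)) : K ε p = 0 := by
    have : stripShear k p = p := by ext <;> simp [stripShear, h]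
    simp only [hK, this, segClass_self]
  have hprim : IsPrimitive hz e D K 0 C := by
    refine ⟨?_, ?_, ?_, ?_⟩
    · intro ε ε' p hp h
      by_cases hε : ε = ε'
      · rw [hε]
      have hb : |p.2| = 1 / 2 := by
        by_contra hne
        have hns := e.sheetChart_notMem_sing hz false (lt_of_le_of_ne hp hne)
        exact hε ((tauPow_eq_iff hz hns ε ε').1 h)
      rcases eq_or_eq_neg_of_abs_eq hb with hb | hb
      · rw [hKtop ε hb hp, hKtop ε' hb hp]
      · rw [hKbot ε hb, hKbot ε' hb]
    · intro ε p q hp hq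
      have hp' := stripShear_mem (k := k).2 hp
      have hq' := stripShear_mem (k := k).2 hq
      have e0 : chainClassMap (e.twist hz k : C(M z, M z)) (segClass (e.sheetChart hz ε) p q) =
          segClass (e.sheetChart hz ε) (stripShear k p) (stripShear k q) := by
        rw [chainClassMap_segClass _ convex_strip (e.continuousOn_sheetChart hz ε) hp hq]
        refine segClass_congr fun s hs => ?_
        refine (e.twist_sheetChart hz k ε (lineMap_mem_strip hp hq hs)).trans ?_
        congr 1
        simp only [AffineMap.lineMap_apply_module, stripShear]
        ext
        · simp; ring
        · simp
      have e1 := e.segClass_add_strip hz ε hp hp' hq'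
      have e2 := e.segClass_add_strip hz ε hp hq hq'
      simp only [hDdef, LinearMap.sub_apply, LinearMap.id_apply, hK]
      rw [e0, sub_eq_sub_iff_add_eq_add, add_comm, e1, ← e2, add_comm]
    · intro ε p hp
      simp only [hK]
      rw [stripShear_add, e.segClass_add_one hz _ hp (stripShear_mem.2 hp), Bool.not_not, add_zero]
    · intro ε ε' p hp _
      have h1 : p ∈ strip := by simp only [strip, Set.mem_ofPred_eq, hp]; norm_num [abs_of_pos]
      rw [hKtop ε hp h1, hKbot ε' (by simp [hp]; norm_num), zero_add]
  have h := hprim.eq_zero hx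
  refine homologyι_injective z ?_
  rw [homologyι_H1map]
  exact sub_eq_zero.1 h

end Direction
end Action

/-! ### Affine homeomorphisms with a given derivative -/

section Affine
variable {z : Plane} (hz : Admissible z) (e : Direction z)
  {g : Matrix.SpecialLinearGroup (Fin 2) ℤ}

lemma act_add (g : Matrix.SpecialLinearGroup (Fin 2) ℤ) (p q : Plane) :
    act g (p + q) = act g p + act g q := Matrix.mulVec_add _ _ _

/-- A homeomorphism over the linear automorphism `g` of the torus is affine with derivative `g`. -/
lemma isAffineWithDerivative_of_proj {f : M z ≃ₜ M z} (hs : ∀ m ∈ sing z, f m ∈ sing z)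
    (h : ∀ m p, proj z m = toTorus p → proj z (f m) = toTorus (act g p)) :
    IsAffineWithDerivative g f := by
  refine ⟨hs, fun m _ => ?_⟩
  have hc (k : Fin 2) : Continuous fun m' => ‖(proj z m' - proj z m) k‖ :=
    (((continuous_apply k).comp ((proj z).continuous.sub continuous_const))).norm
  have hev : ∀ᶠ m' in 𝓝 m, ∀ k, ‖(proj z m' - proj z m) k‖ < 1 / 2 := by
    refine Filter.eventually_all.2 fun k => ?_
    exact (hc k).continuousAt.eventually_lt continuousAt_const (by simp)
  filter_upwards [hev] with m' hm'
  obtain ⟨v, hv, hvt⟩ := exists_toTorus_eq (proj z m' - proj z m)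
  obtain ⟨p, -, hp⟩ := exists_toTorus_eq (proj z m)
  have e1 : proj z m' = proj z m + toTorus v := by rw [hvt, add_sub_cancel]
  refine ⟨v, fun k => ?_, e1, ?_⟩
  · rw [← norm_coe_of_abs_le (abs_le.2 ⟨(hv k).1, (hv k).2.le⟩)]
    have := hm' k
    rwa [← hvt] at this
  · rw [h m p hp.symm, h m' (p + v) (by rw [e1, ← hp, toTorus_add]), act_add, toTorus_add]

include hz e in
lemma dense_compl_sing : Dense (sing z)ᶜ := by
  intro m
  obtain ⟨ε, p, hp, -, rfl⟩ := e.exists_sheetChart hz m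
  have hsub : {p : ℝ × ℝ | |p.2| < 1 / 2} ⊆ strip := fun q hq => (show |q.2| < 1 / 2 from hq).le
  have h1 := ((e.continuousOn_sheetChart hz ε p hp).mono hsub).mem_closure_image
    (strip_subset_closure hp)
  refine closure_mono ?_ h1
  rintro _ ⟨q, hq, rfl⟩
  exact e.sheetChart_notMem_sing hz ε hq

include hz e in
/-- Two affine homeomorphisms with the same derivative, one of which lifts a linear automorphism of
the torus, differ by a translation on the torus. -/
lemma exists_translation {f f₀ : M z ≃ₜ M z} (hf : IsAffineWithDerivative g f)
    (h₀ : ∀ m p, proj z m = toTorus p → proj z (f₀ m) = toTorus (act g p)) :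
    ∃ t : Torus, ∀ m, proj z (f m) = proj z (f₀ m) + t := by
  have hloc : IsLocallyConstant fun m : ((sing z)ᶜ : Set (M z)) =>
      proj z (f m) - proj z (f₀ m) := by
    rw [IsLocallyConstant.iff_eventually_eq]
    intro m
    filter_upwards [continuous_subtype_val.continuousAt.eventually (hf.affine m m.2)] with m' hm'
    obtain ⟨v, -, hv1, hv2⟩ := hm'
    obtain ⟨p, -, hp⟩ := exists_toTorus_eq (proj z m)
    rw [hv2, h₀ m p hp.symm, h₀ m' (p + v) (by rw [hv1, ← hp, toTorus_add]), act_add, toTorus_add,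
      add_sub_add_right_eq_sub]
  have := isPreconnected_iff_preconnectedSpace.1 (isPreconnected_compl_sing hz)
  have hd := dense_compl_sing hz e
  obtain ⟨m₀, hm₀⟩ := hd.nonempty_iff.2 ⟨e.chart hz 0⟩
  refine ⟨proj z (f m₀) - proj z (f₀ m₀), fun m => ?_⟩
  have hc1 : Continuous fun m => proj z (f m) := (proj z).continuous.comp f.continuous
  have hc2 : Continuous fun m => proj z (f₀ m) + (proj z (f m₀) - proj z (f₀ m₀)) :=
    ((proj z).continuous.comp f₀.continuous).add continuous_const
  refine congrFun (Continuous.ext_on hd hc1 hc2 fun m hm => ?_) m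
  have := hloc.apply_eq_of_isPreconnected isPreconnected_univ (Set.mem_univ ⟨m, hm⟩)
    (Set.mem_univ ⟨m₀, hm₀⟩)
  exact sub_eq_iff_eq_add'.1 this

include hz e in
/-- Two homeomorphisms over the same map of the torus, one of which fixes the singularities, agree
up to the deck transformation. -/
lemma eq_or_eq_tau_comp {f f₀ : M z ≃ₜ M z} (hfix : ∀ m ∈ sing z, f₀ m = m)
    (h : ∀ m, proj z (f m) = proj z (f₀ m)) : f = f₀ ∨ f = f₀.trans (tau hz) := by
  have := t2Space hz
  have hd := dense_compl_sing hz e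
  rcases eqOn_or_eqOn_tau hz (isPreconnected_compl_sing hz) f₀.continuous.continuousOn
    f.continuous.continuousOn (fun m _ => (h m).symm)
    (fun m hm hm' => hm (f₀.injective (hfix _ hm') ▸ hm')) with h1 | h1
  · exact Or.inl (Homeomorph.ext fun m => congrFun (Continuous.ext_on hd f.continuous
      f₀.continuous h1) m)
  · exact Or.inr (Homeomorph.ext fun m => congrFun (Continuous.ext_on hd f.continuous
      (f₀.trans (tau hz)).continuous h1) m)

lemma toTorus_apply_one_ne (hz : Admissible z) : toTorus z 1 ≠ 0 := by
  have h := hz.abs_lt 1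
  rw [← norm_ne_zero_iff, toTorus, norm_coe_of_abs_le h.le]
  exact abs_ne_zero.2 hz.ne_zero

include hz in
/-- No homeomorphism of the surface lifts a nontrivial translation of the torus that exchanges the
two singularities: it would commute with the lift `iota` of `-1` up to a constant power of the
deck transformation, but the power is odd over the origin and even over `(1/2, 0)`. -/
lemma not_translation {h : M z ≃ₜ M z} {t : Torus} (ht : ∀ m, proj z (h m) = proj z m + t)
    (ht1 : t = toTorus z + toTorus z) (ht2 : t = -t) : False := by
  have hz1 := toTorus_apply_one_ne hz
  have htwo : t + t = 0 := by nth_rewrite 2 [ht2]; exact add_neg_cancel t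
  have hhalf : t 1 = ((1 / 2 : ℝ) : UnitAddCircle) := by
    have h4 : ((4 * z 1 : ℝ) : UnitAddCircle) = 0 := by
      have := congrFun htwo 1
      rw [ht1] at this
      rw [show 4 * z 1 = (z 1 + z 1) + (z 1 + z 1) by ring]
      exact this
    obtain ⟨j, hj⟩ := (AddCircle.coe_eq_zero_iff (1 : ℝ)).1 h4
    have hj' : (j : ℝ) = 4 * z 1 := by simpa using hj
    have hb := abs_lt.1 (hz.abs_lt 1)
    have h1 : j < 2 := by have : (j : ℝ) < 2 := by linarith
                          exact_mod_cast this
    have h2 : -2 < j := by have : -2 < (j : ℝ) := by linarith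
                           exact_mod_cast this
    have h3 : j ≠ 0 := by
      rintro rfl
      exact hz.ne_zero (by simpa using hj'.symm)
    have e1 : t 1 = ((z 1 + z 1 : ℝ) : UnitAddCircle) := congrFun ht1 1
    rw [e1, ← sub_eq_zero, ← AddCircle.coe_sub, AddCircle.coe_eq_zero_iff]
    obtain rfl | rfl : j = -1 ∨ j = 1 := by omega
    · exact ⟨-1, by push_cast at hj'; rw [neg_one_zsmul]; linarith⟩
    · exact ⟨0, by push_cast at hj'; rw [zero_zsmul]; linarith⟩
  have hsing {m : M z} (hm : h m ∈ sing z) : m ∈ sing z := by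
    have e1 : proj z m = proj z (h m) - t := by rw [ht, add_sub_cancel_right]
    rcases hm with hm | hm
    · refine Or.inr ?_
      change proj z m = toTorus (-z)
      rw [e1, show proj z (h m) = toTorus z from hm, ht1, toTorus_neg]; abel
    · refine Or.inl ?_
      change proj z m = toTorus z
      rw [e1, show proj z (h m) = toTorus (-z) from hm, ht2, ht1, toTorus_neg]; abel
  have hsing' {m : M z} (hm : iota hz m ∈ sing z) : m ∈ sing z := by
    rcases hm with hm | hm
    · refine Or.inr ?_
      change proj z m = toTorus (-z)
      rw [toTorus_neg, ← show proj z (iota hz m) = toTorus z from hm, proj_iota, neg_neg]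
    · refine Or.inl ?_
      change proj z m = toTorus z
      rw [← neg_inj, ← proj_iota hz, ← toTorus_neg]
      exact hm
  have hnot {m : M z} (hm : proj z m 1 = 0) : m ∉ sing z := by
    rintro (hs | hs)
    · rw [show proj z m = toTorus z from hs] at hm; exact hz1 hm
    · rw [show proj z m = toTorus (-z) from hs] at hm
      exact hz1 (neg_eq_zero.1 hm)
  have hpt (x : Torus) : ∃ m, proj z m = x := by
    obtain ⟨w, hw⟩ := IsAlgClosed.exists_pow_nat_eq (branch z x) zero_lt_two
    obtain ⟨m, hm, -⟩ := exists_point hz hw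
    exact ⟨m, hm⟩
  have hc1 : Continuous fun m => h (iota hz m) := h.continuous.comp (iota hz).continuous
  have hc2 : Continuous fun m => iota hz (h m) := (iota hz).continuous.comp h.continuous
  have hproj (m : M z) : proj z (h (iota hz m)) = proj z (iota hz (h m)) := by
    rw [ht, proj_iota, proj_iota, ht, neg_add, ← ht2]
  obtain ⟨m, hm⟩ := hpt 0
  obtain ⟨m', hm'⟩ := hpt (toTorus ![1 / 2, 0])
  have hns : m ∉ sing z := hnot (by rw [hm]; rfl)
  have hns' : m' ∉ sing z := hnot (by rw [hm']; rfl)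
  have h2m' : -proj z m' = proj z m' := by
    rw [eq_comm, eq_neg_iff_add_eq_zero, hm', ← toTorus_add, toTorus_eq_zero_iff]
    intro k
    fin_cases k
    · exact ⟨1, by norm_num⟩
    · exact ⟨0, by norm_num⟩
  have i1 : iota hz (h m) = h m := iota_eq_self_of_half hz 1
    (by rw [ht, hm, zero_add, hhalf]) (by rw [ht, hm, zero_add, ← ht2])
  have i2 : iota hz (h m') = h m' := iota_eq_self_of_half hz 1
    (by rw [ht, hm', Pi.add_apply, hhalf]; simp [toTorus])
    (by rw [ht, neg_add, ← ht2, h2m'])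
  have i3 : iota hz m' = m' := iota_eq_self_of_half hz 0 (by rw [hm']; rfl) h2m'
  have i4 := iota_eq_tau_of_zero hz hm
  rcases eqOn_or_eqOn_tau hz (isPreconnected_compl_sing hz) hc1.continuousOn hc2.continuousOn
    (fun m _ => hproj m) (fun m hm hm' => hm (hsing' (hsing hm'))) with h1 | h1
  · have := h1 hns
    simp only [i1, i4] at this
    exact hns ((tau_eq_self_iff hz m).1 (h.injective this).symm)
  · have := h1 hns'
    simp only [i2, i3] at this
    exact hns' (hsing ((tau_eq_self_iff hz _).1 this.symm))

include hz e in
/-- An affine homeomorphism that lifts a linear automorphism of the torus and fixes the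
singularities is determined by its derivative up to the exchange of the two tori. -/
theorem eq_or_eq_tau_of_isAffineWithDerivative {f f₀ : M z ≃ₜ M z} (hf : IsAffineWithDerivative g f)
    (hfix : ∀ m ∈ sing z, f₀ m = m)
    (h₀ : ∀ m p, proj z m = toTorus p → proj z (f₀ m) = toTorus (act g p)) :
    f = f₀ ∨ f = f₀.trans (tau hz) := by
  obtain ⟨t, ht⟩ := exists_translation hz e hf h₀
  have hpt {x : Torus} (hx : branch z x = 0) : ∃ m, proj z m = x := by
    obtain ⟨m, hm, -⟩ := exists_point hz (x := x) (w := 0) (by rw [hx]; simp)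
    exact ⟨m, hm⟩
  obtain ⟨b, hb⟩ := hpt ((branch_eq_zero_iff' hz (toTorus z)).2 (Or.inl rfl))
  obtain ⟨c, hc⟩ := hpt ((branch_eq_zero_iff' hz (toTorus (-z))).2 (Or.inr rfl))
  have hbs : b ∈ sing z := Or.inl hb
  have hcs : c ∈ sing z := Or.inr hc
  have tb := ht b
  have tc := ht c
  rw [hfix b hbs, hb] at tb
  rw [hfix c hcs, hc] at tc
  by_cases ht0 : t = 0
  · exact eq_or_eq_tau_comp hz e hfix fun m => by rw [ht, ht0, add_zero]
  · exfalso
    have e1 : t = -(toTorus z + toTorus z) := by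
      rcases hf.map_sing b hbs with h | h
      · rw [show proj z (f b) = toTorus z from h] at tb
        exact absurd (left_eq_add.1 tb) ht0
      · rw [show proj z (f b) = toTorus (-z) from h, toTorus_neg] at tb
        rw [eq_sub_of_add_eq' tb.symm]
        abel
    have e2 : t = toTorus z + toTorus z := by
      rcases hf.map_sing c hcs with h | h
      · rw [show proj z (f c) = toTorus z from h, toTorus_neg] at tc
        rw [eq_sub_of_add_eq' tc.symm]
        abel
      · rw [show proj z (f c) = toTorus (-z) from h] at tc
        exact absurd (left_eq_add.1 tc) ht0
    refine not_translation hz (h := f₀.symm.trans f) (t := t) (fun m => ?_) e2 ?_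
    · simp [ht]
    · nth_rewrite 1 [e1]
      rw [← e2]

end Affine

/-! ### The word as a product of two twists -/

section Word

lemma coe_hPlus_pow (k : ℕ) : ((hPlus ^ k : Matrix.SpecialLinearGroup (Fin 2) ℤ) :
    Matrix (Fin 2) (Fin 2) ℤ) = !![1, (k : ℤ); 0, 1] := by
  induction k with
  | zero => simp [Matrix.one_fin_two]
  | succ k ih =>
    rw [pow_succ, Matrix.SpecialLinearGroup.coe_mul, ih, hPlus]
    simp [add_comm]

lemma coe_hMinus_pow (k : ℕ) : ((hMinus ^ k : Matrix.SpecialLinearGroup (Fin 2) ℤ) :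
    Matrix (Fin 2) (Fin 2) ℤ) = !![1, 0; (k : ℤ), 1] := by
  induction k with
  | zero => simp [Matrix.one_fin_two]
  | succ k ih =>
    rw [pow_succ, Matrix.SpecialLinearGroup.coe_mul, ih, hMinus]
    simp

/-- The linear parabolic map with direction `v` that is the derivative of `twist k`. -/
def shear (v : Plane) (k : ℝ) (p : Plane) : Plane := p + (2 * k * side v p) • v

/-- The direction of the first twist. -/
def firstDirection (a n : ℕ) : Plane := ![a, -1 - n * a]

/-- The direction of the second twist. -/
def secondDirection (d : ℕ) : Plane := ![d, 1]

/-- The word is a product of two parabolic matrices. With the rotation `R = (0 1; -1 0)` and the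
halves `A = h₊^(d-1) h₋ h₊ h₋^d` and `B = h₋^(a-1) h₊ h₋ h₊^a`, the matrices `A R` and `R⁻¹ B` are
parabolic with directions `(d, 1)` and `(a, -1)`, and `R⁻¹ h₊^n R = h₋^(-n)`, so the second one
is conjugated by `h₋^(-n)`. -/
lemma act_gWord {a d : ℕ} (ha : 1 ≤ a) (hd : 1 ≤ d) (n : ℕ) (p : Plane) : act (gWord a d n) p =
    shear (secondDirection d) 1 (shear (firstDirection a n) (-1) p) := by
  obtain ⟨a, rfl⟩ := Nat.exists_eq_add_of_le' ha
  obtain ⟨d, rfl⟩ := Nat.exists_eq_add_of_le' hd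
  have h1 := coe_hPlus_pow 1
  have h2 := coe_hMinus_pow 1
  rw [pow_one] at h1 h2
  have hw : ((gWord (a + 1) (d + 1) n : Matrix.SpecialLinearGroup (Fin 2) ℤ) :
      Matrix (Fin 2) (Fin 2) ℤ) = !![1, (d : ℤ); 0, 1] * !![1, 0; 1, 1] * !![1, 1; 0, 1] *
        !![1, 0; (d : ℤ) + 1, 1] * !![1, (n : ℤ); 0, 1] * !![1, 0; (a : ℤ), 1] * !![1, 1; 0, 1] *
        !![1, 0; 1, 1] * !![1, (a : ℤ) + 1; 0, 1] * !![1, 0; (n : ℤ), 1] := by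
    simp only [gWord, Matrix.SpecialLinearGroup.coe_mul, coe_hPlus_pow, coe_hMinus_pow, h1, h2,
      Nat.add_sub_cancel, Nat.cast_add, Nat.cast_one]
  simp only [Matrix.mul_fin_two] at hw
  funext k
  rw [act, hw]
  fin_cases k
  · simp [shear, firstDirection, secondDirection, side, Matrix.vecHead, Matrix.vecTail]
    ring
  · simp [shear, firstDirection, secondDirection, side, Matrix.vecHead, Matrix.vecTail]
    ring

variable {z : Plane} (hz : Admissible z)

lemma Direction.proj_twist_shear (e : Direction z) (k : ℤ) {m : M z} {p : Plane}
    (h : proj z m = toTorus p) :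
    proj z (e.twist hz k m) = toTorus (shear (fun i => (e.v i : ℝ)) k p) := by
  rw [e.proj_twist hz k (p := e.coord p) (by rw [e.pt_coord, h])]
  have h1 : side (fun i => (e.v i : ℝ)) p = (e.coord p).2 := rfl
  have h2 : ((e.coord p).1 + 2 * k * (e.coord p).2, (e.coord p).2) =
      e.coord p + (2 * k * (e.coord p).2, 0) := by ext <;> simp
  rw [h2, map_add, e.pt_coord, shear, h1]
  congr 2
  funext i
  simp [Direction.pt_apply]

include hz in
/-- The product of the two twists lifts the word to the surface, fixes the singularities and acts
trivially on the classes with zero holonomy. -/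
theorem exists_lift {a d n : ℕ} (ha : 1 ≤ a) (hd : 1 ≤ d)
    (h1 : ∃ j : ℤ, side (firstDirection a n) z = j + 1 / 2)
    (h2 : ∃ j : ℤ, side (secondDirection d) z = j + 1 / 2) :
    Nonempty (Direction z) ∧ ∃ f : M z ≃ₜ M z, (∀ m ∈ sing z, f m = m) ∧
      (∀ m p, proj z m = toTorus p → proj z (f m) = toTorus (act (gWord a d n) p)) ∧
      ∀ c ∈ H1zero z, H1map f c = c := by
  have v1 : (fun i => ((![(a : ℤ), -1 - n * a] : Fin 2 → ℤ) i : ℝ)) = firstDirection a n := by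
    funext i; fin_cases i <;> simp [firstDirection]
  have v2 : (fun i => ((![(d : ℤ), 1] : Fin 2 → ℤ) i : ℝ)) = secondDirection d := by
    funext i; fin_cases i <;> simp [secondDirection]
  let e₁ : Direction z := ⟨![(a : ℤ), -1 - n * a], ![1, -n], by simp; ring, by rwa [v1]⟩
  let e₂ : Direction z := ⟨![(d : ℤ), 1], ![-1, 0], by simp, by rwa [v2]⟩
  refine ⟨⟨e₁⟩, (e₁.twist hz (-1)).trans (e₂.twist hz 1), fun m hm => ?_, fun m p hp => ?_,
    fun c hc => ?_⟩
  · change e₂.twist hz 1 (e₁.twist hz (-1) m) = m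
    rw [e₁.twist_of_mem_sing hz (-1) hm, e₂.twist_of_mem_sing hz 1 hm]
  · have := e₂.proj_twist_shear hz 1 (e₁.proj_twist_shear hz (-1) hp)
    rw [act_gWord ha hd, ← v1, ← v2]
    simpa using this
  · rw [H1map_trans, e₁.H1map_twist hz (-1) hc, e₂.H1map_twist hz 1 hc]

end Word

end SlitTori

end

theorem mainTheorem7 (q : ℕ) (r s : ℤ) (hr : |r| < q) (hs : |s| < q) (hs0 : s ≠ 0)
    (hsq : IsCoprime s (q : ℤ)) (hodd : Odd r ∨ Odd s)
    (a d : ℕ) (ha : 4 * q < a ∧ a ≤ 6 * q) (hd : 4 * q < d ∧ d ≤ 6 * q)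
    (hra : r + a * s ≡ -q [ZMOD 2 * q]) (hds : d * s - r ≡ -q [ZMOD 2 * q])
    (m n : ℕ) (hn : n = 8 * q * m)
    (z : SlitTori.Plane) (hz : z = ![(r : ℝ) / (2 * q), (s : ℝ) / (2 * q)]) :
    SlitTori.toTorus (SlitTori.act (SlitTori.gWord a d n) z) = SlitTori.toTorus z ∧
    (∃ f : SlitTori.M z ≃ₜ SlitTori.M z,
      SlitTori.IsAffineWithDerivative (SlitTori.gWord a d n) f ∧
      (∀ p ∈ SlitTori.bullet z, f p ∈ SlitTori.bullet z) ∧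
      (∀ p ∈ SlitTori.circ z, f p ∈ SlitTori.circ z)) ∧
    (∀ f : SlitTori.M z ≃ₜ SlitTori.M z,
      SlitTori.IsAffineWithDerivative (SlitTori.gWord a d n) f →
      (∀ c ∈ SlitTori.H1zero z, SlitTori.H1map f c = c) ∨
      (∀ c ∈ SlitTori.H1zero z, SlitTori.H1map f c = -c)) := by
  have hq : (0 : ℝ) < q := by
    have := (abs_nonneg r).trans_lt hr
    exact_mod_cast this
  have hz0 : z 0 = r / (2 * q) := by rw [hz]; rfl
  have hz1 : z 1 = s / (2 * q) := by rw [hz]; rfl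
  have hlt (t : ℤ) (ht : |t| < q) : |(t : ℝ) / (2 * q)| < 1 / 2 := by
    have h : |(t : ℝ)| < q := by exact_mod_cast ht
    rw [abs_div, abs_of_pos (show (0 : ℝ) < 2 * q by linarith), div_lt_div_iff₀ (by linarith)
      two_pos]
    linarith
  have hA : SlitTori.Admissible z := by
    refine ⟨fun k => ?_, ?_⟩
    · fin_cases k
      · exact hz0 ▸ hlt r hr
      · exact hz1 ▸ hlt s hs
    · rw [hz1]
      have : (s : ℝ) ≠ 0 := by exact_mod_cast hs0
      positivity
  -- The congruences say that the determinants of `z` with the two directions are half-integers.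
  have h1 : ∃ j : ℤ, SlitTori.side (SlitTori.firstDirection a n) z = j + 1 / 2 := by
    obtain ⟨t, ht⟩ := hra.symm.dvd
    have ht' : (r : ℝ) + a * s - -q = 2 * q * t := by exact_mod_cast ht
    refine ⟨t - 1 + 4 * m * a * r, ?_⟩
    simp only [SlitTori.side, SlitTori.firstDirection, hz0, hz1, hn, Matrix.cons_val_zero,
      Matrix.cons_val_one]
    push_cast
    field_simp
    linear_combination ht'
  have h2 : ∃ j : ℤ, SlitTori.side (SlitTori.secondDirection d) z = j + 1 / 2 := by
    obtain ⟨t, ht⟩ := hds.symm.dvd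
    have ht' : (d : ℝ) * s - r - -q = 2 * q * t := by exact_mod_cast ht
    refine ⟨t - 1, ?_⟩
    simp only [SlitTori.side, SlitTori.secondDirection, hz0, hz1, Matrix.cons_val_zero,
      Matrix.cons_val_one]
    push_cast
    field_simp
    linear_combination ht'
  obtain ⟨⟨e⟩, f₀, hfix, hproj, hH⟩ :=
    SlitTori.exists_lift hA (n := n) (show 1 ≤ a by omega) (show 1 ≤ d by omega) h1 h2
  refine ⟨?_, ⟨f₀, SlitTori.isAffineWithDerivative_of_proj
    (fun m hm => (hfix m hm).symm ▸ hm) hproj, fun p hp => (hfix p (Or.inl hp)).symm ▸ hp,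
    fun p hp => (hfix p (Or.inr hp)).symm ▸ hp⟩, fun f hf => ?_⟩
  · -- The fixed singularity `•` lies over `z` and is mapped to a point over the image of `z`.
    obtain ⟨b, hb, -⟩ := SlitTori.exists_point hA (x := SlitTori.toTorus z) (w := 0)
      (by rw [(SlitTori.branch_eq_zero_iff' hA _).2 (Or.inl rfl)]; simp)
    rw [← hproj b z hb, hfix b (Or.inl hb), hb]
  · rcases SlitTori.eq_or_eq_tau_of_isAffineWithDerivative hA e hf hfix hproj with rfl | rfl
    · exact Or.inl hH
    · refine Or.inr fun c hc => ?_
      rw [SlitTori.H1map_trans, hH c hc, e.H1map_tau hA hc]
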